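/- **PL-satisfiability.** *Setting.* A PL knowledge base $\mathcal K$ is a finite set of axioms $\mathsf{func}(R)$, $\mathsf{func}(f)$, $\mathsf{range}(R,A)$, $A\sqsubseteq B$, $\mathsf{disj}(A,B)$, where $A,B$ are concept names, $R$ a role name and $f$ a concrete property name (interpreted as a relation between the domain and $\mathbb N$). Simple PL concepts are given by $C::=A\mid\bot\mid\exists f.[l,u]\mid\exists R.C\mid C\sqcap C$ with $l,u\in\mathbb N$; a PL concept is a union $C_1\sqcup\dots\sqcup C_n$ of simple ones. Let $\mathcal O$ be a $\mathcal{SRIQ}$ knowledge base (for instance a Horn-$\mathcal{SRIQ}$ one) such that $(\mathrm{sig}(\mathcal K)\cup\mathrm{sig}(C))\cap\mathrm{sig}(\mathcal O)$ contains only concept names. Let $\mathcal O^+_{\mathcal K}$ be $\mathcal O$ together with all axioms of the forms $A\sqsubseteq B$ and $\mathsf{disj}(A,B)$ in $\mathcal K$. For a knowledge base $\mathcal O'$, let $pos(\mathcal O')$ be the set of all inclusions $A_1\sqcap\dots\sqcap A_m\sqsubseteq B_1\sqcup\dots\sqcup B_k$ ($m,k\ge 0$; the empty intersection is $\top$, the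 empty union is $\bot$) between concept names of $\mathrm{sig}(\mathcal O')$ that are entailed by $\mathcal O'$. Let $\leadsto$ be the rewriting relation on simple PL concepts given by the following rules, applied to arbitrary subconcepts, where intersections are treated as sets (order and repetition of conjuncts are irrelevant, and the remaining conjuncts $D,D',D''$ standing at the end of a left-hand side may be absent): 1. $\bot\sqcap D\leadsto\bot$; 2. $\exists R.\bot\leadsto\bot$; 3. $\exists f.[l,u]\leadsto\bot$ if $l>u$; 4. $\exists R.D\sqcap\exists R.D'\sqcap D''\leadsto\exists R.(D\sqcap D')\sqcap D''$ if $\mathsf{func}(R)\in\mathcal K$; 5. $\exists f.[l_1,u_1]\sqcap\exists f.[l_2,u_2]\sqcap D\leadsto\exists f.[\max(l_1,l_2),\min(u_1,u_2)]\sqcap D$ if $\mathsf{func}(f)\in\mathcal K$; 6. $\exists R.D\sqcap D'\leadsto\exists R.(D\sqcap A)\sqcap D'$ if $\mathsf{range}(R,A)\in\mathcal K$ and neither $A$ nor $\bot$ is a conjunct of $D$; 7. $A_1\sqcap\dots\sqcap A_n\sqcap D\leadsto\bot$ ($n\ge0$) if $\mathcal O^+_{\mathcal K}\models A_1\sqcap\dots\sqcap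 A_n\sqsubseteq\bot$. *Theorem.* 1. A PL concept $C=C_1\sqcup\dots\sqcup C_n$ is unsatisfiable with respect to $\mathcal K\cup\mathcal O$ if and only if $C_i\leadsto^*\bot$ for all $i\in\{1,\dots,n\}$. 2. For $\mathcal K,\mathcal O,C$ as above, satisfiability of $C$ with respect to $\mathcal K\cup\mathcal O$ is in $\mathsf P^{pos(\mathcal O^+_{\mathcal K})}$: there are one oracle machine and one polynomial $p$ such that for all such $\mathcal K,\mathcal O,C$ the machine, given $(\mathcal K,C)$ and the oracle $pos(\mathcal O^+_{\mathcal K})$, decides in time $p(|(\mathcal K,C)|)$ whether $C$ is satisfiable with respect to $\mathcal K\cup\mathcal O$ (numbers are encoded in binary). Consequently, if $\mathcal L$ is a tractable logic, that is, a set of $\mathcal{SRIQ}$ knowledge bases for which, given $\mathcal O'\in\mathcal L$ and a query $q$, it is decidable in polynomial time whether $q\in pos(\mathcal O')$, then satisfiability of $C$ with respect to $\mathcal K\cup\mathcal O$ is decidable in time polynomial in $|(\mathcal K,\mathcal O,C)|$ for all $\mathcal K,\mathcal O,C$ as above with $\mathcal O^+_{\mathcal K}\in\mathcal L$ (in particular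 for $\mathcal O\in\mathcal L$, when $\mathcal L$ is closed under adding axioms $A\sqsubseteq B$ and $\mathsf{disj}(A,B)$). -/

import Mathlib

namespace PolicyLogic

/-! ## Vocabulary and interpretations

Each of the four kinds of names (concept names, role names, individual names, concrete property
names) is a countably infinite set, represented by `ℕ`. -/

/-- The symbols that can occur in a signature. -/
inductive Symbol where
  | concept (A : ℕ)
  | role (R : ℕ)
  | individual (a : ℕ)
  | property (f : ℕ)

/-- An interpretation. The concrete domain is `ℕ`, so a concrete property is a relation between
the abstract domain and `ℕ`. -/
structure Interp where
  Dom : Type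
  nonempty : Nonempty Dom
  concept : ℕ → Set Dom
  role : ℕ → Dom → Dom → Prop
  individual : ℕ → Dom
  property : ℕ → Dom → ℕ → Prop

/-! ## The policy logic PL -/

/-- Axioms of PL knowledge bases: `func(R)`, `func(f)`, `range(R, A)`, `A ⊑ B`, `disj(A, B)`. -/
inductive PLAxiom where
  | funcRole (R : ℕ)
  | funcProp (f : ℕ)
  | range (R A : ℕ)
  | sub (A B : ℕ)
  | disj (A B : ℕ)

/-- A PL knowledge base is a finite set of PL axioms; it is given by a list of its members. -/
abbrev PLKB := List PLAxiom

/-- Simple PL concepts: `A`, `⊥`, `∃ f.[l, u]`, `∃ R.C`, `C ⊓ D`. -/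
inductive SimplePL where
  | atom (A : ℕ)
  | bot
  | interval (f l u : ℕ)
  | ex (R : ℕ) (C : SimplePL)
  | inter (C D : SimplePL)

/-- A (full) PL concept is the union `C₁ ⊔ … ⊔ Cₙ` of the simple concepts in the list. -/
abbrev PLConcept := List SimplePL

def PLAxiom.Holds (I : Interp) : PLAxiom → Prop
  | .funcRole R => ∀ x y z, I.role R x y → I.role R x z → y = z
  | .funcProp f => ∀ x i j, I.property f x i → I.property f x j → i = j
  | .range R A => ∀ x y, I.role R x y → y ∈ I.concept A
  | .sub A B => I.concept A ⊆ I.concept B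
  | .disj A B => I.concept A ∩ I.concept B = ∅

def SimplePL.ext (I : Interp) : SimplePL → Set I.Dom
  | .atom A => I.concept A
  | .bot => ∅
  | .interval f l u => {x | ∃ i, l ≤ i ∧ i ≤ u ∧ I.property f x i}
  | .ex R C => {x | ∃ y, I.role R x y ∧ y ∈ C.ext I}
  | .inter C D => C.ext I ∩ D.ext I

def PLConcept.ext (I : Interp) (C : PLConcept) : Set I.Dom :=
  {x | ∃ D ∈ C, x ∈ SimplePL.ext I D}

def PLAxiom.sig : PLAxiom → Set Symbol
  | .funcRole R => {.role R}
  | .funcProp f => {.property f}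
  | .range R A => {.role R, .concept A}
  | .sub A B => {.concept A, .concept B}
  | .disj A B => {.concept A, .concept B}

def PLKB.sig (K : PLKB) : Set Symbol := {X | ∃ α ∈ K, X ∈ PLAxiom.sig α}

def SimplePL.sig : SimplePL → Set Symbol
  | .atom A => {.concept A}
  | .bot => ∅
  | .interval f _ _ => {.property f}
  | .ex R C => {.role R} ∪ C.sig
  | .inter C D => C.sig ∪ D.sig

def PLConcept.sig (C : PLConcept) : Set Symbol := {X | ∃ D ∈ C, X ∈ SimplePL.sig D}

/-! ## The description logic SRIQ (the language of the external ontology) -/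

/-- Roles: role names and their inverses. -/
inductive Role where
  | name (R : ℕ)
  | inv (R : ℕ)

inductive SRIQConcept where
  | atom (A : ℕ)
  | top
  | bot
  | inter (C D : SRIQConcept)
  | union (C D : SRIQConcept)
  | compl (C : SRIQConcept)
  | ex (R : Role) (C : SRIQConcept)
  | all (R : Role) (C : SRIQConcept)
  | atLeast (n : ℕ) (S : Role) (C : SRIQConcept)
  | atMost (n : ℕ) (S : Role) (C : SRIQConcept)
  | self (S : Role)

/-- Axioms: `C ⊑ D`, `disj(S₁, S₂)`, `R₁ ∘ … ∘ Rₙ ⊑ R`, `C(a)`, `R(a, b)`. -/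
inductive SRIQAxiom where
  | gci (C D : SRIQConcept)
  | roleDisj (S₁ S₂ : Role)
  | roleIncl (Rs : List Role) (R : Role)
  | conceptAssertion (C : SRIQConcept) (a : ℕ)
  | roleAssertion (R : Role) (a b : ℕ)

/-- A SRIQ knowledge base: a finite set of axioms, given by a list of its members. The usual
decidability restrictions (simple roles, regular role hierarchies) and the further restriction to
Horn axioms are not imposed, so this comprises all Horn-SRIQ knowledge bases. -/
abbrev SRIQKB := List SRIQAxiom

def Role.rel (I : Interp) : Role → I.Dom → I.Dom → Prop
  | .name R => I.role R
  | .inv R => fun x y => I.role R y x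

/-- The composition of a list of roles. -/
def chainRel (I : Interp) : List Role → I.Dom → I.Dom → Prop
  | [] => fun x y => x = y
  | R :: Rs => fun x z => ∃ y, R.rel I x y ∧ chainRel I Rs y z

def SRIQConcept.ext (I : Interp) : SRIQConcept → Set I.Dom
  | .atom A => I.concept A
  | .top => Set.univ
  | .bot => ∅
  | .inter C D => C.ext I ∩ D.ext I
  | .union C D => C.ext I ∪ D.ext I
  | .compl C => (C.ext I)ᶜ
  | .ex R C => {x | ∃ y, R.rel I x y ∧ y ∈ C.ext I}
  | .all R C => {x | ∀ y, R.rel I x y → y ∈ C.ext I}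
  | .atLeast n S C => {x | (n : ℕ∞) ≤ {y | S.rel I x y ∧ y ∈ C.ext I}.encard}
  | .atMost n S C => {x | {y | S.rel I x y ∧ y ∈ C.ext I}.encard ≤ (n : ℕ∞)}
  | .self S => {x | S.rel I x x}

def SRIQAxiom.Holds (I : Interp) : SRIQAxiom → Prop
  | .gci C D => C.ext I ⊆ D.ext I
  | .roleDisj S₁ S₂ => ∀ x y, ¬ (S₁.rel I x y ∧ S₂.rel I x y)
  | .roleIncl Rs R => ∀ x y, chainRel I Rs x y → R.rel I x y
  | .conceptAssertion C a => I.individual a ∈ C.ext I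
  | .roleAssertion R a b => R.rel I (I.individual a) (I.individual b)

def Role.sig : Role → Set Symbol
  | .name R => {.role R}
  | .inv R => {.role R}

def SRIQConcept.sig : SRIQConcept → Set Symbol
  | .atom A => {.concept A}
  | .top => ∅
  | .bot => ∅
  | .inter C D => C.sig ∪ D.sig
  | .union C D => C.sig ∪ D.sig
  | .compl C => C.sig
  | .ex R C => R.sig ∪ C.sig
  | .all R C => R.sig ∪ C.sig
  | .atLeast _ S C => S.sig ∪ C.sig
  | .atMost _ S C => S.sig ∪ C.sig
  | .self S => S.sig

def SRIQAxiom.sig : SRIQAxiom → Set Symbol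
  | .gci C D => C.sig ∪ D.sig
  | .roleDisj S₁ S₂ => S₁.sig ∪ S₂.sig
  | .roleIncl Rs R => {X | ∃ R' ∈ Rs, X ∈ Role.sig R'} ∪ R.sig
  | .conceptAssertion C a => C.sig ∪ {.individual a}
  | .roleAssertion R a b => R.sig ∪ {.individual a, .individual b}

def SRIQKB.sig (O : SRIQKB) : Set Symbol := {X | ∃ α ∈ O, X ∈ SRIQAxiom.sig α}

/-! ## Satisfiability with respect to a main knowledge base and an external ontology -/

def PLKB.Models (I : Interp) (K : PLKB) : Prop := ∀ α ∈ K, PLAxiom.Holds I α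

def SRIQKB.Models (I : Interp) (O : SRIQKB) : Prop := ∀ α ∈ O, SRIQAxiom.Holds I α

/-- `C` is satisfiable with respect to `K ∪ O`. -/
def Satisfiable (K : PLKB) (O : SRIQKB) (C : PLConcept) : Prop :=
  ∃ I : Interp, PLKB.Models I K ∧ SRIQKB.Models I O ∧ (PLConcept.ext I C).Nonempty

/-- The main knowledge base and the concept share only concept names with the ontology. -/
def Admissible (K : PLKB) (O : SRIQKB) (C : PLConcept) : Prop :=
  (PLKB.sig K ∪ PLConcept.sig C) ∩ SRIQKB.sig O ⊆ Set.range Symbol.concept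

/-! ## Oracle queries -/

/-- An oracle query `A₁ ⊓ … ⊓ Aₘ ⊑ B₁ ⊔ … ⊔ Bₖ` between concept names. An empty left-hand side
stands for `⊤`, an empty right-hand side for `⊥`. -/
structure Query where
  lhs : List ℕ
  rhs : List ℕ

def SRIQKB.Entails (O : SRIQKB) (q : Query) : Prop :=
  ∀ I : Interp, SRIQKB.Models I O → ∀ x : I.Dom,
    (∀ A ∈ q.lhs, x ∈ I.concept A) → ∃ B ∈ q.rhs, x ∈ I.concept B

/-- `pos(O)`: the queries over the concept names of `O` that `O` entails. -/
def SRIQKB.pos (O : SRIQKB) : Set Query :=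
  {q | (∀ A ∈ q.lhs ++ q.rhs, Symbol.concept A ∈ SRIQKB.sig O) ∧ SRIQKB.Entails O q}

/-- The ontology axiom corresponding to a PL axiom that is neither a functionality nor a range
axiom; `disj(A, B)` is expressed by `A ⊓ B ⊑ ⊥`. -/
def PLAxiom.shift : PLAxiom → Option SRIQAxiom
  | .funcRole _ => none
  | .funcProp _ => none
  | .range _ _ => none
  | .sub A B => some (.gci (.atom A) (.atom B))
  | .disj A B => some (.gci (.inter (.atom A) (.atom B)) .bot)

/-- `O⁺_K`: the ontology `O` extended with all axioms of `K` that are neither functionality nor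
range axioms. -/
def shifted (K : PLKB) (O : SRIQKB) : SRIQKB := O ++ K.filterMap PLAxiom.shift

/-! ## The normalization rules -/

/-- The conjuncts of a simple concept. -/
def SimplePL.conjuncts : SimplePL → List SimplePL
  | .inter C D => C.conjuncts ++ D.conjuncts
  | C => [C]

/-- Equality of simple concepts when intersections (at any depth) are treated as sets, that is,
up to the order, the grouping and the repetition of conjuncts. -/
inductive SetEq : SimplePL → SimplePL → Prop where
  | refl (C) : SetEq C C
  | symm {C D} : SetEq C D → SetEq D C
  | trans {C D E} : SetEq C D → SetEq D E → SetEq C E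
  | comm (C D) : SetEq (.inter C D) (.inter D C)
  | assoc (C D E) : SetEq (.inter (.inter C D) E) (.inter C (.inter D E))
  | idem (C) : SetEq (.inter C C) C
  | inter {C C' D D'} : SetEq C C' → SetEq D D' → SetEq (.inter C D) (.inter C' D')
  | ex (R) {C C'} : SetEq C C' → SetEq (.ex R C) (.ex R C')

/-- The seven normalization rules with respect to `K` and `O`. The remaining conjuncts of a rule
are supplied by the closure under contexts in `Rewrites`. -/
inductive Rule (K : PLKB) (O : SRIQKB) : SimplePL → SimplePL → Prop where
  | botInter (D) : Rule K O (.inter .bot D) .bot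
  | exBot (R) : Rule K O (.ex R .bot) .bot
  | emptyInterval (f l u) : u < l → Rule K O (.interval f l u) .bot
  | mergeRoles (R D D') : PLAxiom.funcRole R ∈ K →
      Rule K O (.inter (.ex R D) (.ex R D')) (.ex R (.inter D D'))
  | mergeIntervals (f l₁ u₁ l₂ u₂) : PLAxiom.funcProp f ∈ K →
      Rule K O (.inter (.interval f l₁ u₁) (.interval f l₂ u₂))
        (.interval f (max l₁ l₂) (min u₁ u₂))
  | addRange (R A D) : PLAxiom.range R A ∈ K →
      SimplePL.atom A ∉ D.conjuncts → SimplePL.bot ∉ D.conjuncts →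
      Rule K O (.ex R D) (.ex R (.inter D (.atom A)))
  | inconsistent (C) (As : List ℕ) : (∀ A ∈ As, SimplePL.atom A ∈ C.conjuncts) →
      SRIQKB.Entails (shifted K O) ⟨As, []⟩ → Rule K O C .bot

/-- One rewriting step: a rule is applied to a subconcept, intersections being treated as
sets. -/
inductive Rewrites (K : PLKB) (O : SRIQKB) : SimplePL → SimplePL → Prop where
  | rule {C C'} : Rule K O C C' → Rewrites K O C C'
  | inter {C C'} (D) : Rewrites K O C C' → Rewrites K O (.inter C D) (.inter C' D)
  | ex (R) {C C'} : Rewrites K O C C' → Rewrites K O (.ex R C) (.ex R C')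
  | setEq {C C₁ C₂ C'} : SetEq C C₁ → Rewrites K O C₁ C₂ → SetEq C₂ C' → Rewrites K O C C'

/-! ## Oracle machines and polynomial time

The machine has finitely many registers (those named in its program) that hold binary trees. An
instruction is charged one unit plus the number of nodes of all the trees it reads; in particular
copying and asking the oracle cost at least the size of the data involved. Up to a polynomial, this
is the time of an oracle Turing machine, on words that list the nodes of the trees. -/

inductive Data where
  | nil
  | cons (a b : Data)

/-- The number of nodes. -/
def Data.size : Data → ℕ
  | .nil => 1
  | .cons a b => 1 + a.size + b.size

def Data.head : Data → Data
  | .nil => .nil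
  | .cons a _ => a

def Data.tail : Data → Data
  | .nil => .nil
  | .cons _ b => b

/-- Programs. In `ifElse x p q` and `whileDo x p` the test is whether register `x` differs from
`nil`; `query x y` asks the oracle about the content of `y` and stores the answer in `x`. -/
inductive Program where
  | setNil (x : ℕ)
  | copy (x y : ℕ)
  | cons (x y z : ℕ)
  | head (x y : ℕ)
  | tail (x y : ℕ)
  | query (x y : ℕ)
  | seq (p q : Program)
  | ifElse (x : ℕ) (p q : Program)
  | whileDo (x : ℕ) (p : Program)

abbrev Store := ℕ → Data

/-- `Runs Ω p s t s'`: with oracle `Ω`, the program `p` started in store `s` halts in store `s'`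
after time `t`. -/
inductive Runs (Ω : Set Data) : Program → Store → ℕ → Store → Prop where
  | setNil (x s) : Runs Ω (.setNil x) s 1 (Function.update s x .nil)
  | copy (x y s) : Runs Ω (.copy x y) s (1 + (s y).size) (Function.update s x (s y))
  | cons (x y z s) : Runs Ω (.cons x y z) s (1 + (s y).size + (s z).size)
      (Function.update s x (.cons (s y) (s z)))
  | head (x y s) : Runs Ω (.head x y) s (1 + (s y).size) (Function.update s x (s y).head)
  | tail (x y s) : Runs Ω (.tail x y) s (1 + (s y).size) (Function.update s x (s y).tail)
  | queryYes (x y s) : s y ∈ Ω →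
      Runs Ω (.query x y) s (1 + (s y).size) (Function.update s x (.cons .nil .nil))
  | queryNo (x y s) : s y ∉ Ω →
      Runs Ω (.query x y) s (1 + (s y).size) (Function.update s x .nil)
  | seq {p q s s' s'' t t'} : Runs Ω p s t s' → Runs Ω q s' t' s'' →
      Runs Ω (.seq p q) s (t + t') s''
  | ifTrue {x p q s s' t} : s x ≠ .nil → Runs Ω p s t s' → Runs Ω (.ifElse x p q) s (1 + t) s'
  | ifFalse {x p q s s' t} : s x = .nil → Runs Ω q s t s' → Runs Ω (.ifElse x p q) s (1 + t) s'
  | whileStop {x p s} : s x = .nil → Runs Ω (.whileDo x p) s 1 s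
  | whileStep {x p s s' s'' t t'} : s x ≠ .nil → Runs Ω p s t s' →
      Runs Ω (.whileDo x p) s' t' s'' → Runs Ω (.whileDo x p) s (1 + t + t') s''

/-- The store in which register `0` holds the input and all other registers are empty. -/
def startStore (d : Data) : Store := Function.update (fun _ => .nil) 0 d

/-- One program decides, in time polynomial in the size of the encoded input, whether `L x` holds,
for all instances `x` that satisfy `promise`; on the instance `x` the oracle `oracle x` is
available. A run accepts if register `0` finally differs from `nil`. -/
def PolyTimeDecidable {α : Type} (encode : α → Data) (oracle : α → Set Data)
    (promise L : α → Prop) : Prop :=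
  ∃ (p : Program) (P : Polynomial ℕ), ∀ x, promise x →
    ∃ (t : ℕ) (s : Store), Runs (oracle x) p (startStore (encode x)) t s ∧
      t ≤ P.eval (encode x).size ∧ (s 0 ≠ .nil ↔ L x)

/-! ## Encodings -/

def encodeList {α : Type} (e : α → Data) : List α → Data
  | [] => .nil
  | a :: l => .cons (e a) (encodeList e l)

def encodeBit : Bool → Data
  | false => .nil
  | true => .cons .nil .nil

/-- Natural numbers (interval bounds, numbers in number restrictions, names) are written in
binary, least significant bit first. -/
def encodeNat (n : ℕ) : Data := encodeList encodeBit n.bits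

def encodeNats (l : List ℕ) : Data := encodeList encodeNat l

/-- A value marked with the number of its constructor. -/
def tagged (k : ℕ) (d : Data) : Data := .cons (encodeNat k) d

def PLAxiom.encode : PLAxiom → Data
  | .funcRole R => tagged 0 (encodeNat R)
  | .funcProp f => tagged 1 (encodeNat f)
  | .range R A => tagged 2 (encodeNats [R, A])
  | .sub A B => tagged 3 (encodeNats [A, B])
  | .disj A B => tagged 4 (encodeNats [A, B])

def SimplePL.encode : SimplePL → Data
  | .atom A => tagged 0 (encodeNat A)
  | .bot => tagged 1 .nil
  | .interval f l u => tagged 2 (encodeNats [f, l, u])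
  | .ex R C => tagged 3 (.cons (encodeNat R) C.encode)
  | .inter C D => tagged 4 (.cons C.encode D.encode)

def Role.encode : Role → Data
  | .name R => tagged 0 (encodeNat R)
  | .inv R => tagged 1 (encodeNat R)

def SRIQConcept.encode : SRIQConcept → Data
  | .atom A => tagged 0 (encodeNat A)
  | .top => tagged 1 .nil
  | .bot => tagged 2 .nil
  | .inter C D => tagged 3 (.cons C.encode D.encode)
  | .union C D => tagged 4 (.cons C.encode D.encode)
  | .compl C => tagged 5 C.encode
  | .ex R C => tagged 6 (.cons R.encode C.encode)
  | .all R C => tagged 7 (.cons R.encode C.encode)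
  | .atLeast n S C => tagged 8 (.cons (encodeNat n) (.cons S.encode C.encode))
  | .atMost n S C => tagged 9 (.cons (encodeNat n) (.cons S.encode C.encode))
  | .self S => tagged 10 S.encode

def SRIQAxiom.encode : SRIQAxiom → Data
  | .gci C D => tagged 0 (.cons C.encode D.encode)
  | .roleDisj S₁ S₂ => tagged 1 (.cons S₁.encode S₂.encode)
  | .roleIncl Rs R => tagged 2 (.cons (encodeList Role.encode Rs) R.encode)
  | .conceptAssertion C a => tagged 3 (.cons C.encode (encodeNat a))
  | .roleAssertion R a b => tagged 4 (.cons R.encode (encodeNats [a, b]))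

def PLKB.encode (K : PLKB) : Data := encodeList PLAxiom.encode K

def PLConcept.encode (C : PLConcept) : Data := encodeList SimplePL.encode C

def SRIQKB.encode (O : SRIQKB) : Data := encodeList SRIQAxiom.encode O

def Query.encode (q : Query) : Data := .cons (encodeNats q.lhs) (encodeNats q.rhs)

/-! ## The decision problems -/

/-- A main knowledge base, an external ontology, and a concept. -/
structure Problem where
  K : PLKB
  O : SRIQKB
  C : PLConcept

/-- The input of a machine that has access to the ontology only through an oracle. -/
def Problem.encodeWithoutOntology (π : Problem) : Data :=
  .cons (PLKB.encode π.K) (PLConcept.encode π.C)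

def Problem.encode (π : Problem) : Data :=
  .cons (PLKB.encode π.K) (.cons (SRIQKB.encode π.O) (PLConcept.encode π.C))

/-- The oracle `pos(O⁺_K)`. -/
def Problem.posOracle (π : Problem) : Set Data :=
  Query.encode '' SRIQKB.pos (shifted π.K π.O)

/-- A logic, that is, a set of knowledge bases, is tractable if membership in `pos(O)` is decidable
in polynomial time, given `O` in the logic and the query. -/
def Tractable (𝓛 : Set SRIQKB) : Prop :=
  PolyTimeDecidable (α := SRIQKB × Query)
    (fun x => .cons (SRIQKB.encode x.1) (Query.encode x.2)) (fun _ => ∅)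
    (fun x => x.1 ∈ 𝓛) (fun x => x.2 ∈ SRIQKB.pos x.1)

end PolicyLogic

open PolicyLogic

/-! The proof goes through a tableau. A label is a list of simple concepts read as a conjunction.
`Consistent` performs local tests on its conjuncts (no `⊥`, nonempty intervals, compatible intervals
for functional properties, no contradiction among the concept names known to `O⁺_K`) and recurses
into the successors that the label forces: one per existential for an ordinary role, a single merged
one per functional role, always with the range atoms added.

Three implications close a cycle. A label that fails the tableau can be rewritten to `⊥`, because
every failing test is the left-hand side of a rule (`refuted_of_not_consistent`). Rewriting
preserves extensions in all models of `K` and `O`, so a refuted concept is unsatisfiable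
(`Refuted.ext_eq_empty`). A label that passes has a model (`Consistent.exists_model`): a
countermodel of the local oracle query supplies an individual `d` and a model of `O⁺_K` around it,
the names outside the signature are reinterpreted, and models of the forced successors are attached
to `d` by new edges. These edges carry roles unknown to `O`, so for the ontology the result is a
disjoint union of its models. SRIQ as defined here has neither nominals nor a universal role, hence
its axioms survive disjoint unions when the individual names are kept in one component
(`models_of_components`).

For the complexity bounds, polynomial-time functions on register machines are shown to be closed
under composition, pairing, case distinction and bounded loops (`PolyFun`). The tableau becomes a
worklist loop. It needs no branching, and every existential passes its filler to exactly one
successor; paying each existential enough to cover the range atoms it triggers gives a potential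
that bounds the worklist and decreases with every processed label (`sum_potential_lt`). For a
tractable logic, `O⁺_K` is computed first and each oracle query is replaced by a run of the decision
procedure. -/

namespace PolicyLogic

/-! ## The tableau for conjunctions of simple concepts -/

namespace SimplePL

/-- The name of an atomic concept, as a list with at most one member. -/
def atomNames : SimplePL → List ℕ
  | .atom A => [A]
  | _ => []

/-- The property and the bounds of an interval concept, as a list with at most one member. -/
def intervals : SimplePL → List (ℕ × ℕ × ℕ)
  | .interval f l u => [(f, l, u)]
  | _ => []

/-- The role and the filler of an existential concept, as a list with at most one member. -/
def successors : SimplePL → List (ℕ × SimplePL)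
  | .ex R C => [(R, C)]
  | _ => []

def isBot : SimplePL → Bool
  | .bot => true
  | _ => false

/-- The nesting depth of existential concepts. -/
def depth : SimplePL → ℕ
  | .ex _ C => C.depth + 1
  | .inter C D => max C.depth D.depth
  | _ => 0

@[simp] theorem mem_atomNames {C : SimplePL} {A : ℕ} : A ∈ C.atomNames ↔ C = .atom A := by
  cases C <;> simp [atomNames, eq_comm]

@[simp] theorem mem_intervals {C : SimplePL} {p : ℕ × ℕ × ℕ} :
    p ∈ C.intervals ↔ C = .interval p.1 p.2.1 p.2.2 := by
  obtain ⟨f, l, u⟩ := p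
  cases C <;> simp [intervals, eq_comm]

@[simp] theorem mem_successors {C : SimplePL} {p : ℕ × SimplePL} :
    p ∈ C.successors ↔ C = .ex p.1 p.2 := by
  obtain ⟨R, D⟩ := p
  cases C <;> simp [successors, eq_comm]

@[simp] theorem isBot_iff {C : SimplePL} : C.isBot = true ↔ C = .bot := by
  cases C <;> simp [isBot]

theorem ext_of_mem_conjuncts {I : Interp} {x : I.Dom} {C : SimplePL} :
    x ∈ C.ext I ↔ ∀ D ∈ C.conjuncts, x ∈ D.ext I := by
  induction C with
  | inter C D hC hD =>
    simp only [conjuncts, List.mem_append]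
    rw [show ext I (C.inter D) = C.ext I ∩ D.ext I from rfl, Set.mem_inter_iff, hC, hD]
    exact ⟨fun h E hE => hE.elim (h.1 E) (h.2 E), fun h => ⟨fun E hE => h E (.inl hE),
      fun E hE => h E (.inr hE)⟩⟩
  | _ => simp [conjuncts]

theorem depth_le_of_mem_conjuncts {C D : SimplePL} (h : D ∈ C.conjuncts) : D.depth ≤ C.depth := by
  induction C with
  | inter C E hC hE =>
    rcases List.mem_append.1 h with h | h
    · exact (hC h).trans (le_max_left _ _)
    · exact (hE h).trans (le_max_right _ _)
  | _ => simp [conjuncts] at h; simp [h]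

theorem sig_subset_of_mem_conjuncts {C D : SimplePL} (h : D ∈ C.conjuncts) : D.sig ⊆ C.sig := by
  induction C with
  | inter C E hC hE =>
    rcases List.mem_append.1 h with h | h
    · exact (hC h).trans Set.subset_union_left
    · exact (hE h).trans Set.subset_union_right
  | _ => simp [conjuncts] at h; simp [h]

/-- Idempotence lets a conjunct be copied to the front while the whole concept stays behind as the
remainder. No conjunct ever has to be deleted in order to match a rule. -/
theorem setEq_inter_of_mem_conjuncts {C D : SimplePL} (h : D ∈ C.conjuncts) :
    SetEq C (.inter D C) := by
  induction C with
  | inter C E hC hE =>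
    rcases List.mem_append.1 h with h | h
    · exact (SetEq.inter (hC h) (.refl _)).trans (.assoc _ _ _)
    · exact (SetEq.inter (.refl _) (hE h)).trans <| ((SetEq.assoc _ _ _).symm.trans <|
        (SetEq.inter (.comm _ _) (.refl _)).trans (.assoc _ _ _))
  | _ => simp only [conjuncts, List.mem_singleton] at h; subst h; exact (SetEq.idem _).symm

end SimplePL

/-! ### Reading off functionality and range axioms -/

namespace PLAxiom

def functionalRoles : PLAxiom → List ℕ
  | .funcRole R => [R]
  | _ => []

def functionalProperties : PLAxiom → List ℕ
  | .funcProp f => [f]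
  | _ => []

def ranges : PLAxiom → List (ℕ × ℕ)
  | .range R A => [(R, A)]
  | _ => []

@[simp] theorem mem_functionalRoles {α : PLAxiom} {R : ℕ} :
    R ∈ α.functionalRoles ↔ α = .funcRole R := by
  cases α <;> simp [functionalRoles, eq_comm]

@[simp] theorem mem_functionalProperties {α : PLAxiom} {f : ℕ} :
    f ∈ α.functionalProperties ↔ α = .funcProp f := by
  cases α <;> simp [functionalProperties, eq_comm]

@[simp] theorem mem_ranges {α : PLAxiom} {p : ℕ × ℕ} : p ∈ α.ranges ↔ α = .range p.1 p.2 := by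
  obtain ⟨R, A⟩ := p
  cases α <;> simp [ranges, eq_comm]

end PLAxiom

namespace PLKB

def isFunctionalRole (K : PLKB) (R : ℕ) : Bool :=
  (K.flatMap PLAxiom.functionalRoles).any fun R' => decide (R' = R)

def isFunctionalProperty (K : PLKB) (f : ℕ) : Bool :=
  (K.flatMap PLAxiom.functionalProperties).any fun f' => decide (f' = f)

/-- The atomic concepts that `K` requires of the successors with respect to `R`. -/
def rangeAtoms (K : PLKB) (R : ℕ) : List SimplePL :=
  ((K.flatMap PLAxiom.ranges).filter fun p => decide (p.1 = R)).map fun p => .atom p.2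

@[simp] theorem isFunctionalRole_iff {K : PLKB} {R : ℕ} :
    K.isFunctionalRole R = true ↔ .funcRole R ∈ K := by
  simp [isFunctionalRole]

@[simp] theorem isFunctionalProperty_iff {K : PLKB} {f : ℕ} :
    K.isFunctionalProperty f = true ↔ .funcProp f ∈ K := by
  simp [isFunctionalProperty]

@[simp] theorem mem_rangeAtoms {K : PLKB} {R : ℕ} {C : SimplePL} :
    C ∈ K.rangeAtoms R ↔ ∃ A, .range R A ∈ K ∧ C = .atom A := by
  simp only [rangeAtoms, List.mem_map, List.mem_filter, List.mem_flatMap, PLAxiom.mem_ranges,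
    exists_eq_right, decide_eq_true_eq, Prod.exists]
  constructor
  · rintro ⟨R', A, ⟨h, rfl⟩, rfl⟩
    exact ⟨A, h, rfl⟩
  · rintro ⟨A, h, rfl⟩
    exact ⟨R, A, ⟨h, rfl⟩, rfl⟩

end PLKB

/-! ### Labels, local tests and required successors -/

/-- A list with the members of `l`, without repetitions. -/
def distinct (l : List ℕ) : List ℕ :=
  l.foldl (fun acc a => bif acc.any (fun b => decide (b = a)) then acc else a :: acc) []

theorem mem_distinct_aux {l acc : List ℕ} {a : ℕ} :
    a ∈ l.foldl (fun acc a => bif acc.any (fun b => decide (b = a)) then acc else a :: acc) acc ↔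
      a ∈ l ∨ a ∈ acc := by
  induction l generalizing acc with
  | nil => simp
  | cons b l ih =>
    rw [List.foldl_cons, ih]
    by_cases h : b ∈ acc
    · have : (acc.any fun c => decide (c = b)) = true := by simpa using h
      rw [this, cond_true, List.mem_cons]
      constructor
      · tauto
      · rintro ((rfl | h') | h') <;> tauto
    · have : (acc.any fun c => decide (c = b)) = false := by
        simp only [List.any_eq_false, decide_eq_true_eq]
        exact fun x hx e => h (e ▸ hx)
      rw [this, cond_false, List.mem_cons, List.mem_cons]
      tauto

@[simp] theorem mem_distinct {l : List ℕ} {a : ℕ} : a ∈ distinct l ↔ a ∈ l := by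
  simp [distinct, mem_distinct_aux]

/-- All conjuncts of the concepts in a list. -/
def allConjuncts (L : List SimplePL) : List SimplePL := (L.flatMap SimplePL.conjuncts).reverse

@[simp] theorem mem_allConjuncts {L : List SimplePL} {C : SimplePL} :
    C ∈ allConjuncts L ↔ ∃ D ∈ L, C ∈ D.conjuncts := by
  simp [allConjuncts]

/-- The conditions on the conjuncts `N` of an individual that do not concern its successors. The
function `q` answers the oracle queries; the query `A ⊑ A` asks whether `A` occurs in the
ontology. -/
def locallyConsistent (K : PLKB) (q : Query → Bool) (N : List SimplePL) : Bool :=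
  (!(N.any SimplePL.isBot)) &&
  ((!(q ⟨(N.flatMap SimplePL.atomNames).filter fun A => q ⟨[A], [A]⟩, []⟩)) &&
  (((N.flatMap SimplePL.intervals).all fun p => decide (p.2.1 ≤ p.2.2)) &&
  ((N.flatMap SimplePL.intervals).all fun p => (N.flatMap SimplePL.intervals).all fun p' =>
    (!(decide (p.1 = p'.1) && K.isFunctionalProperty p.1)) || decide (p.2.1 ≤ p'.2.2))))

/-- The successors that the conjuncts `N` require: one for each existential concept with a role that
is not functional, and one for each functional role. -/
def requiredSuccessors (K : PLKB) (N : List SimplePL) : List (ℕ × List SimplePL) :=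
  ((N.flatMap SimplePL.successors).filter fun p => !(K.isFunctionalRole p.1)).map
    (fun p => (p.1, p.2 :: K.rangeAtoms p.1)) ++
  (distinct (((N.flatMap SimplePL.successors).filter fun p => K.isFunctionalRole p.1).map
    Prod.fst)).map
    fun R => (R, ((N.flatMap SimplePL.successors).filter fun p => decide (p.1 = R)).map Prod.snd ++
      K.rangeAtoms R)

/-- The conjunction of the concepts in a list passes all tests of the tableau. -/
inductive Consistent (K : PLKB) (q : Query → Bool) : List SimplePL → Prop where
  | intro (L) : locallyConsistent K q (allConjuncts L) = true →
      (∀ c ∈ requiredSuccessors K (allConjuncts L), Consistent K q c.2) → Consistent K q L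

theorem mem_requiredSuccessors {K : PLKB} {N : List SimplePL} {c : ℕ × List SimplePL} :
    c ∈ requiredSuccessors K N ↔
      (∃ D, .ex c.1 D ∈ N ∧ .funcRole c.1 ∉ K ∧ c.2 = D :: K.rangeAtoms c.1) ∨
      (.funcRole c.1 ∈ K ∧ (∃ D, .ex c.1 D ∈ N) ∧
        c.2 = ((N.flatMap SimplePL.successors).filter fun p => decide (p.1 = c.1)).map Prod.snd ++
          K.rangeAtoms c.1) := by
  obtain ⟨R, L⟩ := c
  simp only [requiredSuccessors, List.mem_append, List.mem_map, List.mem_filter, List.mem_flatMap,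
    SimplePL.mem_successors, exists_eq_right, mem_distinct, Prod.exists, Prod.mk.injEq,
    Bool.not_eq_true', ← Bool.not_eq_true, PLKB.isFunctionalRole_iff]
  constructor
  · rintro (⟨R', D, ⟨h, h'⟩, rfl, rfl⟩ | ⟨R', ⟨R'', D, ⟨h, h'⟩, rfl⟩, rfl, rfl⟩)
    · exact .inl ⟨D, h, h', rfl⟩
    · exact .inr ⟨h', ⟨D, h⟩, rfl⟩
  · rintro (⟨D, h, h', e⟩ | ⟨h', ⟨D, h⟩, e⟩)
    · exact .inl ⟨R, D, ⟨h, h'⟩, rfl, e.symm⟩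
    · exact .inr ⟨R, ⟨R, D, ⟨h, h'⟩, rfl⟩, rfl, e.symm⟩

/-- Bounds what a successor can contain; both the decrease of the nesting depth and the control of
the role names in a label rest on it. -/
theorem mem_successor_label {K : PLKB} {N : List SimplePL} {c : ℕ × List SimplePL}
    (hc : c ∈ requiredSuccessors K N) {D : SimplePL} (hD : D ∈ c.2) :
    .ex c.1 D ∈ N ∨ ∃ A, .range c.1 A ∈ K ∧ D = .atom A := by
  rcases mem_requiredSuccessors.1 hc with ⟨E, hE, -, h⟩ | ⟨-, -, h⟩
  · rw [h, List.mem_cons] at hD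
    rcases hD with rfl | hD
    · exact .inl hE
    · exact .inr (PLKB.mem_rangeAtoms.1 hD)
  · rw [h, List.mem_append] at hD
    rcases hD with hD | hD
    · left
      simp only [List.mem_map, List.mem_filter, List.mem_flatMap, SimplePL.mem_successors,
        exists_eq_right, Prod.exists, decide_eq_true_eq] at hD
      exact hD
    · exact .inr (PLKB.mem_rangeAtoms.1 hD)

theorem rangeAtoms_subset_successor {K : PLKB} {N : List SimplePL} {c : ℕ × List SimplePL}
    (hc : c ∈ requiredSuccessors K N) : K.rangeAtoms c.1 ⊆ c.2 := by
  rcases mem_requiredSuccessors.1 hc with ⟨E, hE, -, h⟩ | ⟨-, -, h⟩ <;> rw [h] <;> simp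

theorem exists_requiredSuccessor {K : PLKB} {N : List SimplePL} {R : ℕ} {D : SimplePL}
    (h : .ex R D ∈ N) : ∃ c ∈ requiredSuccessors K N, c.1 = R ∧ D ∈ c.2 := by
  by_cases hR : .funcRole R ∈ K
  · refine ⟨(R, ((N.flatMap SimplePL.successors).filter fun p => decide (p.1 = R)).map Prod.snd ++
      K.rangeAtoms R), mem_requiredSuccessors.2 (.inr ⟨hR, ⟨D, h⟩, rfl⟩), rfl, ?_⟩
    simp only [List.mem_append, List.mem_map, List.mem_filter, List.mem_flatMap,
      SimplePL.mem_successors, exists_eq_right, decide_eq_true_eq]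
    exact .inl ⟨(R, D), ⟨h, rfl⟩, rfl⟩
  · exact ⟨(R, D :: K.rangeAtoms R), mem_requiredSuccessors.2 (.inl ⟨D, h, hR, rfl⟩), rfl,
      by simp⟩

/-- All fillers of a functional role are merged into one successor. This is what makes the role
functional in the constructed model. -/
theorem requiredSuccessor_unique {K : PLKB} {N : List SimplePL} {c c' : ℕ × List SimplePL}
    (hc : c ∈ requiredSuccessors K N) (hc' : c' ∈ requiredSuccessors K N) (h : c.1 = c'.1)
    (hf : .funcRole c.1 ∈ K) : c = c' := by
  obtain ⟨R, L⟩ := c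
  obtain ⟨R', L'⟩ := c'
  obtain rfl : R = R' := h
  rcases mem_requiredSuccessors.1 hc with ⟨E, -, h, -⟩ | ⟨-, -, h⟩
  · exact absurd hf h
  rcases mem_requiredSuccessors.1 hc' with ⟨E, -, h, -⟩ | ⟨-, -, h'⟩
  · exact absurd hf h
  exact Prod.ext rfl (h.trans h'.symm)

theorem locallyConsistent_iff {K : PLKB} {q : Query → Bool} {N : List SimplePL} :
    locallyConsistent K q N = true ↔
      .bot ∉ N ∧
      q ⟨(N.flatMap SimplePL.atomNames).filter fun A => q ⟨[A], [A]⟩, []⟩ = false ∧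
      (∀ f l u, .interval f l u ∈ N → l ≤ u) ∧
      ∀ f l u l' u', .funcProp f ∈ K → .interval f l u ∈ N → .interval f l' u' ∈ N → l ≤ u' := by
  simp only [locallyConsistent, Bool.and_eq_true, Bool.not_eq_true', List.all_eq_true,
    List.mem_flatMap, SimplePL.mem_intervals, exists_eq_right, Bool.or_eq_true, decide_eq_true_eq,
    ← Bool.not_eq_true, PLKB.isFunctionalProperty_iff, List.any_eq_true, SimplePL.isBot_iff,
    Prod.forall]
  refine and_congr_right fun _ => and_congr_right fun _ => and_congr_right fun _ => ⟨?_, ?_⟩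
  · intro h f l u l' u' hf h1 h2
    exact (h f l u h1 f l' u' h2).resolve_left fun h => h ⟨rfl, hf⟩
  · intro h f l u h1 f' l' u' h2
    by_cases hf : f = f' ∧ .funcProp f ∈ K
    · obtain ⟨rfl, hf⟩ := hf
      exact .inr (h f l u l' u' hf h1 h2)
    · exact .inl hf

/-! ## Rewriting inconsistent conjunctions to `⊥` -/

/-- `C` can be rewritten to `⊥`. -/
def Refuted (K : PLKB) (O : SRIQKB) (C : SimplePL) : Prop :=
  Relation.ReflTransGen (Rewrites K O) C .bot

namespace Refuted

variable {K : PLKB} {O : SRIQKB}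

theorem of_step {C D : SimplePL} (h : Rewrites K O C D) (hD : Refuted K O D) : Refuted K O C :=
  Relation.ReflTransGen.head h hD

theorem of_rule {C : SimplePL} (h : Rule K O C .bot) : Refuted K O C :=
  of_step (.rule h) .refl

theorem of_setEq {C D : SimplePL} (h : SetEq C D) (hD : Refuted K O D) : Refuted K O C := by
  rcases Relation.ReflTransGen.cases_head hD with rfl | ⟨E, hE, hE'⟩
  -- `Rewrites` absorbs `SetEq` only around an actual step. If the derivation is empty, `C` is
  -- set-equal to `⊥`, hence to `⊥ ⊓ ⊥`, and the first rule provides a step.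
  · exact of_step (.setEq (h.trans (SetEq.idem _).symm) (.rule (.botInter _)) (.refl _)) .refl
  · exact of_step (.setEq h hE (.refl _)) hE'

theorem inter {C : SimplePL} (D : SimplePL) (hC : Refuted K O C) : Refuted K O (.inter C D) := by
  refine Relation.ReflTransGen.trans ?_ (of_rule (.botInter D))
  exact Relation.ReflTransGen.lift (fun E => SimplePL.inter E D) (fun _ _ h => Rewrites.inter D h) _ _ hC

theorem ex {C : SimplePL} (R : ℕ) (hC : Refuted K O C) : Refuted K O (.ex R C) := by
  refine Relation.ReflTransGen.trans ?_ (of_rule (.exBot R))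
  exact Relation.ReflTransGen.lift (SimplePL.ex R) (fun _ _ h => Rewrites.ex R h) _ _ hC

theorem of_mem_conjuncts {C D : SimplePL} (h : D ∈ C.conjuncts) (hD : Refuted K O D) :
    Refuted K O C :=
  of_setEq (SimplePL.setEq_inter_of_mem_conjuncts h) (hD.inter C)

theorem of_mem_conjuncts₂ {C D D' : SimplePL} (h : D ∈ C.conjuncts) (h' : D' ∈ C.conjuncts)
    (hD : Refuted K O (.inter D D')) : Refuted K O C :=
  of_setEq ((SimplePL.setEq_inter_of_mem_conjuncts h').trans <|
    (SetEq.inter (.refl _) (SimplePL.setEq_inter_of_mem_conjuncts h)).trans <|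
    (SetEq.assoc _ _ _).symm.trans (.inter (.comm _ _) (.refl _))) (hD.inter C)

/-- Range atoms can be added to a filler before refuting it. -/
theorem ex_of_ranges {R : ℕ} (As : List SimplePL)
    (hAs : ∀ B ∈ As, ∃ A, PLAxiom.range R A ∈ K ∧ B = .atom A) (D : SimplePL)
    (h : ∀ E : SimplePL, D.conjuncts ⊆ E.conjuncts → As ⊆ E.conjuncts → Refuted K O E) :
    Refuted K O (.ex R D) := by
  induction As generalizing D with
  | nil => exact (h D (List.Subset.refl _) (by simp)).ex R
  | cons B As ih =>
    have ih := ih fun B hB => hAs B (List.mem_cons_of_mem _ hB)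
    obtain ⟨A, hA, rfl⟩ := hAs B List.mem_cons_self
    -- The side conditions of `addRange` cost nothing: an atom that is present need not be added,
    -- and a filler with the conjunct `⊥` is refuted at once.
    by_cases h1 : .atom A ∈ D.conjuncts
    · exact ih D fun E hE hE' => h E hE (List.cons_subset.2 ⟨hE h1, hE'⟩)
    by_cases h2 : .bot ∈ D.conjuncts
    · exact (of_mem_conjuncts h2 .refl).ex R
    refine of_step (.rule (.addRange R A D hA h1 h2)) (ih _ fun E hE hE' => h E ?_ ?_)
    · exact fun x hx => hE (List.mem_append_left _ hx)
    · exact List.cons_subset.2 ⟨hE (List.mem_append_right _ (by simp [SimplePL.conjuncts])), hE'⟩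

/-- The fillers of a functional role can be merged before refuting them. -/
theorem inter_ex_of_merge {R : ℕ} (hR : PLAxiom.funcRole R ∈ K) {C : SimplePL}
    (Ds : List SimplePL) (hDs : ∀ D ∈ Ds, SimplePL.ex R D ∈ C.conjuncts) (D : SimplePL)
    (h : ∀ E : SimplePL, D.conjuncts ⊆ E.conjuncts → (∀ D' ∈ Ds, D'.conjuncts ⊆ E.conjuncts) →
      Refuted K O (.ex R E)) :
    Refuted K O (.inter (.ex R D) C) := by
  induction Ds generalizing D with
  | nil => exact (h D (List.Subset.refl _) (by simp)).inter C
  | cons F Ds ih =>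
    -- Only a copy of `∃ R.F` is merged; the original stays in `C`, so the induction hypothesis
    -- applies with the same `C`.
    refine of_setEq ((SetEq.inter (.refl _) (SimplePL.setEq_inter_of_mem_conjuncts
      (hDs F List.mem_cons_self))).trans (SetEq.assoc _ _ _).symm)
      (of_step (.inter C (.rule (.mergeRoles R D F hR))) ?_)
    refine ih (fun D hD => hDs D (List.mem_cons_of_mem _ hD)) _ fun E hE hE' => h E ?_ ?_
    · exact fun x hx => hE (List.mem_append_left _ hx)
    · exact List.forall_mem_cons.2 ⟨fun x hx => hE (List.mem_append_right _ hx), hE'⟩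

/-- A concept is refuted if its conjuncts require a successor that is refuted. -/
theorem of_requiredSuccessor {C : SimplePL} {N : List SimplePL} (hN : N ⊆ C.conjuncts)
    {c : ℕ × List SimplePL} (hc : c ∈ requiredSuccessors K N)
    (h : ∀ E : SimplePL, (∀ D ∈ c.2, D.conjuncts ⊆ E.conjuncts) → Refuted K O E) :
    Refuted K O C := by
  have key : ∀ D : SimplePL, (∀ E : SimplePL, D.conjuncts ⊆ E.conjuncts →
      K.rangeAtoms c.1 ⊆ E.conjuncts → Refuted K O E) → Refuted K O (.ex c.1 D) :=
    ex_of_ranges _ fun B hB => PLKB.mem_rangeAtoms.1 hB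
  have hat : ∀ E : SimplePL, K.rangeAtoms c.1 ⊆ E.conjuncts →
      ∀ B ∈ K.rangeAtoms c.1, B.conjuncts ⊆ E.conjuncts := by
    intro E hE B hB
    obtain ⟨A, -, rfl⟩ := PLKB.mem_rangeAtoms.1 hB
    simpa [SimplePL.conjuncts] using hE hB
  rcases mem_requiredSuccessors.1 hc with ⟨D, hD, -, hc'⟩ | ⟨hf, ⟨D, hD⟩, hc'⟩
  · refine of_mem_conjuncts (hN hD) (key D fun E hE hE' => h E ?_)
    rw [hc']
    exact List.forall_mem_cons.2 ⟨hE, hat E hE'⟩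
  -- Some existential for the role is pulled out, all fillers are merged into it (its own once more,
  -- harmlessly), and the range atoms are added last.
  · refine of_setEq (SimplePL.setEq_inter_of_mem_conjuncts (hN hD)) (inter_ex_of_merge hf
      (((N.flatMap SimplePL.successors).filter fun p => decide (p.1 = c.1)).map Prod.snd) ?_ D
      fun E _ hE => key E fun F hF hF' => h F ?_)
    · intro D' hD'
      simp only [List.mem_map, List.mem_filter, List.mem_flatMap, SimplePL.mem_successors,
        exists_eq_right, Prod.exists, decide_eq_true_eq] at hD'
      exact hN hD'
    · rw [hc']
      exact List.forall_mem_append.2 ⟨fun D hD => List.Subset.trans (hE D hD) hF, hat F hF'⟩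

end Refuted

/-- Each test mirrors a rule. Asking only that `N` consists of conjuncts of `C` leaves room for the
surplus conjuncts that merging and copying produce. -/
theorem refuted_of_not_locallyConsistent {K : PLKB} {O : SRIQKB} {q : Query → Bool}
    (hq : ∀ Q, q Q = true → (shifted K O).Entails Q) {C : SimplePL} {N : List SimplePL}
    (hN : N ⊆ C.conjuncts) (h : ¬ locallyConsistent K q N = true) : Refuted K O C := by
  by_contra hC
  refine h (locallyConsistent_iff.2 ⟨?_, ?_, ?_, ?_⟩)
  · exact fun hb => hC (.of_mem_conjuncts (hN hb) .refl)
  · rw [← Bool.not_eq_true]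
    refine fun hQ => hC (.of_rule (.inconsistent C _ ?_ (hq _ hQ)))
    intro A hA
    simp only [List.mem_filter, List.mem_flatMap, SimplePL.mem_atomNames, exists_eq_right] at hA
    exact hN (by simpa using hA.1)
  · intro f l u hI
    by_contra hlt
    exact hC (.of_mem_conjuncts (hN hI) (.of_rule (.emptyInterval f l u (by omega))))
  · intro f l u l' u' hf hI hI'
    by_contra hlt
    -- Merging gives `[max l l', min u u']`, which is empty because `u' < l`.
    exact hC (.of_mem_conjuncts₂ (hN hI) (hN hI') (.of_step (.rule (.mergeIntervals f l u l' u' hf))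
      (.of_rule (.emptyInterval _ _ _ (by omega)))))

/-- Induction on a strict bound for the nesting depth of the label. The concept `C` may have more
conjuncts than the label, since the fillers obtained by rewriting do. -/
theorem refuted_of_not_consistent {K : PLKB} {O : SRIQKB} {q : Query → Bool}
    (hq : ∀ Q, q Q = true → (shifted K O).Entails Q) (n : ℕ) {L : List SimplePL}
    (hn : ∀ D ∈ L, D.depth < n) (h : ¬ Consistent K q L) {C : SimplePL}
    (hC : ∀ D ∈ L, D.conjuncts ⊆ C.conjuncts) : Refuted K O C := by
  induction n generalizing L C with
  | zero =>
    cases L with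
    | nil =>
      -- The empty label can fail too: if `O⁺_K` is inconsistent, the query `⊤ ⊑ ⊥` is entailed and
      -- refutes any concept.
      by_contra hr
      refine h (.intro _ ?_ ?_)
      · by_contra hl
        exact hr (refuted_of_not_locallyConsistent hq (by simp [allConjuncts]) hl)
      · intro c hc
        simp [mem_requiredSuccessors] at hc
    | cons D L => exact absurd (hn D List.mem_cons_self) (Nat.not_lt_zero _)
  | succ n ih =>
    have hN : allConjuncts L ⊆ C.conjuncts := by
      intro D hD
      obtain ⟨E, hE, hD⟩ := mem_allConjuncts.1 hD
      exact hC E hE hD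
    by_contra hr
    refine h (.intro _ ?_ fun c hc => ?_)
    · by_contra hl
      exact hr (refuted_of_not_locallyConsistent hq hN hl)
    · by_contra hcon
      -- Range atoms have depth `0`, so the induction hypothesis needs `0 < n`. For `n = 0` the
      -- label contains no existential that could require `c`.
      rcases Nat.eq_zero_or_pos n with rfl | hpos
      · have hex : ∃ D, SimplePL.ex c.1 D ∈ allConjuncts L := by
          rcases mem_requiredSuccessors.1 hc with ⟨D, hD, -⟩ | ⟨-, hD, -⟩
          exacts [⟨D, hD⟩, hD]
        obtain ⟨D, hD⟩ := hex
        obtain ⟨E, hE, hD⟩ := mem_allConjuncts.1 hD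
        have := SimplePL.depth_le_of_mem_conjuncts hD
        have := hn E hE
        simp only [SimplePL.depth] at *
        omega
      refine hr (.of_requiredSuccessor hN hc fun E hE => ih ?_ hcon hE)
      intro D hD
      rcases mem_successor_label hc hD with hD | ⟨A, -, rfl⟩
      · obtain ⟨E, hE, hD⟩ := mem_allConjuncts.1 hD
        have := SimplePL.depth_le_of_mem_conjuncts hD
        have := hn E hE
        simp only [SimplePL.depth] at *
        omega
      · exact hpos

/-! ## Soundness of the rules -/

theorem shifted_models {K : PLKB} {O : SRIQKB} {I : Interp} (hK : K.Models I) (hO : O.Models I) :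
    (shifted K O).Models I := by
  intro α hα
  rcases List.mem_append.1 hα with hα | hα
  · exact hO α hα
  · obtain ⟨β, hβ, hs⟩ := List.mem_filterMap.1 hα
    have := hK β hβ
    cases β <;> simp only [PLAxiom.shift, reduceCtorEq, Option.some.injEq] at hs <;> subst hs
    · exact this
    · exact this.le

theorem SetEq.ext_eq {C D : SimplePL} (h : SetEq C D) (I : Interp) : C.ext I = D.ext I := by
  induction h with
  | refl => rfl
  | symm _ ih => exact ih.symm
  | trans _ _ ih ih' => exact ih.trans ih'
  | comm => exact Set.inter_comm _ _
  | assoc => exact Set.inter_assoc _ _ _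
  | idem => exact Set.inter_self _
  | inter _ _ ih ih' => simp only [SimplePL.ext, ih, ih']
  | ex R _ ih => simp only [SimplePL.ext, ih]

theorem Rule.ext_eq {K : PLKB} {O : SRIQKB} {C D : SimplePL} (h : Rule K O C D) {I : Interp}
    (hK : K.Models I) (hO : O.Models I) : C.ext I = D.ext I := by
  cases h with
  | botInter => simp [SimplePL.ext]
  | exBot => simp [SimplePL.ext]
  | emptyInterval f l u h =>
    simp only [SimplePL.ext, Set.eq_empty_iff_forall_notMem, Set.mem_ofPred_eq]
    rintro x ⟨i, h1, h2, -⟩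
    omega
  | mergeRoles R D D' h =>
    have := hK _ h
    ext x
    simp only [SimplePL.ext, Set.mem_inter_iff, Set.mem_ofPred_eq]
    constructor
    · rintro ⟨⟨y, hy, hD⟩, z, hz, hD'⟩
      obtain rfl := this x y z hy hz
      exact ⟨y, hy, hD, hD'⟩
    · rintro ⟨y, hy, hD, hD'⟩
      exact ⟨⟨y, hy, hD⟩, y, hy, hD'⟩
  | mergeIntervals f l₁ u₁ l₂ u₂ h =>
    have := hK _ h
    ext x
    simp only [SimplePL.ext, Set.mem_inter_iff, Set.mem_ofPred_eq]
    constructor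
    · rintro ⟨⟨y, hy, hu, hD⟩, z, hz, hu', hD'⟩
      obtain rfl := this x y z hD hD'
      exact ⟨y, by omega, by omega, hD⟩
    · rintro ⟨y, hy, hD, hD'⟩
      exact ⟨⟨y, by omega, by omega, hD'⟩, y, by omega, by omega, hD'⟩
  | addRange R A D h =>
    have := hK _ h
    ext x
    simp only [SimplePL.ext, Set.mem_inter_iff, Set.mem_ofPred_eq]
    exact ⟨fun ⟨y, hy, hD⟩ => ⟨y, hy, hD, this x y hy⟩, fun ⟨y, hy, hD⟩ => ⟨y, hy, hD.1⟩⟩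
  | inconsistent C As hAs hE =>
    simp only [SimplePL.ext, Set.eq_empty_iff_forall_notMem]
    intro x hx
    obtain ⟨B, hB, -⟩ := hE I (shifted_models hK hO) x fun A hA =>
      SimplePL.ext_of_mem_conjuncts.1 hx _ (hAs A hA)
    simp at hB

theorem Rewrites.ext_eq {K : PLKB} {O : SRIQKB} {C D : SimplePL} (h : Rewrites K O C D)
    {I : Interp} (hK : K.Models I) (hO : O.Models I) : C.ext I = D.ext I := by
  induction h with
  | rule h => exact h.ext_eq hK hO
  | inter D _ ih => simp only [SimplePL.ext, ih]
  | ex R _ ih => simp only [SimplePL.ext, ih]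
  | setEq h _ h' ih => rw [h.ext_eq, ih, h'.ext_eq]

theorem Refuted.ext_eq_empty {K : PLKB} {O : SRIQKB} {C : SimplePL} (h : Refuted K O C)
    {I : Interp} (hK : K.Models I) (hO : O.Models I) : C.ext I = ∅ := by
  have : ∀ D, Relation.ReflTransGen (Rewrites K O) C D → C.ext I = D.ext I := by
    intro D hD
    induction hD with
    | refl => rfl
    | tail _ h ih => exact ih.trans (h.ext_eq hK hO)
  exact this _ h

/-! ## Models of consistent conjunctions -/

/-- `e` embeds the interpretation `I` into `J` as a union of connected components, as far as the
names in `S` are concerned. -/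
structure IsComponent (S : Set Symbol) (I J : Interp) (e : I.Dom → J.Dom) : Prop where
  injective : Function.Injective e
  concept_iff : ∀ A, .concept A ∈ S → ∀ x, e x ∈ J.concept A ↔ x ∈ I.concept A
  role_iff : ∀ R, .role R ∈ S → ∀ x z, J.role R (e x) z ↔ ∃ y, z = e y ∧ I.role R x y
  role_iff' : ∀ R, .role R ∈ S → ∀ x z, J.role R z (e x) ↔ ∃ y, z = e y ∧ I.role R y x

namespace IsComponent

variable {S : Set Symbol} {I J : Interp} {e : I.Dom → J.Dom}

theorem rel_iff (h : IsComponent S I J e) {R : Role} (hR : R.sig ⊆ S) (x : I.Dom) (z : J.Dom) :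
    R.rel J (e x) z ↔ ∃ y, z = e y ∧ R.rel I x y := by
  cases R with
  | name R => exact h.role_iff R (hR rfl) x z
  | inv R => exact h.role_iff' R (hR rfl) x z

theorem rel_map_iff (h : IsComponent S I J e) {R : Role} (hR : R.sig ⊆ S) (x y : I.Dom) :
    R.rel J (e x) (e y) ↔ R.rel I x y := by
  rw [h.rel_iff hR]
  exact ⟨fun ⟨z, hz, hr⟩ => h.injective hz ▸ hr, fun hr => ⟨y, rfl, hr⟩⟩

theorem chainRel_iff (h : IsComponent S I J e) {Rs : List Role} (hR : ∀ R ∈ Rs, R.sig ⊆ S)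
    (x : I.Dom) (z : J.Dom) : chainRel J Rs (e x) z ↔ ∃ y, z = e y ∧ chainRel I Rs x y := by
  induction Rs generalizing x with
  | nil => simp [chainRel, eq_comm]
  | cons R Rs ih =>
    simp only [chainRel]
    constructor
    · rintro ⟨w, hw, hz⟩
      obtain ⟨y, rfl, hy⟩ := (h.rel_iff (hR R List.mem_cons_self) x w).1 hw
      obtain ⟨y', rfl, hy'⟩ := (ih (fun R hR' => hR R (List.mem_cons_of_mem _ hR')) y).1 hz
      exact ⟨y', rfl, y, hy, hy'⟩
    · rintro ⟨y', rfl, y, hy, hy'⟩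
      exact ⟨e y, (h.rel_map_iff (hR R List.mem_cons_self) x y).2 hy,
        (ih (fun R hR' => hR R (List.mem_cons_of_mem _ hR')) y).2 ⟨y', rfl, hy'⟩⟩

theorem encard_eq (h : IsComponent S I J e) {R : Role} (hR : R.sig ⊆ S) {X : Set I.Dom}
    {Y : Set J.Dom} (hXY : ∀ x, e x ∈ Y ↔ x ∈ X) (x : I.Dom) :
    {z | R.rel J (e x) z ∧ z ∈ Y}.encard = {y | R.rel I x y ∧ y ∈ X}.encard := by
  rw [← h.injective.encard_image]
  congr 1
  ext z
  simp only [Set.mem_ofPred_eq, Set.mem_image]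
  constructor
  · rintro ⟨hz, hY⟩
    obtain ⟨y, rfl, hy⟩ := (h.rel_iff hR x z).1 hz
    exact ⟨y, ⟨hy, (hXY y).1 hY⟩, rfl⟩
  · rintro ⟨y, ⟨hy, hX⟩, rfl⟩
    exact ⟨(h.rel_map_iff hR x y).2 hy, (hXY y).2 hX⟩

/-- A SRIQ concept at an individual depends only on what is reachable along its roles and their
inverses. That never leaves a component, and injectivity preserves the counts in number
restrictions. -/
theorem mem_ext_iff (h : IsComponent S I J e) {C : SRIQConcept} (hC : C.sig ⊆ S) (x : I.Dom) :
    e x ∈ C.ext J ↔ x ∈ C.ext I := by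
  induction C generalizing x with
  | atom A => exact h.concept_iff A (hC rfl) x
  | top => simp [SRIQConcept.ext]
  | bot => simp [SRIQConcept.ext]
  | inter C D ihC ihD =>
    obtain ⟨h1, h2⟩ := Set.union_subset_iff.1 hC
    exact and_congr (ihC h1 x) (ihD h2 x)
  | union C D ihC ihD =>
    obtain ⟨h1, h2⟩ := Set.union_subset_iff.1 hC
    exact or_congr (ihC h1 x) (ihD h2 x)
  | compl C ih => exact not_congr (ih hC x)
  | ex R C ih =>
    obtain ⟨h1, h2⟩ := Set.union_subset_iff.1 hC
    simp only [SRIQConcept.ext, Set.mem_ofPred_eq, h.rel_iff h1]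
    constructor
    · rintro ⟨_, ⟨y, rfl, hy⟩, hC⟩
      exact ⟨y, hy, (ih h2 y).1 hC⟩
    · rintro ⟨y, hy, hC⟩
      exact ⟨e y, ⟨y, rfl, hy⟩, (ih h2 y).2 hC⟩
  | all R C ih =>
    obtain ⟨h1, h2⟩ := Set.union_subset_iff.1 hC
    simp only [SRIQConcept.ext, Set.mem_ofPred_eq, h.rel_iff h1]
    constructor
    · exact fun H y hy => (ih h2 y).1 (H _ ⟨y, rfl, hy⟩)
    · rintro H _ ⟨y, rfl, hy⟩
      exact (ih h2 y).2 (H y hy)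
  | atLeast n R C ih =>
    obtain ⟨h1, h2⟩ := Set.union_subset_iff.1 hC
    simp only [SRIQConcept.ext, Set.mem_ofPred_eq, h.encard_eq h1 (ih h2)]
  | atMost n R C ih =>
    obtain ⟨h1, h2⟩ := Set.union_subset_iff.1 hC
    simp only [SRIQConcept.ext, Set.mem_ofPred_eq, h.encard_eq h1 (ih h2)]
  | self R => exact h.rel_map_iff hC x x

end IsComponent

/-- An interpretation that is covered by models of `T`, as connected components, is a model of `T`
if it interprets the individuals in one of them. -/
theorem models_of_components {T : SRIQKB} {κ : Type} {M : κ → Interp} {J : Interp}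
    {e : ∀ k, (M k).Dom → J.Dom} (he : ∀ k, IsComponent T.sig (M k) J (e k))
    (hM : ∀ k, T.Models (M k)) (hcov : ∀ z, ∃ k y, e k y = z) (k₀ : κ)
    (hind : ∀ a, J.individual a = e k₀ ((M k₀).individual a)) : T.Models J := by
  intro α hα
  have hs : α.sig ⊆ T.sig := fun X hX => ⟨α, hα, hX⟩
  cases α with
  | gci C D =>
    obtain ⟨h1, h2⟩ := Set.union_subset_iff.1 hs
    intro z hz
    obtain ⟨k, y, rfl⟩ := hcov z
    exact ((he k).mem_ext_iff h2 y).2 (hM k _ hα (((he k).mem_ext_iff h1 y).1 hz))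
  | roleDisj R R' =>
    obtain ⟨h1, h2⟩ := Set.union_subset_iff.1 hs
    rintro x z ⟨hR, hR'⟩
    obtain ⟨k, y, rfl⟩ := hcov x
    obtain ⟨w, rfl, hw⟩ := ((he k).rel_iff h1 y z).1 hR
    exact hM k _ hα y w ⟨hw, ((he k).rel_map_iff h2 y w).1 hR'⟩
  | roleIncl Rs R =>
    obtain ⟨h1, h2⟩ := Set.union_subset_iff.1 hs
    intro x z hxz
    obtain ⟨k, y, rfl⟩ := hcov x
    obtain ⟨w, rfl, hw⟩ := ((he k).chainRel_iff (fun R hR X hX => h1 ⟨R, hR, hX⟩) y z).1 hxz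
    exact ((he k).rel_map_iff h2 y w).2 (hM k _ hα y w hw)
  | conceptAssertion C a =>
    obtain ⟨h1, -⟩ := Set.union_subset_iff.1 hs
    simp only [SRIQAxiom.Holds, hind]
    exact ((he k₀).mem_ext_iff h1 _).2 (hM k₀ _ hα)
  | roleAssertion R a b =>
    obtain ⟨h1, -⟩ := Set.union_subset_iff.1 hs
    simp only [SRIQAxiom.Holds, hind]
    exact ((he k₀).rel_map_iff h1 _ _).2 (hM k₀ _ hα)

/-- The axioms moved from `K` to the ontology contain only concept names, so the roles of `K` and
`C` stay invisible to `O⁺_K`. -/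
theorem mem_sig_of_role_mem_sig_shifted {K : PLKB} {O : SRIQKB} {R : ℕ}
    (h : .role R ∈ (shifted K O).sig) : .role R ∈ O.sig := by
  obtain ⟨α, hα, hR⟩ := h
  rcases List.mem_append.1 hα with hα | hα
  · exact ⟨α, hα, hR⟩
  · obtain ⟨β, -, hs⟩ := List.mem_filterMap.1 hα
    cases β <;> simp only [PLAxiom.shift, reduceCtorEq, Option.some.injEq] at hs <;> subst hs <;>
      simp [SRIQAxiom.sig, SRIQConcept.sig] at hR

theorem models_of_shifted_models {K : PLKB} {O : SRIQKB} {I : Interp}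
    (h : (shifted K O).Models I) : O.Models I :=
  fun α hα => h α (List.mem_append_left _ hα)

theorem plModels_of_shifted_models {K : PLKB} {O : SRIQKB} {I : Interp}
    (h : (shifted K O).Models I)
    (hR : ∀ R, .funcRole R ∈ K → ∀ x y z, I.role R x y → I.role R x z → y = z)
    (hf : ∀ f, .funcProp f ∈ K → ∀ x i j, I.property f x i → I.property f x j → i = j)
    (hr : ∀ R A, .range R A ∈ K → ∀ x y, I.role R x y → y ∈ I.concept A) : K.Models I := by
  intro α hα
  have hs : ∀ β, α.shift = some β → β.Holds I := fun β hβ =>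
    h β (List.mem_append_right _ (List.mem_filterMap.2 ⟨α, hα, hβ⟩))
  cases α with
  | funcRole R => exact hR R hα
  | funcProp f => exact hf f hα
  | range R A => exact hr R A hα
  | sub A B => exact hs _ rfl
  | disj A B => exact Set.subset_empty_iff.1 (hs _ rfl)

/-! ### Reinterpretation and gluing of models -/

/-- Interpretation of the properties at an individual whose interval constraints are compatible. -/
theorem exists_property_values {K : PLKB} {q : Query → Bool} {N : List SimplePL}
    (h : locallyConsistent K q N = true) :
    ∃ V : ℕ → ℕ → Prop, (∀ f, .funcProp f ∈ K → ∀ i j, V f i → V f j → i = j) ∧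
      ∀ f l u, .interval f l u ∈ N → ∃ i, l ≤ i ∧ i ≤ u ∧ V f i := by
  obtain ⟨-, -, h1, h2⟩ := locallyConsistent_iff.1 h
  -- Helly's theorem on the line: the greatest lower bound of any of the intervals lies in all of
  -- them, as each lower bound is at most each upper bound.
  have hsup : ∀ f, .funcProp f ∈ K → ∃ m, ∀ l u, .interval f l u ∈ N → l ≤ m ∧ m ≤ u := by
    intro f hf
    by_cases hne : ∃ l u, .interval f l u ∈ N
    · have hfin : {l | ∃ u, .interval f l u ∈ N}.Finite := by
        refine Set.Finite.subset ((N.flatMap SimplePL.intervals).map fun p => p.2.1).finite_toSet ?_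
        rintro l ⟨u, hu⟩
        simp only [Set.mem_ofPred_eq, List.mem_map, List.mem_flatMap, SimplePL.mem_intervals]
        exact ⟨(f, l, u), ⟨_, hu, rfl⟩, rfl⟩
      obtain ⟨m, ⟨u₀, hm⟩, hmax⟩ := Set.exists_max_image _ id hfin hne
      exact ⟨m, fun l u hl => ⟨hmax l ⟨u, hl⟩, h2 f m u₀ l u hf hm hl⟩⟩
    · exact ⟨0, fun l u hl => absurd ⟨l, u, hl⟩ hne⟩
  choose! m hm using hsup
  -- A property that is not functional is related to every number, so `l` itself witnesses `[l, u]`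
  -- once `l ≤ u`.
  refine ⟨fun f i => .funcProp f ∈ K → i = m f, fun f hf i j hi hj => (hi hf).trans (hj hf).symm,
    fun f l u hI => ?_⟩
  by_cases hf : .funcProp f ∈ K
  · exact ⟨m f, (hm f hf l u hI).1, (hm f hf l u hI).2, fun _ => rfl⟩
  · exact ⟨l, le_rfl, h1 f l u hI, fun h => absurd h hf⟩

open Classical in
/-- The interpretation `J` with the names outside `S` interpreted anew: concept names by the whole
domain, roles by the empty relation, and the properties by `V` at the individual `d` only. -/
def Interp.reinterpret (J : Interp) (S : Set Symbol) (d : J.Dom) (V : ℕ → ℕ → Prop) : Interp where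
  Dom := J.Dom
  nonempty := J.nonempty
  concept A := if .concept A ∈ S then J.concept A else Set.univ
  role R x y := .role R ∈ S ∧ J.role R x y
  individual := J.individual
  property f x i := x = d ∧ V f i

/-- The ontology does not see the change, while every atom unknown to it now holds at `d`. With the
roles outside `S` empty, functionality and range axioms for them hold vacuously in this component.
-/
theorem Interp.isComponent_reinterpret (J : Interp) (S : Set Symbol) (d : J.Dom)
    (V : ℕ → ℕ → Prop) : IsComponent S J (J.reinterpret S d V) id where
  injective := Function.injective_id
  concept_iff A hA x := by
    change x ∈ (reinterpret J S d V).concept A ↔ _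
    simp only [reinterpret, if_pos hA]
    exact Iff.rfl
  role_iff R hR x z := ⟨fun h => ⟨z, rfl, h.2⟩, by rintro ⟨y, rfl, h⟩; exact ⟨hR, h⟩⟩
  role_iff' R hR x z := ⟨fun h => ⟨z, rfl, h.2⟩, by rintro ⟨y, rfl, h⟩; exact ⟨hR, h⟩⟩

/-- The disjoint union of the interpretations `M o`, with an edge labelled `ρ c` from the individual
`d` of the first of them to the individual `x c` of each of the others. -/
def Interp.glue {κ : Type} (M : Option κ → Interp) (d : (M none).Dom)
    (x : ∀ c, (M (some c)).Dom) (ρ : κ → ℕ) : Interp where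
  Dom := Σ o, (M o).Dom
  nonempty := ⟨⟨none, d⟩⟩
  concept A := {p | p.2 ∈ (M p.1).concept A}
  role R p p' := (∃ o y z, p = ⟨o, y⟩ ∧ p' = ⟨o, z⟩ ∧ (M o).role R y z) ∨
    ∃ c, ρ c = R ∧ p = ⟨none, d⟩ ∧ p' = ⟨some c, x c⟩
  individual a := ⟨none, (M none).individual a⟩
  property f p i := (M p.1).property f p.2 i

/-- The added edges carry labels outside `S`, so with respect to `S` the summands remain
disconnected. -/
theorem Interp.isComponent_glue {κ : Type} (M : Option κ → Interp) (d : (M none).Dom)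
    (x : ∀ c, (M (some c)).Dom) (ρ : κ → ℕ) {S : Set Symbol} (hρ : ∀ c, .role (ρ c) ∉ S)
    (o : Option κ) : IsComponent S (M o) (glue M d x ρ) (fun y => ⟨o, y⟩) where
  injective := fun _ _ h => eq_of_heq (Sigma.mk.inj h).2
  concept_iff A _ y := Iff.rfl
  role_iff R hR y z := by
    constructor
    · rintro (⟨o', y', z', h1, rfl, h⟩ | ⟨c, rfl, -⟩)
      · cases h1
        exact ⟨z', rfl, h⟩
      · exact absurd hR (hρ c)
    · rintro ⟨z', rfl, h⟩
      exact .inl ⟨o, y, z', rfl, rfl, h⟩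
  role_iff' R hR y z := by
    constructor
    · rintro (⟨o', y', z', rfl, h1, h⟩ | ⟨c, rfl, -⟩)
      · cases h1
        exact ⟨y', rfl, h⟩
      · exact absurd hR (hρ c)
    · rintro ⟨z', rfl, h⟩
      exact .inl ⟨o, z', y, rfl, rfl, h⟩

theorem SimplePL.inter_notMem_conjuncts (C D E : SimplePL) : .inter C D ∉ E.conjuncts := by
  induction E with
  | inter _ _ ih ih' => simp [conjuncts, ih, ih']
  | _ => simp [conjuncts]

/-- Simple PL concepts are built without negation and universal restriction, so the added edges
cannot destroy them. Only this direction holds. -/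
theorem SimplePL.mem_ext_glue {κ : Type} (M : Option κ → Interp) (d : (M none).Dom)
    (x : ∀ c, (M (some c)).Dom) (ρ : κ → ℕ) (o : Option κ) (D : SimplePL) (y : (M o).Dom)
    (h : y ∈ D.ext (M o)) :
    (⟨o, y⟩ : (Interp.glue M d x ρ).Dom) ∈ D.ext (Interp.glue M d x ρ) := by
  induction D generalizing y with
  | atom A => exact h
  | bot => exact h
  | interval f l u => exact h
  | ex R C ih =>
    obtain ⟨z, hz, hC⟩ := h
    exact ⟨⟨o, z⟩, .inl ⟨o, y, z, rfl, rfl, hz⟩, ih z hC⟩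
  | inter C D ihC ihD => exact ⟨ihC y h.1, ihD y h.2⟩

open Classical in
/-- A consistent conjunction holds at some individual of some model. -/
theorem Consistent.exists_model {K : PLKB} {O : SRIQKB} {q : Query → Bool}
    (hq : ∀ Q, Q ∈ (shifted K O).pos → q Q = true)
    (hq' : ∀ A, q ⟨[A], [A]⟩ = true → .concept A ∈ (shifted K O).sig)
    (hK : ∀ R, .role R ∈ K.sig → .role R ∉ O.sig) {L : List SimplePL} (h : Consistent K q L)
    (hL : ∀ D ∈ L, ∀ R, .role R ∈ D.sig → .role R ∉ O.sig) :
    ∃ (I : Interp) (x : I.Dom), K.Models I ∧ (shifted K O).Models I ∧ ∀ D ∈ L, x ∈ D.ext I := by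
  induction h with
  | intro L hloc _ ih =>
  set N := allConjuncts L with hN
  have hNsig : ∀ D ∈ N, ∀ R, .role R ∈ D.sig → .role R ∉ O.sig := by
    intro D hD R hR
    obtain ⟨E, hE, hD⟩ := mem_allConjuncts.1 hD
    exact hL E hE R (SimplePL.sig_subset_of_mem_conjuncts hD hR)
  obtain ⟨hbot, hpos, -, -⟩ := locallyConsistent_iff.1 hloc
  obtain ⟨V, hV, hVI⟩ := exists_property_values hloc
  have hposn := mt (hq _) (by rw [hpos]; exact Bool.false_ne_true)
  -- The query is not in `pos`, although all its names belong to the signature; so it is not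
  -- entailed, and a countermodel provides `J` and `d`.
  obtain ⟨J, hJ, d, hd⟩ : ∃ J : Interp, (shifted K O).Models J ∧ ∃ d : J.Dom,
      ∀ A ∈ (N.flatMap SimplePL.atomNames).filter fun A => q ⟨[A], [A]⟩, d ∈ J.concept A := by
    by_contra hne
    push Not at hne
    refine hposn ⟨fun A hA => ?_, fun J hJ d hd => ?_⟩
    · simp only [List.append_nil, List.mem_filter] at hA
      exact hq' A hA.2
    · obtain ⟨A, hA, hnA⟩ := hne J hJ d
      exact absurd (hd A hA) hnA
  let κ := {c // c ∈ requiredSuccessors K N}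
  have hch : ∀ c : κ, ∃ (I : Interp) (x : I.Dom), K.Models I ∧ (shifted K O).Models I ∧
      ∀ D ∈ c.1.2, x ∈ D.ext I := by
    intro c
    refine ih c.1 c.2 fun D hD R hR => ?_
    rcases mem_successor_label c.2 hD with hD | ⟨A, -, rfl⟩
    · exact hNsig _ hD R (.inr hR)
    · simp [SimplePL.sig] at hR
  choose I x hIK hImodels hIx using hch
  let J' := J.reinterpret (shifted K O).sig d V
  have hJ' : (shifted K O).Models J' :=
    models_of_components (κ := Unit) (M := fun _ => J) (e := fun _ => id)
      (fun _ => J.isComponent_reinterpret _ d V) (fun _ => hJ) (fun z => ⟨(), z, rfl⟩) ()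
      (fun _ => rfl)
  have hrole : ∀ R, .role R ∉ O.sig → ∀ y z, ¬ J'.role R y z := fun R hR y z h =>
    hR (mem_sig_of_role_mem_sig_shifted h.1)
  have hJK : K.Models J' := plModels_of_shifted_models hJ'
    (fun R hR y z w h => absurd h (hrole R (hK R ⟨_, hR, rfl⟩) _ _))
    (fun f hf y i j hi hj => hV f hf i j hi.2 hj.2)
    (fun R A hR y z h => absurd h (hrole R (hK R ⟨_, hR, .inl rfl⟩) _ _))
  let M : Option κ → Interp := fun o => o.elim J' I
  have hMK : ∀ o, K.Models (M o) := fun o => by cases o; exacts [hJK, hIK _]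
  have hMO : ∀ o, (shifted K O).Models (M o) := fun o => by cases o; exacts [hJ', hImodels _]
  let ρ : κ → ℕ := fun c => c.1.1
  have hρ : ∀ c, .role (ρ c) ∉ O.sig := by
    intro c
    have : ∃ D, SimplePL.ex c.1.1 D ∈ N := by
      rcases mem_requiredSuccessors.1 c.2 with ⟨D, hD, -⟩ | ⟨-, hD, -⟩
      exacts [⟨D, hD⟩, hD]
    obtain ⟨D, hD⟩ := this
    exact hNsig _ hD _ (.inl rfl)
  let G := Interp.glue M d x ρ
  have hG : (shifted K O).Models G := models_of_components (e := fun o y => ⟨o, y⟩)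
    (fun o => Interp.isComponent_glue M d x ρ
      (fun c h => hρ c (mem_sig_of_role_mem_sig_shifted h)) o) hMO
    (fun z => ⟨z.1, z.2, rfl⟩) none (fun _ => rfl)
  refine ⟨G, ⟨none, d⟩, plModels_of_shifted_models hG ?_ ?_ ?_, hG, fun D hD => ?_⟩
  -- The root component has no `R`-edges, because `R` occurs in `K` and therefore not in `O`. So
  -- `R`-edges either stay inside a child, which models `K`, or start at `d`, where the required
  -- successor is unique.
  · intro R hR y z w h1 h2
    rcases h1 with ⟨o, y1, z1, rfl, rfl, h1⟩ | ⟨c, rfl, rfl, rfl⟩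
    · rcases h2 with ⟨o', y2, z2, h, rfl, h2⟩ | ⟨c, -, h, -⟩
      · cases h
        rw [hMK o _ hR _ _ _ h1 h2]
      · cases h
        exact absurd h1 (hrole R (hK R ⟨_, hR, rfl⟩) _ _)
    · rcases h2 with ⟨o', y2, z2, h, rfl, h2⟩ | ⟨c', h, -, rfl⟩
      · cases h
        exact absurd h2 (hrole _ (hK _ ⟨_, hR, rfl⟩) _ _)
      · rw [Subtype.ext (requiredSuccessor_unique c.2 c'.2 h.symm hR : c.1 = c'.1)]
  · intro f hf y i j hi hj
    exact hMK y.1 _ hf y.2 i j hi hj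
  · intro R A hR y z h
    rcases h with ⟨o, y1, z1, rfl, rfl, h1⟩ | ⟨c, rfl, rfl, rfl⟩
    · exact hMK o _ hR _ _ h1
    -- A new edge satisfies the range axioms because the label of its target contains the range
    -- atoms.
    · exact hIx c _ (rangeAtoms_subset_successor c.2 (PLKB.mem_rangeAtoms.2 ⟨A, hR, rfl⟩))
  · refine SimplePL.ext_of_mem_conjuncts.2 fun E hE => ?_
    have hEN : E ∈ N := mem_allConjuncts.2 ⟨D, hD, hE⟩
    cases E with
    | atom A =>
      change d ∈ (if _ then _ else _ : Set J.Dom)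
      -- A name in the signature of `O⁺_K` passes the test `A ⊑ A` and thus belongs to the query
      -- that `d` satisfies. Any other name was reinterpreted by the whole domain.
      split_ifs with hA
      · refine hd A (List.mem_filter.2 ⟨List.mem_flatMap.2 ⟨_, hEN, by simp⟩, hq _ ⟨?_, ?_⟩⟩)
        · simpa using hA
        · exact fun _ _ _ h => ⟨A, by simp, h A (by simp)⟩
      · trivial
    | bot => exact absurd hEN hbot
    | interval f l u =>
      obtain ⟨i, h1, h2, h3⟩ := hVI f l u hEN
      exact ⟨i, h1, h2, rfl, h3⟩
    | ex R C =>
      obtain ⟨c, hc, rfl, hC⟩ := exists_requiredSuccessor (K := K) hEN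
      exact ⟨⟨some ⟨c, hc⟩, x ⟨c, hc⟩⟩, .inr ⟨⟨c, hc⟩, rfl, rfl, rfl⟩,
        SimplePL.mem_ext_glue M d x ρ (some ⟨c, hc⟩) C _ (hIx ⟨c, hc⟩ C hC)⟩
    | inter C E => exact absurd hE (SimplePL.inter_notMem_conjuncts C E D)

/-! ### Consistency, satisfiability and refutability -/

open Classical in
/-- The oracle that answers membership in `pos(O⁺_K)`. -/
noncomputable def posAnswer (K : PLKB) (O : SRIQKB) (Q : Query) : Bool :=
  decide (Q ∈ (shifted K O).pos)

section

variable {K : PLKB} {O : SRIQKB} {C : PLConcept}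

theorem exists_model_of_consistent (h : Admissible K O C) {D : SimplePL} (hD : D ∈ C)
    (hcon : Consistent K (posAnswer K O) [D]) : Satisfiable K O C := by
  have hsig : ∀ X, X ∈ K.sig ∪ PLConcept.sig C → ∀ R, X = .role R → .role R ∉ O.sig := by
    rintro X hX R rfl hR
    obtain ⟨A, hA⟩ := h ⟨hX, hR⟩
    cases hA
  obtain ⟨I, x, hK, hO, hx⟩ := hcon.exists_model (O := O)
    (fun Q hQ => by simpa [posAnswer] using hQ)
    (fun A hA => by
      have : (⟨[A], [A]⟩ : Query) ∈ (shifted K O).pos := by simpa [posAnswer] using hA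
      exact this.1 A (by simp))
    (fun R hR => hsig _ (.inl hR) R rfl)
    (fun E hE R hR => hsig _ (.inr ⟨D, hD, by simpa [List.mem_singleton.1 hE] using hR⟩) R rfl)
  exact ⟨I, hK, models_of_shifted_models hO, x, D, hD, hx D (by simp)⟩

theorem refuted_of_not_consistent_singleton {D : SimplePL}
    (h : ¬ Consistent K (posAnswer K O) [D]) : Refuted K O D := by
  refine refuted_of_not_consistent (q := posAnswer K O) (fun Q hQ => ?_) (D.depth + 1) (L := [D])
    (by simp) h (by simp)
  have : Q ∈ (shifted K O).pos := by simpa [posAnswer] using hQ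
  exact this.2

theorem not_satisfiable_of_refuted (h : ∀ D ∈ C, Refuted K O D) : ¬ Satisfiable K O C := by
  rintro ⟨I, hK, hO, x, D, hD, hx⟩
  rw [(h D hD).ext_eq_empty hK hO] at hx
  exact hx

theorem satisfiable_iff_exists_consistent (h : Admissible K O C) :
    Satisfiable K O C ↔ ∃ D ∈ C, Consistent K (posAnswer K O) [D] := by
  refine ⟨fun hs => ?_, fun ⟨D, hD, hc⟩ => exists_model_of_consistent h hD hc⟩
  by_contra hn
  push Not at hn
  exact not_satisfiable_of_refuted (fun D hD => refuted_of_not_consistent_singleton (hn D hD)) hs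

theorem not_satisfiable_iff_refuted (h : Admissible K O C) :
    ¬ Satisfiable K O C ↔ ∀ D ∈ C, Refuted K O D := by
  refine ⟨fun hs D hD => ?_, not_satisfiable_of_refuted⟩
  exact refuted_of_not_consistent_singleton fun hc => hs (exists_model_of_consistent h hD hc)

end

/-! ## Programs and their running time -/

namespace Program

/-- All registers of the program are below this bound. -/
def bound : Program → ℕ
  | .setNil x => x + 1
  | .copy x y => max (x + 1) (y + 1)
  | .cons x y z => max (x + 1) (max (y + 1) (z + 1))
  | .head x y => max (x + 1) (y + 1)
  | .tail x y => max (x + 1) (y + 1)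
  | .query x y => max (x + 1) (y + 1)
  | .seq p q => max p.bound q.bound
  | .ifElse x p q => max (x + 1) (max p.bound q.bound)
  | .whileDo x p => max (x + 1) p.bound

end Program

theorem Data.size_pos (d : Data) : 0 < d.size := by
  cases d <;> simp only [Data.size] <;> omega

theorem Data.size_head_le (d : Data) : d.head.size ≤ d.size := by
  cases d <;> simp only [Data.size, Data.head] <;> omega

theorem Data.size_tail_le (d : Data) : d.tail.size ≤ d.size := by
  cases d <;> simp only [Data.size, Data.tail] <;> omega

namespace Runs

variable {Ω : Set Data}

/-- Frame property: registers from the bound on can serve as storage across a run. -/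
theorem eq_of_bound_le {p : Program} {s s' : Store} {t : ℕ} (h : Runs Ω p s t s') {x : ℕ}
    (hx : p.bound ≤ x) : s' x = s x := by
  induction h with
  | seq _ _ ih ih' =>
    simp only [Program.bound, max_le_iff] at hx
    rw [ih' hx.2, ih hx.1]
  | ifTrue _ _ ih =>
    simp only [Program.bound, max_le_iff] at hx
    exact ih hx.2.1
  | ifFalse _ _ ih =>
    simp only [Program.bound, max_le_iff] at hx
    exact ih hx.2.2
  | whileStop => rfl
  | whileStep _ _ _ ih ih' =>
    rw [ih' hx]
    simp only [Program.bound, max_le_iff] at hx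
    exact ih hx.2
  | _ =>
    simp only [Program.bound, max_le_iff] at hx
    exact Function.update_of_ne (by omega) _ _

/-- An instruction enlarges a register by no more than the time it takes. Hence time bounds are also
bounds on the size of results. -/
theorem size_le {p : Program} {s s' : Store} {t : ℕ} (h : Runs Ω p s t s') (x : ℕ) :
    (s' x).size ≤ (s x).size + t := by
  have key : ∀ (s : Store) (y : ℕ) (d : Data) (t : ℕ), d.size ≤ (s y).size + t →
      (Function.update s y d x).size ≤ (s x).size + t := by
    intro s y d t hd
    by_cases hxy : x = y
    · subst hxy
      simpa using hd
    · simp [Function.update_of_ne hxy]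
  induction h with
  | setNil => exact key _ _ _ _ (by simp only [Data.size]; omega)
  | copy => exact key _ _ _ _ (by omega)
  | cons => exact key _ _ _ _ (by simp only [Data.size]; omega)
  | head x y s => exact key _ _ _ _ (by have := (s y).size_head_le; omega)
  | tail x y s => exact key _ _ _ _ (by have := (s y).size_tail_le; omega)
  | queryYes x y s =>
    -- The answer has three nodes: the old content accounts for at least one, the duration of the
    -- query for at least two.
    exact key _ _ _ _ (by have := (s x).size_pos; have := (s y).size_pos; simp only [Data.size]; omega)
  | queryNo => exact key _ _ _ _ (by simp only [Data.size]; omega)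
  | whileStop => omega
  | _ => omega

/-- A run depends only on the registers of the program. -/
theorem congr {p : Program} {s s' : Store} {t : ℕ} (h : Runs Ω p s t s') {n : ℕ}
    (hn : p.bound ≤ n) {s₁ : Store} (hs : ∀ x < n, s₁ x = s x) :
    ∃ s₁', Runs Ω p s₁ t s₁' ∧ ∀ x < n, s₁' x = s' x := by
  have key : ∀ (s s₁ : Store) (y : ℕ) (d : Data), (∀ x < n, s₁ x = s x) →
      ∀ x < n, Function.update s₁ y d x = Function.update s y d x := by
    intro s s₁ y d h x hx
    by_cases hxy : x = y
    · subst hxy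
      simp
    · simp [Function.update_of_ne hxy, h x hx]
  induction h generalizing s₁ with
  | setNil x s => exact ⟨_, .setNil x s₁, key _ _ _ _ hs⟩
  | copy x y s =>
    simp only [Program.bound, max_le_iff] at hn
    rw [← hs y (by omega)]
    exact ⟨_, .copy x y s₁, key _ _ _ _ hs⟩
  | cons x y z s =>
    simp only [Program.bound, max_le_iff] at hn
    rw [← hs y (by omega), ← hs z (by omega)]
    exact ⟨_, .cons x y z s₁, key _ _ _ _ hs⟩
  | head x y s =>
    simp only [Program.bound, max_le_iff] at hn
    rw [← hs y (by omega)]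
    exact ⟨_, .head x y s₁, key _ _ _ _ hs⟩
  | tail x y s =>
    simp only [Program.bound, max_le_iff] at hn
    rw [← hs y (by omega)]
    exact ⟨_, .tail x y s₁, key _ _ _ _ hs⟩
  | queryYes x y s h =>
    simp only [Program.bound, max_le_iff] at hn
    rw [← hs y (by omega)] at h ⊢
    exact ⟨_, .queryYes x y s₁ h, key _ _ _ _ hs⟩
  | queryNo x y s h =>
    simp only [Program.bound, max_le_iff] at hn
    rw [← hs y (by omega)] at h ⊢
    exact ⟨_, .queryNo x y s₁ h, key _ _ _ _ hs⟩
  | seq _ _ ih ih' =>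
    simp only [Program.bound, max_le_iff] at hn
    obtain ⟨s₂, h₂, hs₂⟩ := ih hn.1 hs
    obtain ⟨s₃, h₃, hs₃⟩ := ih' hn.2 hs₂
    exact ⟨s₃, h₂.seq h₃, hs₃⟩
  | ifTrue h _ ih =>
    simp only [Program.bound, max_le_iff] at hn
    obtain ⟨s₂, h₂, hs₂⟩ := ih hn.2.1 hs
    exact ⟨s₂, .ifTrue (by rwa [hs _ (by omega)]) h₂, hs₂⟩
  | ifFalse h _ ih =>
    simp only [Program.bound, max_le_iff] at hn
    obtain ⟨s₂, h₂, hs₂⟩ := ih hn.2.2 hs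
    exact ⟨s₂, .ifFalse (by rwa [hs _ (by omega)]) h₂, hs₂⟩
  | whileStop h =>
    simp only [Program.bound, max_le_iff] at hn
    exact ⟨s₁, .whileStop (by rwa [hs _ (by omega)]), hs⟩
  | whileStep h _ _ ih ih' =>
    obtain ⟨s₂, h₂, hs₂⟩ := ih (by simp only [Program.bound, max_le_iff] at hn; exact hn.2) hs
    obtain ⟨s₃, h₃, hs₃⟩ := ih' hn hs₂
    simp only [Program.bound, max_le_iff] at hn
    exact ⟨s₃, .whileStep (by rwa [hs _ (by omega)]) h₂ h₃, hs₃⟩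

end Runs

/-- The program halts within time `T` in a store that satisfies `Q`. -/
def HaltsIn (Ω : Set Data) (p : Program) (s : Store) (T : ℕ) (Q : Store → Prop) : Prop :=
  ∃ t s', Runs Ω p s t s' ∧ t ≤ T ∧ Q s'

namespace HaltsIn

variable {Ω : Set Data} {p q : Program} {s : Store} {T T' : ℕ} {Q Q' : Store → Prop}

theorem mono (h : HaltsIn Ω p s T Q) (hT : T ≤ T') (hQ : ∀ s', Q s' → Q' s') :
    HaltsIn Ω p s T' Q' := by
  obtain ⟨t, s', h, ht, hs⟩ := h
  exact ⟨t, s', h, ht.trans hT, hQ s' hs⟩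

theorem frame (h : HaltsIn Ω p s T Q) :
    HaltsIn Ω p s T fun s' => Q s' ∧ ∀ x, p.bound ≤ x → s' x = s x := by
  obtain ⟨t, s', h, ht, hs⟩ := h
  exact ⟨t, s', h, ht, hs, fun x hx => h.eq_of_bound_le hx⟩

/-- The postcondition of `p` is a halting statement about `q`, so correctness proofs can follow the
program text. -/
theorem seq (h : HaltsIn Ω p s T fun s' => HaltsIn Ω q s' T' Q) :
    HaltsIn Ω (.seq p q) s (T + T') Q := by
  obtain ⟨t, s', h, ht, t', s'', h', ht', hs⟩ := h
  exact ⟨_, s'', h.seq h', by omega, hs⟩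

theorem setNil {x : ℕ} (h : Q (Function.update s x .nil)) : HaltsIn Ω (.setNil x) s 1 Q :=
  ⟨_, _, .setNil x s, le_rfl, h⟩

theorem copy {x y : ℕ} (h : Q (Function.update s x (s y))) :
    HaltsIn Ω (.copy x y) s (1 + (s y).size) Q :=
  ⟨_, _, .copy x y s, le_rfl, h⟩

theorem cons {x y z : ℕ} (h : Q (Function.update s x (.cons (s y) (s z)))) :
    HaltsIn Ω (.cons x y z) s (1 + (s y).size + (s z).size) Q :=
  ⟨_, _, .cons x y z s, le_rfl, h⟩

theorem head {x y : ℕ} (h : Q (Function.update s x (s y).head)) :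
    HaltsIn Ω (.head x y) s (1 + (s y).size) Q :=
  ⟨_, _, .head x y s, le_rfl, h⟩

theorem tail {x y : ℕ} (h : Q (Function.update s x (s y).tail)) :
    HaltsIn Ω (.tail x y) s (1 + (s y).size) Q :=
  ⟨_, _, .tail x y s, le_rfl, h⟩

open Classical in
theorem query {x y : ℕ} (h : Q (Function.update s x (encodeBit (decide (s y ∈ Ω))))) :
    HaltsIn Ω (.query x y) s (1 + (s y).size) Q := by
  by_cases hy : s y ∈ Ω
  · exact ⟨_, _, .queryYes x y s hy, le_rfl, by simpa [hy, encodeBit] using h⟩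
  · exact ⟨_, _, .queryNo x y s hy, le_rfl, by simpa [hy, encodeBit] using h⟩

theorem ifElse {x : ℕ} (h : s x ≠ .nil → HaltsIn Ω p s T Q) (h' : s x = .nil → HaltsIn Ω q s T' Q) :
    HaltsIn Ω (.ifElse x p q) s (1 + T + T') Q := by
  by_cases hx : s x = .nil
  · obtain ⟨t, s', h, ht, hs⟩ := h' hx
    exact ⟨_, _, .ifFalse hx h, by omega, hs⟩
  · obtain ⟨t, s', h, ht, hs⟩ := h hx
    exact ⟨_, _, .ifTrue hx h, by omega, hs⟩

theorem whileDo_of_eq_nil {x : ℕ} (hx : s x = .nil) (h : Q s) : HaltsIn Ω (.whileDo x p) s 1 Q :=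
  ⟨_, _, .whileStop hx, le_rfl, h⟩

theorem whileDo_step {x : ℕ} (hx : s x ≠ .nil)
    (h : HaltsIn Ω p s T fun s' => HaltsIn Ω (.whileDo x p) s' T' Q) :
    HaltsIn Ω (.whileDo x p) s (1 + T + T') Q := by
  obtain ⟨t, s', h, ht, t', s'', h', ht', hs⟩ := h
  exact ⟨_, s'', .whileStep hx h h', by omega, hs⟩

end HaltsIn

/-! ## Functions computable in polynomial time -/

/-- Types whose elements are encoded as data. -/
class DataEncoding (α : Type) where
  enc : α → Data

open PolicyLogic.DataEncoding (enc)

instance : DataEncoding Data := ⟨id⟩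
instance : DataEncoding ℕ := ⟨encodeNat⟩
instance : DataEncoding Bool := ⟨encodeBit⟩
instance : DataEncoding Unit := ⟨fun _ => .nil⟩
instance {α : Type} [DataEncoding α] : DataEncoding (List α) := ⟨encodeList enc⟩
instance {α β : Type} [DataEncoding α] [DataEncoding β] : DataEncoding (α × β) :=
  ⟨fun x => .cons (enc x.1) (enc x.2)⟩
instance {α : Type} [DataEncoding α] (p : α → Prop) : DataEncoding {a // p a} := ⟨fun x => enc x.1⟩
instance : DataEncoding SimplePL := ⟨SimplePL.encode⟩
instance : DataEncoding PLAxiom := ⟨PLAxiom.encode⟩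
instance : DataEncoding SRIQAxiom := ⟨SRIQAxiom.encode⟩
instance : DataEncoding Query := ⟨Query.encode⟩

/-! ### Sizes of encodings -/

section

variable {α β : Type} [DataEncoding α] [DataEncoding β]

/-- The size of the encoding. -/
def encSize (a : α) : ℕ := (enc a).size

theorem encSize_pos (a : α) : 0 < encSize a := Data.size_pos _

theorem encSize_prod (x : α × β) : encSize x = 1 + encSize x.1 + encSize x.2 := rfl

@[simp] theorem encSize_nil : encSize ([] : List α) = 1 := rfl

@[simp] theorem encSize_cons (a : α) (l : List α) :
    encSize (a :: l) = 1 + encSize a + encSize l := rfl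

theorem encSize_bool (b : Bool) : encSize b ≤ 3 := by
  cases b <;> simp [encSize, enc, encodeBit, Data.size]

/-- The terminating `nil` of a list is counted twice on the right. -/
theorem encSize_append (l l' : List α) : encSize (l ++ l') + 1 = encSize l + encSize l' := by
  induction l with
  | nil => simp [add_comm]
  | cons a l ih => rw [List.cons_append, encSize_cons, encSize_cons]; omega

@[simp] theorem encSize_reverse (l : List α) : encSize l.reverse = encSize l := by
  induction l with
  | nil => rfl
  | cons a l ih =>
    have := encSize_append l.reverse [a]
    simp only [List.reverse_cons, encSize_cons, encSize_nil] at *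
    omega

theorem encSize_le_of_mem {a : α} {l : List α} (h : a ∈ l) : encSize a ≤ encSize l := by
  induction l with
  | nil => simp at h
  | cons b l ih =>
    rw [encSize_cons]
    rcases List.mem_cons.1 h with rfl | h
    · omega
    · have := ih h; omega

theorem encSize_le_of_sublist {l l' : List α} (h : l.Sublist l') : encSize l ≤ encSize l' := by
  induction h with
  | slnil => rfl
  | cons a _ ih => rw [encSize_cons]; omega
  | cons_cons a _ ih => rw [encSize_cons, encSize_cons]; omega

theorem length_le_encSize (l : List α) : l.length ≤ encSize l := by
  induction l with
  | nil => simp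
  | cons a l ih => rw [encSize_cons, List.length_cons]; omega

theorem encSize_le_of_forall {l : List α} {B : ℕ} (h : ∀ a ∈ l, encSize a ≤ B) :
    encSize l ≤ 1 + l.length * (1 + B) := by
  induction l with
  | nil => simp
  | cons a l ih =>
    have h1 := h a List.mem_cons_self
    have h2 := ih fun b hb => h b (List.mem_cons_of_mem _ hb)
    rw [encSize_cons, List.length_cons, add_mul]
    omega

end

/-! ### Polynomial bounds and computability -/

/-- Problem instances, together with an oracle and a further input for each of them. -/
structure OracleSetting where
  Idx : Type
  oracle : Idx → Set Data
  ctx : Idx → Data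

/-- A bound that is polynomial in the size of the arguments and of the further input. -/
def PolyBound (E : OracleSetting) {α : Type} [DataEncoding α] (T : E.Idx → α → ℕ) : Prop :=
  ∃ P : Polynomial ℕ, ∀ i a, T i a ≤ P.eval (encSize a + (E.ctx i).size)

theorem eval_mono (P : Polynomial ℕ) {m n : ℕ} (h : m ≤ n) : P.eval m ≤ P.eval n := by
  rw [Polynomial.eval_eq_sum_range, Polynomial.eval_eq_sum_range]
  exact Finset.sum_le_sum fun i _ => Nat.mul_le_mul_left _ (Nat.pow_le_pow_left h i)

namespace PolyBound

variable {E : OracleSetting} {α β γ : Type} [DataEncoding α] [DataEncoding β] [DataEncoding γ]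
  {T T' : E.Idx → α → ℕ}

theorem of_le (h : PolyBound E T') (hT : ∀ i a, T i a ≤ T' i a) : PolyBound E T := by
  obtain ⟨P, hP⟩ := h
  exact ⟨P, fun i a => (hT i a).trans (hP i a)⟩

theorem const (c : ℕ) : PolyBound E fun (_ : E.Idx) (_ : α) => c :=
  ⟨Polynomial.C c, fun i a => by simp⟩

theorem add (h : PolyBound E T) (h' : PolyBound E T') : PolyBound E fun i a => T i a + T' i a := by
  obtain ⟨P, hP⟩ := h
  obtain ⟨P', hP'⟩ := h'
  exact ⟨P + P', fun i a => by rw [Polynomial.eval_add]; exact add_le_add (hP i a) (hP' i a)⟩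

theorem mul (h : PolyBound E T) (h' : PolyBound E T') : PolyBound E fun i a => T i a * T' i a := by
  obtain ⟨P, hP⟩ := h
  obtain ⟨P', hP'⟩ := h'
  exact ⟨P * P', fun i a => by rw [Polynomial.eval_mul]; exact Nat.mul_le_mul (hP i a) (hP' i a)⟩

theorem size : PolyBound E fun (_ : E.Idx) (a : α) => encSize a :=
  ⟨Polynomial.X, fun i a => by simp⟩

theorem ctx : PolyBound E fun (i : E.Idx) (_ : α) => (E.ctx i).size :=
  ⟨Polynomial.X, fun i a => by simp⟩

/-- A polynomial bound, over all arguments of polynomial size. -/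
theorem uniform {T : E.Idx → β → ℕ} (h : PolyBound E T) {B : E.Idx → α → ℕ} (hB : PolyBound E B) :
    ∃ T' : E.Idx → α → ℕ, PolyBound E T' ∧ ∀ i a b, encSize b ≤ B i a → T i b ≤ T' i a := by
  obtain ⟨P, hP⟩ := h
  obtain ⟨Q, hQ⟩ := hB
  refine ⟨fun i a => P.eval (Q.eval (encSize a + (E.ctx i).size) + (E.ctx i).size),
    ⟨P.comp (Q + Polynomial.X), fun i a => ?_⟩, fun i a b hb => (hP i b).trans (eval_mono P ?_)⟩
  · simp only [Polynomial.eval_comp, Polynomial.eval_add, Polynomial.eval_X]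
    exact eval_mono P (by omega)
  · have := hQ i a
    omega

theorem comp {T : E.Idx → β → ℕ} (h : PolyBound E T) {f : E.Idx → α → β}
    (hf : PolyBound E fun i a => encSize (f i a)) : PolyBound E fun i a => T i (f i a) := by
  obtain ⟨T', hT', hle⟩ := h.uniform hf
  exact hT'.of_le fun i a => hle i a _ le_rfl

end PolyBound

/-- `p` computes `f`, and leaves the further input in register `1` intact. -/
def Computes (E : OracleSetting) {α β : Type} [DataEncoding α] [DataEncoding β] (p : Program)
    (T : E.Idx → α → ℕ) (f : E.Idx → α → β) : Prop :=
  ∀ i a s, s 0 = enc a → s 1 = E.ctx i →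
    HaltsIn (E.oracle i) p s (T i a) fun s' => s' 0 = enc (f i a) ∧ s' 1 = E.ctx i

/-- Computability in polynomial time. -/
def PolyFun (E : OracleSetting) {α β : Type} [DataEncoding α] [DataEncoding β]
    (f : E.Idx → α → β) : Prop :=
  ∃ p T, PolyBound E T ∧ Computes E p T f

/-- Runs `p` on a copy of register `0`; the result is stored in register `r + 1`. -/
def Program.aside (p : Program) (r : ℕ) : Program :=
  .seq (.copy r 0) (.seq p (.seq (.copy (r + 1) 0) (.copy 0 r)))

/-- The registers `r` and `r + 1` lie beyond those of `p`, so the argument survives the run and the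
result can be kept for later. `2 ≤ r` protects the argument in `0` and the further input in `1`. -/
theorem HaltsIn.aside {E : OracleSetting} {α β : Type} [DataEncoding α] [DataEncoding β]
    {p : Program} {T : E.Idx → α → ℕ} {f : E.Idx → α → β} (hp : Computes E p T f) {r : ℕ}
    (hr : p.bound ≤ r) (h2 : 2 ≤ r) {i : E.Idx} {a : α} {s : Store} (h0 : s 0 = enc a)
    (h1 : s 1 = E.ctx i) :
    HaltsIn (E.oracle i) (p.aside r) s (4 * encSize a + 2 * T i a + 4) fun s' =>
      s' 0 = enc a ∧ s' 1 = E.ctx i ∧ s' (r + 1) = enc (f i a) ∧ s' r = enc a ∧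
      ∀ x, p.bound ≤ x → x ≠ 0 → x ≠ r → x ≠ r + 1 → s' x = s x := by
  have hsz : encSize a = (enc a).size := rfl
  refine HaltsIn.mono (.seq (T := 1 + encSize a) (T' := 3 * encSize a + 2 * T i a + 3) ?_)
    (by omega) fun _ h => h
  refine HaltsIn.mono (HaltsIn.copy ?_) (by rw [h0, hsz]) fun _ h => h
  set s₁ := Function.update s r (s 0) with hs₁
  have e0 : s₁ 0 = enc a := by rw [hs₁, Function.update_of_ne (by omega), h0]
  have e1 : s₁ 1 = E.ctx i := by rw [hs₁, Function.update_of_ne (by omega), h1]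
  have er : s₁ r = enc a := by rw [hs₁, Function.update_self, h0]
  obtain ⟨t, s₂, hrun, ht, ⟨h20, h21⟩, hfr⟩ := (hp i a s₁ e0 e1).frame
  have hsize : (s₂ 0).size ≤ encSize a + T i a := by
    have := hrun.size_le 0
    rw [e0] at this
    omega
  refine HaltsIn.mono (.seq (T := T i a) (T' := 3 * encSize a + T i a + 3)
    ⟨t, s₂, hrun, ht, ?_⟩) (by omega) fun _ h => h
  refine HaltsIn.mono (.seq (.copy (.copy ?_))) ?_ fun _ h => h
  · have hr2 : s₂ r = enc a := by rw [hfr r hr, er]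
    refine ⟨?_, ?_, ?_, ?_, ?_⟩
    · rw [Function.update_self, Function.update_of_ne (by omega), hr2]
    · rw [Function.update_of_ne (by omega), Function.update_of_ne (by omega), h21]
    · rw [Function.update_of_ne (by omega), Function.update_self, h20]
    · rw [Function.update_of_ne (by omega), Function.update_of_ne (by omega), hr2]
    · intro x hx hx0 hxr hxr1
      rw [Function.update_of_ne hx0, Function.update_of_ne hxr1, hfr x hx, hs₁,
        Function.update_of_ne hxr]
  · rw [Function.update_of_ne (by omega), hfr r hr, er, ← hsz]
    omega

namespace PolyFun

variable {E : OracleSetting} {α β γ δ σ : Type} [DataEncoding α] [DataEncoding β] [DataEncoding γ]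
  [DataEncoding δ] [DataEncoding σ]

theorem polyBound {f : E.Idx → α → β} (hf : PolyFun E f) :
    PolyBound E fun i a => encSize (f i a) := by
  obtain ⟨p, T, hT, hp⟩ := hf
  refine (PolyBound.size.add hT).of_le fun i a => ?_
  -- Only registers `0` and `1` are prescribed; any store with these two contents will do.
  let s : Store := fun x => if x = 0 then enc a else E.ctx i
  obtain ⟨t, s', h, ht, h0, -⟩ := hp i a s rfl rfl
  have := h.size_le 0
  rw [h0] at this
  change encSize (f i a) ≤ encSize a + t at this
  omega

/-- Change of types along functions that preserve the encoding. -/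
theorem of_enc {g : E.Idx → γ → δ} (hg : PolyFun E g) {f : E.Idx → α → β} (φ : α → γ)
    (h : ∀ a, enc (φ a) = enc a) (h' : ∀ i a, enc (f i a) = enc (g i (φ a))) : PolyFun E f := by
  obtain ⟨p, T, ⟨P, hP⟩, hp⟩ := hg
  refine ⟨p, fun i a => T i (φ a), ⟨P, fun i a => ?_⟩, fun i a s h0 h1 => ?_⟩
  · have := hP i (φ a)
    rwa [encSize, h a] at this
  · rw [h' i a]
    exact hp i (φ a) s (by rw [h, h0]) h1

protected theorem id : PolyFun E fun (_ : E.Idx) (a : α) => a :=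
  ⟨.copy 2 0, fun _ a => 1 + encSize a, (PolyBound.const 1).add .size, fun i a s h0 h1 =>
    (HaltsIn.copy (by simp [h0, h1])).mono (by rw [h0]; rfl) fun _ h => h⟩

theorem cast {f : E.Idx → α → β} (φ : α → β) (h : ∀ a, enc (φ a) = enc a)
    (hf : ∀ i a, f i a = φ a) : PolyFun E f :=
  (PolyFun.id (α := β)).of_enc φ h fun i a => by rw [hf]

theorem comp {g : E.Idx → β → γ} (hg : PolyFun E g) {f : E.Idx → α → β} (hf : PolyFun E f) :
    PolyFun E fun i a => g i (f i a) := by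
  have hb := hf.polyBound
  obtain ⟨p, T, hT, hp⟩ := hf
  obtain ⟨q, T', hT', hq⟩ := hg
  refine ⟨.seq p q, fun i a => T i a + T' i (f i a), hT.add (hT'.comp hb), fun i a s h0 h1 => ?_⟩
  exact .seq ((hp i a s h0 h1).mono le_rfl fun s' h => hq i _ s' h.1 h.2)

theorem pair {f : E.Idx → α → β} {g : E.Idx → α → γ} (hf : PolyFun E f) (hg : PolyFun E g) :
    PolyFun E fun i a => (f i a, g i a) := by
  have hbf := hf.polyBound
  have hbg := hg.polyBound
  obtain ⟨p, T, hT, hp⟩ := hf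
  obtain ⟨q, T', hT', hq⟩ := hg
  set r := max (max p.bound q.bound) 2 with hr
  refine ⟨.seq (p.aside r) (.seq q (.cons 0 (r + 1) 0)), fun i a =>
    (4 * encSize a + 2 * T i a + 4) + (T' i a + (1 + encSize (f i a) + encSize (g i a))),
    ?_, fun i a s h0 h1 => ?_⟩
  · exact ((((PolyBound.const 4).mul .size).add ((PolyBound.const 2).mul hT)).add (.const 4)).add
      (hT'.add (((PolyBound.const 1).add hbf).add hbg))
  · refine .seq ((HaltsIn.aside hp (by omega) (by omega) h0 h1).mono le_rfl ?_)
    rintro s₁ ⟨h10, h11, h1r, -, -⟩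
    refine .seq ((hq i a s₁ h10 h11).frame.mono le_rfl ?_)
    rintro s₂ ⟨⟨h20, h21⟩, hfr⟩
    have h2r : s₂ (r + 1) = enc (f i a) := by rw [hfr _ (by omega), h1r]
    refine HaltsIn.mono (HaltsIn.cons (x := 0) (y := r + 1) (z := 0) ?_) ?_ fun _ h => h
    · rw [Function.update_self, Function.update_of_ne (by omega), h2r, h20, h21]
      exact ⟨rfl, rfl⟩
    · rw [h2r, h20]
      rfl

theorem fst : PolyFun E fun (_ : E.Idx) (x : α × β) => x.1 :=
  ⟨.head 0 0, fun _ a => 1 + encSize a, (PolyBound.const 1).add .size, fun i a s h0 h1 =>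
    (HaltsIn.head (by simp [h0, h1, enc, Data.head])).mono (by rw [h0]; rfl) fun _ h => h⟩

theorem snd : PolyFun E fun (_ : E.Idx) (x : α × β) => x.2 :=
  ⟨.tail 0 0, fun _ a => 1 + encSize a, (PolyBound.const 1).add .size, fun i a s h0 h1 =>
    (HaltsIn.tail (by simp [h0, h1, enc, Data.tail])).mono (by rw [h0]; rfl) fun _ h => h⟩

/-- The components of a pair that is computed. -/
theorem fst' {f : E.Idx → α → β × γ} (hf : PolyFun E f) : PolyFun E fun i a => (f i a).1 :=
  fst.comp hf

theorem snd' {f : E.Idx → α → β × γ} (hf : PolyFun E f) : PolyFun E fun i a => (f i a).2 :=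
  snd.comp hf

theorem constData (d : Data) : PolyFun E fun (_ : E.Idx) (_ : α) => d := by
  induction d with
  | nil => exact ⟨.setNil 0, fun _ _ => 1, .const 1, fun i a s h0 h1 =>
      HaltsIn.setNil (by simp [h1, enc])⟩
  | cons a b iha ihb => exact (iha.pair ihb).of_enc id (fun _ => rfl) fun _ _ => rfl

theorem const (b : β) : PolyFun E fun (_ : E.Idx) (_ : α) => b :=
  (constData (enc b)).of_enc id (fun _ => rfl) fun _ _ => rfl

/-- Case distinction. -/
theorem cases {c : E.Idx → α → Bool} (hc : PolyFun E c) {f : E.Idx → α → β} {p : α → Prop}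
    {q : α → Prop} (hp : ∀ i a, c i a = true → p a) (hq : ∀ i a, c i a = false → q a)
    (hf : PolyFun E fun i (a : {a // p a}) => f i a.1)
    (hf' : PolyFun E fun i (a : {a // q a}) => f i a.1) : PolyFun E f := by
  classical
  obtain ⟨pc, Tc, hTc, hpc⟩ := hc
  obtain ⟨p₁, T₁, ⟨P₁, hP₁⟩, hp₁⟩ := hf
  obtain ⟨p₂, T₂, ⟨P₂, hP₂⟩, hp₂⟩ := hf'
  set r := max pc.bound 2 with hr
  -- The time bounds `T₁` and `T₂` exist only on the two subtypes; their polynomials make sense for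
  -- all arguments.
  refine ⟨.seq (pc.aside r) (.ifElse (r + 1) p₁ p₂), fun i a =>
    (4 * encSize a + 2 * Tc i a + 4) + (1 + P₁.eval (encSize a + (E.ctx i).size) +
      P₂.eval (encSize a + (E.ctx i).size)), ?_, fun i a s h0 h1 => ?_⟩
  · exact ((((PolyBound.const 4).mul .size).add ((PolyBound.const 2).mul hTc)).add (.const 4)).add
      (((PolyBound.const 1).add ⟨P₁, fun _ _ => le_rfl⟩).add ⟨P₂, fun _ _ => le_rfl⟩)
  · refine .seq ((HaltsIn.aside hpc (by omega) (by omega) h0 h1).mono le_rfl ?_)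
    rintro s₁ ⟨h10, h11, h1r, -, -⟩
    refine .ifElse (fun hne => ?_) (fun he => ?_)
    · have hca : c i a = true := by
        by_contra hca
        rw [Bool.not_eq_true] at hca
        exact hne (by rw [h1r, hca]; rfl)
      exact (hp₁ i ⟨a, hp i a hca⟩ s₁ h10 h11).mono (hP₁ i ⟨a, hp i a hca⟩) fun _ h => h
    · have hca : c i a = false := by
        by_contra hca
        rw [Bool.not_eq_false] at hca
        rw [h1r, hca] at he
        cases he
      exact (hp₂ i ⟨a, hq i a hca⟩ s₁ h10 h11).mono (hP₂ i ⟨a, hq i a hca⟩) fun _ h => h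

theorem val {p : α → Prop} : PolyFun E fun (_ : E.Idx) (a : {a // p a}) => a.1 :=
  cast (fun a => a.1) (fun _ => rfl) fun _ _ => rfl

theorem cond {c : E.Idx → α → Bool} (hc : PolyFun E c) {f g : E.Idx → α → β} (hf : PolyFun E f)
    (hg : PolyFun E g) : PolyFun E fun i a => bif c i a then f i a else g i a := by
  have h1 : PolyFun E fun i (a : Bool × α) => bif a.1 then f i a.2 else g i a.2 := by
    refine cases (c := fun _ a => a.1) (p := fun a => a.1 = true) (q := fun a => a.1 = false) fst
      (fun _ _ h => h) (fun _ _ h => h) ?_ ?_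
    · have := (hf.comp snd).comp (val (E := E) (p := fun a : Bool × α => a.1 = true))
      exact this.of_enc id (fun _ => rfl) fun i a => by simp [a.2]
    · have := (hg.comp snd).comp (val (E := E) (p := fun a : Bool × α => a.1 = false))
      exact this.of_enc id (fun _ => rfl) fun i a => by simp [a.2]
  exact h1.comp (hc.pair .id)

theorem not {c : E.Idx → α → Bool} (hc : PolyFun E c) : PolyFun E fun i a => !(c i a) := by
  have := hc.cond (const (α := α) false) (const (α := α) true)
  convert this using 3 with i a
  cases c i a <;> rfl

theorem and {c d : E.Idx → α → Bool} (hc : PolyFun E c) (hd : PolyFun E d) :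
    PolyFun E fun i a => c i a && d i a := by
  have := hc.cond hd (const (α := α) false)
  convert this using 3 with i a
  cases c i a <;> rfl

theorem or {c d : E.Idx → α → Bool} (hc : PolyFun E c) (hd : PolyFun E d) :
    PolyFun E fun i a => c i a || d i a := by
  have := hc.cond (const (α := α) true) hd
  convert this using 3 with i a
  cases c i a <;> rfl

/-! ### Loops -/

end PolyFun

/-- `n` iterations of `step` lead from the first to the second state, where the loop stops, through
states of size at most `B`. -/
inductive LoopTrace {σ : Type} [DataEncoding σ] (test : σ → Bool) (step : σ → σ) (B : ℕ) :
    ℕ → σ → σ → Prop where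
  | finish {a} : test a = false → encSize a ≤ B → LoopTrace test step B 0 a a
  | step {n a b} : test a = true → encSize a ≤ B → LoopTrace test step B n (step a) b →
      LoopTrace test step B (n + 1) a b

theorem LoopTrace.size_le {σ : Type} [DataEncoding σ] {test : σ → Bool} {step : σ → σ} {B n : ℕ}
    {a b : σ} (h : LoopTrace test step B n a b) : encSize a ≤ B := by
  cases h <;> assumption

namespace PolyFun

variable {E : OracleSetting} {α β γ δ σ : Type} [DataEncoding α] [DataEncoding β] [DataEncoding γ]
  [DataEncoding δ] [DataEncoding σ]

/-- Iterating a polynomial-time step is harmless only if the intermediate states stay small. The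
trace bounds the rounds and all states by `B`, which gives uniform time bounds for test and step.
The test is evaluated before the loop and after each step, because `whileDo` merely inspects a
register. -/
theorem loop {test : E.Idx → σ → Bool} {step : E.Idx → σ → σ} {init f : E.Idx → α → σ}
    (ht : PolyFun E test) (hs : PolyFun E step) (hi : PolyFun E init) {B : E.Idx → α → ℕ}
    (hB : PolyBound E B)
    (h : ∀ i a, ∃ n ≤ B i a, LoopTrace (test i) (step i) (B i a) n (init i a) (f i a)) :
    PolyFun E f := by
  obtain ⟨p₀, T₀, hT₀, hp₀⟩ := hi
  obtain ⟨p, T, hT, hp⟩ := ht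
  obtain ⟨q, T', hT', hq⟩ := hs
  obtain ⟨U, hU, hTU⟩ := hT.uniform hB
  obtain ⟨U', hU', hTU'⟩ := hT'.uniform hB
  set r := max (max p.bound q.bound) 2 with hr
  let V : E.Idx → α → ℕ := fun i a => 4 * B i a + 2 * U i a + 4
  have hV : PolyBound E V :=
    (((PolyBound.const 4).mul hB).add ((PolyBound.const 2).mul hU)).add (.const 4)
  refine ⟨.seq p₀ (.seq (p.aside r) (.whileDo (r + 1) (.seq q (p.aside r)))), fun i a =>
    T₀ i a + (V i a + (B i a * (1 + (U' i a + V i a)) + 1)), hT₀.add (hV.add ((hB.mul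
      ((PolyBound.const 1).add (hU'.add hV))).add (.const 1))), fun i a s h0 h1 => ?_⟩
  have haside : ∀ (b : σ) (s : Store), encSize b ≤ B i a → s 0 = enc b → s 1 = E.ctx i →
      HaltsIn (E.oracle i) (p.aside r) s (V i a) fun s' =>
        s' 0 = enc b ∧ s' 1 = E.ctx i ∧ s' (r + 1) = enc (test i b) := by
    intro b s hb h0 h1
    refine (HaltsIn.aside hp (by omega) (by omega) h0 h1).mono ?_ fun s' h => ⟨h.1, h.2.1, h.2.2.1⟩
    have := hTU i a b hb
    change _ ≤ 4 * B i a + 2 * U i a + 4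
    omega
  have hloop : ∀ (n : ℕ) (b c : σ), LoopTrace (test i) (step i) (B i a) n b c → ∀ s : Store,
      s 0 = enc b → s 1 = E.ctx i → s (r + 1) = enc (test i b) →
      HaltsIn (E.oracle i) (.whileDo (r + 1) (.seq q (p.aside r))) s
        (n * (1 + (U' i a + V i a)) + 1) fun s' => s' 0 = enc c ∧ s' 1 = E.ctx i := by
    intro n b c hbc
    induction hbc with
    | @finish b htest hb =>
      intro s h0 h1 hr
      rw [htest] at hr
      exact (HaltsIn.whileDo_of_eq_nil hr ⟨h0, h1⟩).mono (by omega) fun _ h => h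
    | @step n b c htest hb htrace ih =>
      intro s h0 h1 hr
      rw [htest] at hr
      refine HaltsIn.mono (HaltsIn.whileDo_step (by rw [hr]; exact Data.noConfusion)
        (.seq ((hq i b s h0 h1).mono (hTU' i a b hb) fun s₁ h₁ =>
          (haside (step i b) s₁ ?_ h₁.1 h₁.2).mono le_rfl fun s₂ h₂ =>
            ih s₂ h₂.1 h₂.2.1 h₂.2.2))) ?_ fun _ h => h
      · exact htrace.size_le
      · rw [add_mul, one_mul]
        omega
  obtain ⟨n, hn, htrace⟩ := h i a
  refine .seq ((hp₀ i a s h0 h1).mono le_rfl fun s₀ h₀ => ?_)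
  refine .seq ((haside _ s₀ htrace.size_le h₀.1 h₀.2).mono le_rfl fun s₁ h₁ => ?_)
  refine (hloop n _ _ htrace s₁ h₁.1 h₁.2.1 h₁.2.2).mono ?_ fun _ h => h
  exact Nat.add_le_add_right (Nat.mul_le_mul_right _ hn) 1

/-- A loop with a decreasing potential that bounds the size of the state. -/
theorem loop_of_potential {test : E.Idx → σ → Bool} {step : E.Idx → σ → σ} {f : E.Idx → σ → σ}
    (ht : PolyFun E test) (hs : PolyFun E step) {μ : E.Idx → σ → ℕ} (hμ : PolyBound E μ)
    (hsize : ∀ i a, encSize a ≤ μ i a)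
    (hdec : ∀ i a, test i a = true → μ i (step i a) < μ i a)
    (hf : ∀ i a, test i a = true → f i a = f i (step i a))
    (hf' : ∀ i a, test i a = false → f i a = a) : PolyFun E f := by
  refine loop ht hs .id hμ fun i a => ?_
  have key : ∀ m b, μ i b ≤ m → m ≤ μ i a → ∃ n ≤ m,
      LoopTrace (test i) (step i) (μ i a) n b (f i b) := by
    intro m
    induction m with
    | zero =>
      intro b hb hm
      have := hsize i b
      have := encSize_pos b
      omega
    | succ m ih =>
      intro b hb hm
      cases hb' : test i b with
      | false =>
        refine ⟨0, Nat.zero_le _, ?_⟩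
        rw [hf' i b hb']
        exact .finish hb' ((hsize i b).trans (hb.trans hm))
      | true =>
        obtain ⟨n, hn, htr⟩ := ih (step i b) (by have := hdec i b hb'; omega) (by omega)
        refine ⟨n + 1, by omega, .step hb' ((hsize i b).trans (hb.trans hm)) ?_⟩
        rw [hf i b hb']
        exact htr
  exact key _ a le_rfl le_rfl

/-! ### Lists -/

theorem cons {f : E.Idx → α → β} {g : E.Idx → α → List β} (hf : PolyFun E f) (hg : PolyFun E g) :
    PolyFun E fun i a => f i a :: g i a :=
  (hf.pair hg).of_enc id (fun _ => rfl) fun _ _ => rfl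

theorem isEmptyOfNil : PolyFun E fun (_ : E.Idx) (l : List α) => !l.isEmpty := by
  refine ⟨.ifElse 0 (.seq (.setNil 0) (.cons 0 0 0)) (.setNil 0), fun _ _ => 1 + (1 + 3) + 1,
    .const _, fun i l s h0 h1 => .ifElse (fun h => ?_) (fun h => ?_)⟩
  · cases l with
    | nil => exact absurd h0 h
    | cons a l => exact .seq (.setNil (.mono (.cons (by simp [h1, enc, encodeBit]))
        (by simp [Data.size]) fun _ h => h))
  · cases l with
    | nil => exact .setNil (by simp [h1, enc, encodeBit])
    | cons a l => rw [h] at h0; cases h0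

/-- Case distinction on the second component, a list. -/
theorem listCases {f : E.Idx → α × List β → γ} (h : PolyFun E fun i a => f i (a, []))
    (h' : PolyFun E fun i (x : α × β × List β) => f i (x.1, x.2.1 :: x.2.2)) : PolyFun E f := by
  refine cases (c := fun _ x => !x.2.isEmpty) (p := fun x => x.2 ≠ []) (q := fun x => x.2 = [])
    (isEmptyOfNil.comp snd) (fun _ x h => ?_) (fun _ x h => ?_) ?_ ?_
  · rintro e
    simp [e] at h
  · simpa using h
  · refine h'.of_enc (fun x => (x.1.1, x.1.2.head x.2, x.1.2.tail)) (fun x => ?_) (fun i x => ?_)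
    all_goals
      obtain ⟨⟨a, l⟩, hl⟩ := x
      cases l with
      | nil => exact absurd rfl hl
      | cons b l => rfl
  · refine ((h.comp fst).comp (val (E := E) (p := fun x : α × List β => x.2 = []))).of_enc id
      (fun _ => rfl) fun i x => ?_
    obtain ⟨⟨a, l⟩, hl⟩ := x
    obtain rfl : l = [] := hl
    rfl

/-- The loop state consists of the argument, the accumulator and the unread part of the list.
Accumulators are controlled at every prefix, since their growth could compound. -/
theorem foldl {l : E.Idx → α → List β} {init : E.Idx → α → σ} {f : E.Idx → α → σ → β → σ}
    (hl : PolyFun E l) (hinit : PolyFun E init)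
    (hf : PolyFun E fun i (x : α × σ × β) => f i x.1 x.2.1 x.2.2) {B : E.Idx → α → ℕ}
    (hB : PolyBound E B)
    (h : ∀ i a l', l' <+: l i a → encSize (l'.foldl (f i a) (init i a)) ≤ B i a) :
    PolyFun E fun i a => (l i a).foldl (f i a) (init i a) := by
  let step : E.Idx → (α × σ) × List β → (α × σ) × List β := fun i x => match x.2 with
    | [] => x
    | b :: l' => ((x.1.1, f i x.1.1 x.1.2 b), l')
  have hstep : PolyFun E step := by
    refine listCases (PolyFun.pair .id (const [])) ?_
    have h1 : PolyFun E fun i (x : (α × σ) × β × List β) => f i x.1.1 x.1.2 x.2.1 :=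
      hf.comp ((fst' fst).pair ((snd' fst).pair (fst' snd)))
    exact ((fst' fst).pair h1).pair (snd' snd)
  suffices PolyFun E fun i a => ((a, (l i a).foldl (f i a) (init i a)), ([] : List β)) from
    this.fst'.snd'
  refine loop (test := fun _ x => !x.2.isEmpty) (step := step)
    (init := fun i a => ((a, init i a), l i a)) (isEmptyOfNil.comp snd) hstep
    ((PolyFun.id.pair hinit).pair hl) (B := fun i a => encSize a + B i a + encSize (l i a) + 2)
    (((PolyBound.size.add hB).add hl.polyBound).add (.const 2)) fun i a => ?_
  refine ⟨(l i a).length, by have := length_le_encSize (l i a); omega, ?_⟩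
  have key : ∀ rest done : List β, done ++ rest = l i a →
      LoopTrace (fun x => !x.2.isEmpty) (step i) (encSize a + B i a + encSize (l i a) + 2)
        rest.length ((a, done.foldl (f i a) (init i a)), rest)
        ((a, (l i a).foldl (f i a) (init i a)), []) := by
    intro rest
    induction rest with
    | nil =>
      intro done hd
      rw [List.append_nil] at hd
      rw [← hd]
      refine .finish rfl ?_
      have := h i a done (hd ▸ List.prefix_rfl)
      rw [encSize_prod, encSize_prod, encSize_nil]
      have := encSize_pos done
      simp only
      omega
    | cons b rest ih =>
      intro done hd
      refine .step rfl ?_ ?_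
      · have h1 := h i a done ⟨_, hd⟩
        have h2 := encSize_append done (b :: rest)
        rw [hd] at h2
        have := encSize_pos done
        rw [encSize_prod, encSize_prod]
        simp only
        omega
      · have := ih (done ++ [b]) (by simpa using hd)
        rw [List.foldl_append] at this
        exact this
  exact key (l i a) [] rfl

theorem foldl_bool {l : E.Idx → α → List β} {init : E.Idx → α → Bool}
    {f : E.Idx → α → Bool → β → Bool} (hl : PolyFun E l) (hinit : PolyFun E init)
    (hf : PolyFun E fun i (x : α × Bool × β) => f i x.1 x.2.1 x.2.2) :
    PolyFun E fun i a => (l i a).foldl (f i a) (init i a) :=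
  foldl hl hinit hf (.const 3) fun _ _ _ _ => encSize_bool _

theorem all {l : E.Idx → α → List β} {c : E.Idx → α → β → Bool} (hl : PolyFun E l)
    (hc : PolyFun E fun i (x : α × β) => c i x.1 x.2) :
    PolyFun E fun i a => (l i a).all (c i a) := by
  have : PolyFun E fun i a => (l i a).foldl (fun r b => r && c i a b) true :=
    foldl_bool hl (const true) ((fst' snd).and (hc.comp (fst.pair (snd' snd))))
  convert this using 3 with i a
  have key : ∀ (l : List β) (r : Bool),
      l.foldl (fun r b => r && c i a b) r = (r && l.all (c i a)) := by
    intro l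
    induction l with
    | nil => simp
    | cons b l ih => intro r; rw [List.foldl_cons, ih, List.all_cons, Bool.and_assoc]
  rw [key, Bool.true_and]

theorem any {l : E.Idx → α → List β} {c : E.Idx → α → β → Bool} (hl : PolyFun E l)
    (hc : PolyFun E fun i (x : α × β) => c i x.1 x.2) :
    PolyFun E fun i a => (l i a).any (c i a) := by
  have := (all (c := fun i a b => !(c i a b)) hl hc.not).not
  convert this using 3 with i a
  rw [List.not_all_eq_any_not]
  simp

theorem reverse {l : E.Idx → α → List β} (hl : PolyFun E l) :
    PolyFun E fun i a => (l i a).reverse := by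
  have key : ∀ l acc : List β, l.foldl (fun acc b => b :: acc) acc = l.reverse ++ acc := by
    intro l
    induction l with
    | nil => simp
    | cons b l ih => intro acc; simp [ih]
  have : PolyFun E fun i a => (l i a).foldl (fun acc b => b :: acc) [] := by
    refine foldl hl (const []) ((snd' snd).cons (fst' snd)) hl.polyBound fun i a l' hl' => ?_
    rw [key, List.append_nil, encSize_reverse]
    exact encSize_le_of_sublist hl'.sublist
  convert this using 3 with i a
  rw [key, List.append_nil]

theorem append {l l' : E.Idx → α → List β} (hl : PolyFun E l) (hl' : PolyFun E l') :
    PolyFun E fun i a => l i a ++ l' i a := by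
  have key : ∀ l acc : List β, l.foldl (fun acc b => b :: acc) acc = l.reverse ++ acc := by
    intro l
    induction l with
    | nil => simp
    | cons b l ih => intro acc; simp [ih]
  have : PolyFun E fun i a => (l i a).reverse.foldl (fun acc b => b :: acc) (l' i a) := by
    refine foldl hl.reverse hl' ((snd' snd).cons (fst' snd))
      (hl.polyBound.add hl'.polyBound) fun i a l'' h => ?_
    rw [key]
    have h1 := encSize_append l''.reverse (l' i a)
    have h2 := encSize_le_of_sublist h.sublist
    rw [encSize_reverse] at h1 h2
    omega
  convert this using 3 with i a
  rw [key, List.reverse_reverse]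

theorem map {l : E.Idx → α → List β} {f : E.Idx → α → β → γ} (hl : PolyFun E l)
    (hf : PolyFun E fun i (x : α × β) => f i x.1 x.2) :
    PolyFun E fun i a => (l i a).map (f i a) := by
  have key : ∀ (g : β → γ) (l : List β) (acc : List γ),
      l.foldl (fun acc b => g b :: acc) acc = (l.map g).reverse ++ acc := by
    intro g l
    induction l with
    | nil => simp
    | cons b l ih => intro acc; simp [ih]
  obtain ⟨U, hU, hle⟩ := hf.polyBound.uniform
    ((((PolyBound.const 1).add .size).add hl.polyBound : PolyBound E fun i (a : α) =>
      1 + encSize a + encSize (l i a)))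
  have : PolyFun E fun i a => ((l i a).foldl (fun acc b => f i a b :: acc) []).reverse := by
    refine reverse (foldl hl (const []) ((hf.comp (fst.pair (snd' snd))).cons (fst' snd))
      ((PolyBound.const 1).add (hl.polyBound.mul ((PolyBound.const 1).add hU)))
      fun i a l' hl' => ?_)
    rw [key, List.append_nil, encSize_reverse]
    refine (encSize_le_of_forall (B := U i a) fun c hc => ?_).trans ?_
    · obtain ⟨b, hb, rfl⟩ := List.mem_map.1 hc
      refine hle i a (a, b) ?_
      have := encSize_le_of_mem (hl'.subset hb)
      rw [encSize_prod]
      simp only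
      omega
    · rw [List.length_map]
      have h1 := length_le_encSize (l i a)
      have h2 := hl'.length_le
      exact Nat.add_le_add_left (Nat.mul_le_mul_right _ (h2.trans h1)) 1
  convert this using 3 with i a
  rw [key, List.append_nil, List.reverse_reverse]

theorem flatten {l : E.Idx → α → List (List β)} (hl : PolyFun E l) :
    PolyFun E fun i a => (l i a).flatten := by
  have key : ∀ (l : List (List β)) (acc : List β),
      l.foldl (fun acc b => acc ++ b) acc = acc ++ l.flatten := by
    intro l
    induction l with
    | nil => simp
    | cons b l ih => intro acc; simp [ih]
  have hle : ∀ l : List (List β), encSize l.flatten ≤ encSize l := by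
    intro l
    induction l with
    | nil => simp
    | cons b l ih =>
      have := encSize_append b l.flatten
      rw [List.flatten_cons, encSize_cons]
      omega
  have : PolyFun E fun i a => (l i a).foldl (fun acc b => acc ++ b) [] := by
    refine foldl hl (const []) ((fst' snd).append (snd' snd)) hl.polyBound fun i a l' hl' => ?_
    rw [key, List.nil_append]
    exact (hle l').trans (encSize_le_of_sublist hl'.sublist)
  convert this using 3 with i a
  rw [key, List.nil_append]

theorem flatMap {l : E.Idx → α → List β} {f : E.Idx → α → β → List γ} (hl : PolyFun E l)
    (hf : PolyFun E fun i (x : α × β) => f i x.1 x.2) :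
    PolyFun E fun i a => (l i a).flatMap (f i a) :=
  (hl.map hf).flatten

theorem filter {l : E.Idx → α → List β} {c : E.Idx → α → β → Bool} (hl : PolyFun E l)
    (hc : PolyFun E fun i (x : α × β) => c i x.1 x.2) :
    PolyFun E fun i a => (l i a).filter (c i a) := by
  have : PolyFun E fun i a => (l i a).flatMap fun b => bif c i a b then [b] else [] :=
    hl.flatMap (hc.cond (snd.cons (const [])) (const []))
  convert this using 3 with i a
  induction l i a with
  | nil => rfl
  | cons b l ih =>
    rw [List.filter_cons, List.flatMap_cons, ih]
    cases c i a b <;> rfl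

end PolyFun

namespace PolyFun

variable {E : OracleSetting} {α β γ : Type} [DataEncoding α] [DataEncoding β] [DataEncoding γ]

/-! ### Natural numbers in binary -/

theorem encodeList_headI (l : List Bool) : encodeBit l.headI = (encodeList encodeBit l).head := by
  cases l <;> rfl

theorem encodeList_tail (l : List Bool) :
    encodeList encodeBit l.tail = (encodeList encodeBit l).tail := by
  cases l <;> rfl

/-- The least significant bit comes first, so the head of the code is the parity; for `0` the
default head of `nil` is the code of `false`. -/
theorem bodd : PolyFun E fun (_ : E.Idx) (n : ℕ) => n.bodd := by
  refine ⟨.head 0 0, fun _ a => 1 + encSize a, (PolyBound.const 1).add .size, fun i a s h0 h1 =>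
    (HaltsIn.head ?_).mono (by rw [h0]; rfl) fun _ h => h⟩
  rw [h0]
  simp only [Function.update_self, ne_eq, one_ne_zero, not_false_eq_true, Function.update_of_ne,
    h1, and_true, enc, encodeNat]
  rw [Nat.bodd_eq_bits_head, encodeList_headI]

theorem div2 : PolyFun E fun (_ : E.Idx) (n : ℕ) => n.div2 := by
  refine ⟨.tail 0 0, fun _ a => 1 + encSize a, (PolyBound.const 1).add .size, fun i a s h0 h1 =>
    (HaltsIn.tail ?_).mono (by rw [h0]; rfl) fun _ h => h⟩
  rw [h0]
  simp only [Function.update_self, ne_eq, one_ne_zero, not_false_eq_true, Function.update_of_ne,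
    h1, and_true, enc, encodeNat]
  rw [Nat.div2_bits_eq_tail, encodeList_tail]

end PolyFun

theorem encSize_div2_le (n : ℕ) : encSize n.div2 ≤ encSize n := by
  have : enc n.div2 = (enc n).tail := by
    simp only [enc, encodeNat]
    rw [Nat.div2_bits_eq_tail, PolyFun.encodeList_tail]
  rw [encSize, this]
  exact Data.size_tail_le _

/-- A step of the comparison of two numbers, from the least significant bits on; the last component
is the result for the bits that have been read. -/
def compareStep (x : ℕ × ℕ × Bool) : ℕ × ℕ × Bool :=
  (x.1.div2, x.2.1.div2, bif x.1.bodd then x.2.1.bodd && x.2.2 else x.2.1.bodd || x.2.2)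

/-- A higher bit overrides the verdict on the lower ones unless the two bits agree. The list is only
fuel: it has to be long enough to consume both numbers. -/
theorem compareStep_foldl {β : Type} (l : List β) (a b : ℕ) (r : Bool) (ha : a < 2 ^ l.length)
    (hb : b < 2 ^ l.length) :
    (l.foldl (fun x _ => compareStep x) (a, b, r)).2.2 = (decide (a < b) || (decide (a = b) && r)) := by
  induction l generalizing a b r with
  | nil =>
    simp only [List.length_nil, pow_zero, Nat.lt_one_iff] at ha hb
    subst ha hb
    simp
  | cons c l ih =>
    rw [List.length_cons, pow_succ] at ha hb
    have h1 := Nat.bodd_add_div2 a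
    have h2 := Nat.bodd_add_div2 b
    refine (ih a.div2 b.div2 _ (by omega) (by omega)).trans ?_
    simp only
    cases ha' : a.bodd <;> cases hb' : b.bodd <;> rw [ha'] at h1 <;> rw [hb'] at h2 <;>
      simp only [Bool.toNat_true, Bool.toNat_false] at h1 h2 <;> cases r <;>
      rw [Bool.eq_iff_iff] <;> simp <;> omega

theorem encSize_compareStep_foldl_le {β : Type} (l : List β) (x : ℕ × ℕ × Bool) :
    encSize (l.foldl (fun x _ => compareStep x) x) ≤ encSize x.1 + encSize x.2.1 + 5 := by
  induction l generalizing x with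
  | nil =>
    have := encSize_bool x.2.2
    rw [List.foldl_nil, encSize_prod, encSize_prod]
    omega
  | cons c l ih =>
    have h1 := encSize_div2_le x.1
    have h2 := encSize_div2_le x.2.1
    refine (ih (compareStep x)).trans ?_
    simp only [compareStep]
    omega

namespace PolyFun

variable {E : OracleSetting} {α β γ : Type} [DataEncoding α] [DataEncoding β] [DataEncoding γ]

theorem compareStep : PolyFun E fun (_ : E.Idx) (x : ℕ × ℕ × Bool) => compareStep x := by
  have h1 : PolyFun E fun (_ : E.Idx) (x : ℕ × ℕ × Bool) => x.1.bodd := bodd.comp fst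
  have h2 : PolyFun E fun (_ : E.Idx) (x : ℕ × ℕ × Bool) => x.2.1.bodd := bodd.comp (fst' snd)
  have h3 : PolyFun E fun (_ : E.Idx) (x : ℕ × ℕ × Bool) => x.2.2 := snd' snd
  exact (div2.comp fst).pair ((div2.comp (fst' snd)).pair (h1.cond (h2.and h3) (h2.or h3)))

theorem bits : PolyFun E fun (_ : E.Idx) (n : ℕ) => n.bits :=
  cast Nat.bits (fun _ => rfl) fun _ _ => rfl

theorem natLe {f g : E.Idx → α → ℕ} (hf : PolyFun E f) (hg : PolyFun E g) :
    PolyFun E fun i a => decide (f i a ≤ g i a) := by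
  have h : PolyFun E fun i a => ((f i a).bits ++ (g i a).bits).foldl
      (fun x _ => PolicyLogic.compareStep x) (f i a, g i a, true) :=
    -- The two bit lists together are enough fuel, and the initial verdict `true` turns `<` into
    -- `≤`.
    foldl ((bits.comp hf).append (bits.comp hg)) (hf.pair (hg.pair (const true)))
      (compareStep.comp (fst' snd)) (B := fun i a => encSize (f i a) + encSize (g i a) + 5)
      ((hf.polyBound.add hg.polyBound).add (.const 5))
      fun i a l' _ => encSize_compareStep_foldl_le l' _
  convert h.snd'.snd' using 3 with i a
  have hlt : ∀ n : ℕ, n < 2 ^ n.bits.length := fun n => by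
    rw [Nat.size_eq_bits_len]
    exact Nat.lt_size_self n
  rw [compareStep_foldl _ _ _ _ ((hlt _).trans_le (Nat.pow_le_pow_right two_pos (by simp)))
    ((hlt _).trans_le (Nat.pow_le_pow_right two_pos (by simp))), Bool.and_true, Bool.eq_iff_iff]
  simp [le_iff_lt_or_eq]

theorem natEq {f g : E.Idx → α → ℕ} (hf : PolyFun E f) (hg : PolyFun E g) :
    PolyFun E fun i a => decide (f i a = g i a) := by
  convert (hf.natLe hg).and (hg.natLe hf) using 3 with i a
  rw [Bool.eq_iff_iff]
  simp [le_antisymm_iff]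

/-! ### Tagged values -/

/-- A function that is determined by the payload of the values with a certain tag, and empty on all
other values. -/
theorem ofPayload {t : α → ℕ} {pay : α → Data}
    (h : ∀ a, enc a = .cons (encodeNat (t a)) (pay a)) (k : ℕ) {g : γ → List β}
    (hg : PolyFun E fun (_ : E.Idx) => g) {f : α → List β}
    (hf : ∀ a, t a = k → ∃ c, enc c = pay a ∧ f a = g c) (hf' : ∀ a, t a ≠ k → f a = []) :
    PolyFun E fun (_ : E.Idx) => f := by
  have hsplit : PolyFun E fun (_ : E.Idx) (a : α) => (t a, pay a) :=
    cast _ (fun a => (h a).symm) fun _ _ => rfl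
  refine cases (c := fun _ a => decide (t a = k)) (p := fun a => t a = k) (q := fun a => t a ≠ k)
    (hsplit.fst'.natEq (const k)) (fun _ _ h => by simpa using h) (fun _ _ h => by simpa using h)
    ?_ ?_
  -- The decoded payload is chosen non-constructively, but its code is the payload itself, so it is
  -- obtained by a projection.
  · choose φ hφ hφ' using fun a : {a // t a = k} => hf a.1 a.2
    have h2 : PolyFun E fun (_ : E.Idx) (a : {a // t a = k}) => pay a.1 := hsplit.snd'.comp val
    have h3 : PolyFun E fun (_ : E.Idx) (a : {a // t a = k}) => φ a :=
      h2.of_enc id (fun _ => rfl) fun _ a => hφ a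
    convert hg.comp h3 using 3 with i a
    exact hφ' a
  · convert const (E := E) (α := {a // t a ≠ k}) ([] : List β) using 3 with i a
    exact hf' a.1 a.2

theorem ofTag {t : α → ℕ} {pay : α → Data} (h : ∀ a, enc a = .cons (encodeNat (t a)) (pay a))
    (k : ℕ) : PolyFun E fun (_ : E.Idx) (a : α) => decide (t a = k) := by
  have hsplit : PolyFun E fun (_ : E.Idx) (a : α) => (t a, pay a) :=
    cast _ (fun a => (h a).symm) fun _ _ => rfl
  exact hsplit.fst'.natEq (const k)

end PolyFun

def SimplePL.tag : SimplePL → ℕ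
  | .atom _ => 0
  | .bot => 1
  | .interval _ _ _ => 2
  | .ex _ _ => 3
  | .inter _ _ => 4

theorem SimplePL.encode_eq (C : SimplePL) :
    enc C = .cons (encodeNat C.tag) C.encode.tail := by
  cases C <;> rfl

/-- The two conjuncts of an intersection. -/
def SimplePL.parts : SimplePL → List SimplePL
  | .inter C D => [C, D]
  | _ => []

def PLAxiom.tag : PLAxiom → ℕ
  | .funcRole _ => 0
  | .funcProp _ => 1
  | .range _ _ => 2
  | .sub _ _ => 3
  | .disj _ _ => 4

theorem PLAxiom.encode_eq (α : PLAxiom) :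
    enc α = .cons (encodeNat α.tag) α.encode.tail := by
  cases α <;> rfl

namespace PolyFun

variable {E : OracleSetting} {α β γ : Type} [DataEncoding α] [DataEncoding β] [DataEncoding γ]

theorem singleton : PolyFun E fun (_ : E.Idx) (a : α) => [a] := PolyFun.id.cons (const [])

theorem isBot : PolyFun E fun (_ : E.Idx) (C : SimplePL) => C.isBot := by
  convert ofTag (E := E) SimplePL.encode_eq 1 using 3 with i C
  cases C <;> rfl

theorem atomNames : PolyFun E fun (_ : E.Idx) (C : SimplePL) => C.atomNames := by
  refine ofPayload SimplePL.encode_eq 0 (singleton (α := ℕ)) (fun C hC => ?_) fun C hC => ?_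
  · cases C <;> simp only [SimplePL.tag] at hC <;> first | omega | exact ⟨_, rfl, rfl⟩
  · cases C <;> first | rfl | exact absurd rfl hC

theorem successors : PolyFun E fun (_ : E.Idx) (C : SimplePL) => C.successors := by
  refine ofPayload SimplePL.encode_eq 3 (singleton (α := ℕ × SimplePL)) (fun C hC => ?_)
    fun C hC => ?_
  · cases C <;> simp only [SimplePL.tag] at hC <;> first | omega | exact ⟨(_, _), rfl, rfl⟩
  · cases C <;> first | rfl | exact absurd rfl hC

theorem parts : PolyFun E fun (_ : E.Idx) (C : SimplePL) => C.parts := by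
  refine ofPayload SimplePL.encode_eq 4 (γ := SimplePL × SimplePL)
    (g := fun x => [x.1, x.2]) (cons fst (cons snd (const []))) (fun C hC => ?_) fun C hC => ?_
  · cases C <;> simp only [SimplePL.tag] at hC <;> first | omega | exact ⟨(_, _), rfl, rfl⟩
  · cases C <;> first | rfl | exact absurd rfl hC

theorem intervals : PolyFun E fun (_ : E.Idx) (C : SimplePL) => C.intervals := by
  -- The payload is a list of three numbers; its final `nil` is the code of the `Unit` component.
  refine ofPayload SimplePL.encode_eq 2 (γ := ℕ × ℕ × ℕ × Unit)
    (g := fun x => [(x.1, x.2.1, x.2.2.1)])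
    (singleton.comp (fst.pair ((fst' snd).pair (fst' (snd' snd))))) (fun C hC => ?_) fun C hC => ?_
  · cases C <;> simp only [SimplePL.tag] at hC <;>
      first | omega | exact ⟨(_, _, _, ()), rfl, rfl⟩
  · cases C <;> first | rfl | exact absurd rfl hC

theorem functionalRoles : PolyFun E fun (_ : E.Idx) (α : PLAxiom) => α.functionalRoles := by
  refine ofPayload PLAxiom.encode_eq 0 (singleton (α := ℕ)) (fun C hC => ?_) fun C hC => ?_
  · cases C <;> simp only [PLAxiom.tag] at hC <;> first | omega | exact ⟨_, rfl, rfl⟩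
  · cases C <;> first | rfl | exact absurd rfl hC

theorem functionalProperties :
    PolyFun E fun (_ : E.Idx) (α : PLAxiom) => α.functionalProperties := by
  refine ofPayload PLAxiom.encode_eq 1 (singleton (α := ℕ)) (fun C hC => ?_) fun C hC => ?_
  · cases C <;> simp only [PLAxiom.tag] at hC <;> first | omega | exact ⟨_, rfl, rfl⟩
  · cases C <;> first | rfl | exact absurd rfl hC

theorem ranges : PolyFun E fun (_ : E.Idx) (α : PLAxiom) => α.ranges := by
  refine ofPayload PLAxiom.encode_eq 2 (γ := ℕ × ℕ × Unit) (g := fun x => [(x.1, x.2.1)])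
    (singleton.comp (fst.pair (fst' snd))) (fun C hC => ?_) fun C hC => ?_
  · cases C <;> simp only [PLAxiom.tag] at hC <;> first | omega | exact ⟨(_, _, ()), rfl, rfl⟩
  · cases C <;> first | rfl | exact absurd rfl hC

theorem atom : PolyFun E fun (_ : E.Idx) (A : ℕ) => SimplePL.atom A :=
  ((const 0).pair .id).of_enc id (fun _ => rfl) fun _ _ => rfl

/-! ### The tableau -/

/-- A worklist of pending concepts: an intersection is replaced by its two parts, anything else
moves to the front of the accumulator. This explains the reversal in `allConjuncts`. -/
theorem allConjuncts :
    PolyFun E fun (_ : E.Idx) (L : List SimplePL) => allConjuncts L := by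
  have hstep : PolyFun E fun (_ : E.Idx) (x : List SimplePL × List SimplePL) =>
      match x.2 with
      | [] => x
      | C :: L => (bif !C.parts.isEmpty then x.1 else C :: x.1, C.parts ++ L) := by
    refine listCases (PolyFun.id.pair (const [])) ?_
    have h1 : PolyFun E fun (_ : E.Idx) (x : List SimplePL × SimplePL × List SimplePL) =>
        x.2.1.parts := parts.comp (fst' snd)
    exact ((isEmptyOfNil.comp h1).cond fst ((fst' snd).cons fst)).pair (h1.append (snd' snd))
  have hloop : PolyFun E fun (_ : E.Idx) (x : List SimplePL × List SimplePL) =>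
      ((x.2.flatMap SimplePL.conjuncts).reverse ++ x.1, ([] : List SimplePL)) := by
    refine loop_of_potential (test := fun _ x => !x.2.isEmpty)
      -- Pending concepts count double, so that moving one to the accumulator lowers the potential;
      -- splitting an intersection sheds its tag.
      (μ := fun _ x => 2 * encSize x.2 + encSize x.1 + 1) (isEmptyOfNil.comp snd) hstep
      ((((PolyBound.const 2).mul snd.polyBound).add fst.polyBound).add (.const 1)) ?_ ?_ ?_ ?_
    · intro _ x
      rw [encSize_prod]
      omega
    · rintro _ ⟨D, _ | ⟨C, L⟩⟩ h
      · simp at h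
      · simp only
        have := encSize_pos C
        cases C with
        | inter A B =>
          have : encSize (A.inter B) = 1 + encSize (4 : ℕ) + (1 + encSize A + encSize B) := rfl
          have := encSize_pos (4 : ℕ)
          simp only [SimplePL.parts, List.isEmpty_cons, Bool.not_false, cond_true, List.cons_append,
            List.nil_append, encSize_cons]
          omega
        | _ =>
          simp only [SimplePL.parts, List.isEmpty_nil, Bool.not_true, cond_false,
            List.nil_append, encSize_cons]
          omega
    · rintro _ ⟨D, _ | ⟨C, L⟩⟩ h
      · simp at h
      · cases C <;> simp [SimplePL.parts, SimplePL.conjuncts]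
    · rintro _ ⟨D, _ | ⟨C, L⟩⟩ h
      · rfl
      · simp at h
  convert (hloop.comp ((const []).pair .id)).fst' using 3 with i L
  exact (List.append_nil _).symm

theorem encSize_distinct_aux_le (l acc : List ℕ) :
    encSize (l.foldl (fun acc a => bif acc.any (fun b => decide (b = a)) then acc else a :: acc) acc)
      ≤ encSize l + encSize acc := by
  induction l generalizing acc with
  | nil => simp
  | cons a l ih =>
    rw [List.foldl_cons]
    refine (ih _).trans ?_
    rw [encSize_cons]
    cases acc.any (fun b => decide (b = a))
    · rw [cond_false, encSize_cons]
      omega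
    · rw [cond_true]
      omega

theorem distinct : PolyFun E fun (_ : E.Idx) (l : List ℕ) => distinct l := by
  refine foldl (l := fun _ l => l) (init := fun _ _ => ([] : List ℕ))
    (f := fun _ _ acc a => bif acc.any (fun b => decide (b = a)) then acc else a :: acc)
    .id (const _) ?_ (B := fun _ l => encSize l + 1) (PolyBound.size.add (.const 1)) ?_
  · have h1 : PolyFun E fun (_ : E.Idx) (x : List ℕ × List ℕ × ℕ) => x.2.1 := fst' snd
    have h2 : PolyFun E fun (_ : E.Idx) (x : List ℕ × List ℕ × ℕ) => x.2.2 := snd' snd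
    exact (any (c := fun _ x b => decide (b = x.2.2)) h1 (snd.natEq (h2.comp fst))).cond h1
      (h2.cons h1)
  · intro _ l l' hl'
    have h1 := encSize_distinct_aux_le l' []
    have h2 := encSize_le_of_sublist hl'.sublist
    rw [encSize_nil] at h1
    omega

theorem isFunctionalRole {K : E.Idx → PLKB}
    (hK : PolyFun E fun i (_ : Unit) => K i) : PolyFun E fun i (R : ℕ) => (K i).isFunctionalRole R :=
  any (c := fun _ R R' => decide (R' = R))
    (flatMap (f := fun _ _ α => α.functionalRoles) (hK.comp (const ())) (functionalRoles.comp snd))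
    (snd.natEq fst)

theorem isFunctionalProperty {K : E.Idx → PLKB}
    (hK : PolyFun E fun i (_ : Unit) => K i) : PolyFun E fun i (f : ℕ) => (K i).isFunctionalProperty f :=
  any (c := fun _ R R' => decide (R' = R))
    (flatMap (f := fun _ _ α => α.functionalProperties) (hK.comp (const ()))
      (functionalProperties.comp snd))
    (snd.natEq fst)

theorem rangeAtoms {K : E.Idx → PLKB}
    (hK : PolyFun E fun i (_ : Unit) => K i) : PolyFun E fun i (R : ℕ) => (K i).rangeAtoms R :=
  map (f := fun _ _ p => SimplePL.atom p.2) (filter (c := fun _ R p => decide (p.1 = R))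
    (flatMap (f := fun _ _ α => α.ranges) (hK.comp (const ())) (ranges.comp snd))
    ((fst' snd).natEq fst)) (atom.comp (snd' snd))

theorem locallyConsistent {K : E.Idx → PLKB}
    (hK : PolyFun E fun i (_ : Unit) => K i) {q : E.Idx → Query → Bool}
    (hq : PolyFun E q) :
    PolyFun E fun i (N : List SimplePL) => locallyConsistent (K i) (q i) N := by
  have hquery : PolyFun E fun (_ : E.Idx) (x : List ℕ × List ℕ) => (⟨x.1, x.2⟩ : Query) :=
    cast _ (fun _ => rfl) fun _ _ => rfl
  have h1 : PolyFun E fun (_ : E.Idx) (N : List SimplePL) => N.any SimplePL.isBot :=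
    any (c := fun _ _ (C : SimplePL) => C.isBot) .id (isBot.comp snd)
  have h2 : PolyFun E fun (_ : E.Idx) (N : List SimplePL) => N.flatMap SimplePL.atomNames :=
    flatMap (f := fun _ _ (C : SimplePL) => C.atomNames) .id (atomNames.comp snd)
  have h3 : PolyFun E fun (_ : E.Idx) (N : List SimplePL) => N.flatMap SimplePL.intervals :=
    flatMap (f := fun _ _ (C : SimplePL) => C.intervals) .id (intervals.comp snd)
  have h4 : PolyFun E fun i (N : List SimplePL) =>
      (N.flatMap SimplePL.atomNames).filter fun A => q i ⟨[A], [A]⟩ :=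
    filter (c := fun i _ A => q i ⟨[A], [A]⟩) h2
      (hq.comp (hquery.comp ((singleton.comp snd).pair (singleton.comp snd))))
  have h5 : PolyFun E fun (_ : E.Idx) (N : List SimplePL) =>
      (N.flatMap SimplePL.intervals).all fun p => decide (p.2.1 ≤ p.2.2) :=
    all (c := fun _ _ p => decide (p.2.1 ≤ p.2.2)) h3 ((fst' (snd' snd)).natLe (snd' (snd' snd)))
  have h6 : PolyFun E fun i (x : (List SimplePL × (ℕ × ℕ × ℕ)) × (ℕ × ℕ × ℕ)) =>
      (!(decide (x.1.2.1 = x.2.1) && (K i).isFunctionalProperty x.1.2.1)) ||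
        decide (x.1.2.2.1 ≤ x.2.2.2) :=
    (((fst' (snd' fst)).natEq (fst' snd)).and
      ((isFunctionalProperty hK).comp (fst' (snd' fst)))).not.or
      ((fst' (snd' (snd' fst))).natLe (snd' (snd' snd)))
  have h7 : PolyFun E fun i (N : List SimplePL) => (N.flatMap SimplePL.intervals).all fun p =>
      (N.flatMap SimplePL.intervals).all fun p' =>
        (!(decide (p.1 = p'.1) && (K i).isFunctionalProperty p.1)) || decide (p.2.1 ≤ p'.2.2) :=
    all (c := fun i N p => (N.flatMap SimplePL.intervals).all fun p' =>
      (!(decide (p.1 = p'.1) && (K i).isFunctionalProperty p.1)) || decide (p.2.1 ≤ p'.2.2)) h3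
      (all (c := fun i (x : List SimplePL × (ℕ × ℕ × ℕ)) p' => (!(decide (x.2.1 = p'.1) && (K i).isFunctionalProperty x.2.1)) ||
        decide (x.2.2.1 ≤ p'.2.2)) (h3.comp fst) h6)
  exact h1.not.and ((hq.comp (hquery.comp (h4.pair (const [])))).not.and (h5.and h7))

theorem requiredSuccessors {K : E.Idx → PLKB}
    (hK : PolyFun E fun i (_ : Unit) => K i) :
    PolyFun E fun i (N : List SimplePL) => requiredSuccessors (K i) N := by
  have h1 : PolyFun E fun (_ : E.Idx) (N : List SimplePL) => N.flatMap SimplePL.successors :=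
    flatMap (f := fun _ _ (C : SimplePL) => C.successors) .id (successors.comp snd)
  have h2 : PolyFun E fun i (x : List SimplePL × (ℕ × SimplePL)) =>
      (K i).isFunctionalRole x.2.1 := (isFunctionalRole hK).comp (fst' snd)
  have h3 : PolyFun E fun i (N : List SimplePL) => ((N.flatMap SimplePL.successors).filter fun p =>
      !((K i).isFunctionalRole p.1)).map (fun p => (p.1, p.2 :: (K i).rangeAtoms p.1)) :=
    map (f := fun i _ p => (p.1, p.2 :: (K i).rangeAtoms p.1))
      (filter (c := fun i _ p => !((K i).isFunctionalRole p.1)) h1 h2.not)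
      ((fst' snd).pair ((snd' snd).cons ((rangeAtoms hK).comp (fst' snd))))
  have h4 : PolyFun E fun i (N : List SimplePL) =>
      PolicyLogic.distinct (((N.flatMap SimplePL.successors).filter fun p =>
        (K i).isFunctionalRole p.1).map Prod.fst) :=
    distinct.comp (map (f := fun _ _ p => p.1)
      (filter (c := fun i _ p => (K i).isFunctionalRole p.1) h1 h2) (fst' snd))
  have h5 : PolyFun E fun i (x : List SimplePL × ℕ) =>
      (x.2, ((x.1.flatMap SimplePL.successors).filter fun p => decide (p.1 = x.2)).map Prod.snd ++
        (K i).rangeAtoms x.2) :=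
    snd.pair ((map (f := fun _ _ p => p.2) (filter (c := fun _ x p => decide (p.1 = x.2))
      (h1.comp fst) ((fst' snd).natEq (snd' fst))) (snd' snd)).append ((rangeAtoms hK).comp snd))
  exact h3.append (map (f := fun i N R =>
    (R, ((N.flatMap SimplePL.successors).filter fun p => decide (p.1 = R)).map Prod.snd ++
      (K i).rangeAtoms R)) h4 h5)

end PolyFun

/-! ## The potential of the tableau -/

/-- The number of existential concepts. -/
def SimplePL.numEx : SimplePL → ℕ
  | .ex _ C => C.numEx + 1
  | .inter C D => C.numEx + D.numEx
  | _ => 0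

theorem SimplePL.numEx_le_encSize (C : SimplePL) : C.numEx ≤ encSize C := by
  induction C with
  | ex R C ih =>
    have : encSize (SimplePL.ex R C) = 1 + encSize (3 : ℕ) + (1 + encSize R + encSize C) := rfl
    rw [numEx]
    omega
  | inter C D ihC ihD =>
    have : encSize (C.inter D) = 1 + encSize (4 : ℕ) + (1 + encSize C + encSize D) := rfl
    rw [numEx]
    omega
  | _ => exact Nat.zero_le _

/-- The weight of a concept, where `B` is paid for each existential concept. -/
def SimplePL.weight (B : ℕ) (C : SimplePL) : ℕ := encSize C + B * C.numEx

theorem SimplePL.sum_weight_conjuncts_le (B : ℕ) (C : SimplePL) :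
    (C.conjuncts.map (weight B)).sum ≤ C.weight B := by
  induction C with
  | inter C D ihC ihD =>
    have : encSize (C.inter D) = 1 + encSize (4 : ℕ) + (1 + encSize C + encSize D) := rfl
    rw [conjuncts, List.map_append, List.sum_append]
    rw [weight] at *
    rw [numEx, mul_add]
    omega
  | _ => simp [conjuncts]

theorem SimplePL.sum_successors_le (B : ℕ) (C : SimplePL) :
    (C.successors.map fun p => p.2.weight B + B + 1).sum ≤ C.weight B := by
  cases C with
  | ex R C =>
    have : encSize (SimplePL.ex R C) = 1 + encSize (3 : ℕ) + (1 + encSize R + encSize C) := rfl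
    simp only [successors, List.map_cons, List.map_nil, List.sum_cons, List.sum_nil, weight, numEx,
      mul_add, mul_one]
    omega
  | _ => simp [successors]

theorem sum_flatMap_le {α β : Type} {f : α → List β} {g : β → ℕ} {h : α → ℕ} (l : List α)
    (hle : ∀ a, ((f a).map g).sum ≤ h a) : ((l.flatMap f).map g).sum ≤ (l.map h).sum := by
  induction l with
  | nil => simp
  | cons a l ih =>
    rw [List.flatMap_cons, List.map_append, List.sum_append, List.map_cons, List.sum_cons]
    exact add_le_add (hle a) ih

theorem sum_filter_add_sum_filter_not {α : Type} (l : List α) (p : α → Bool) (g : α → ℕ) :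
    ((l.filter p).map g).sum + ((l.filter fun a => !(p a)).map g).sum = (l.map g).sum := by
  induction l with
  | nil => simp
  | cons a l ih =>
    cases h : p a <;> simp [h] <;> omega

/-- Different roles select disjoint parts of the list, so no filler is charged twice. -/
theorem sum_filter_fst_le {β : Type} (g : ℕ × β → ℕ) {rs : List ℕ} (hrs : rs.Nodup)
    (l : List (ℕ × β)) :
    (rs.map fun r => ((l.filter fun p => decide (p.1 = r)).map g).sum).sum ≤ (l.map g).sum := by
  induction rs generalizing l with
  | nil => simp
  | cons r rs ih =>
    rw [List.nodup_cons] at hrs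
    have h1 := sum_filter_add_sum_filter_not l (fun p => decide (p.1 = r)) g
    have h2 := ih hrs.2 (l.filter fun p => !decide (p.1 = r))
    have h3 : (rs.map fun r' => (((l.filter fun p => !decide (p.1 = r)).filter
        fun p => decide (p.1 = r')).map g).sum) =
        rs.map fun r' => ((l.filter fun p => decide (p.1 = r')).map g).sum := by
      refine List.map_congr_left fun r' hr' => ?_
      rw [List.filter_filter]
      congr 3
      ext p
      have hne : r' ≠ r := fun h => hrs.1 (h ▸ hr')
      by_cases hp : p.1 = r'
      · simp [hp, hne]
      · simp [hp]
    rw [h3] at h2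
    rw [List.map_cons, List.sum_cons]
    omega

theorem nodup_distinct (l : List ℕ) : (distinct l).Nodup := by
  have key : ∀ (l acc : List ℕ), acc.Nodup → (l.foldl (fun acc a =>
      bif acc.any (fun b => decide (b = a)) then acc else a :: acc) acc).Nodup := by
    intro l
    induction l with
    | nil => exact fun _ h => h
    | cons a l ih =>
      intro acc h
      rw [List.foldl_cons]
      refine ih _ ?_
      cases ha : acc.any (fun b => decide (b = a)) with
      | true => exact h
      | false =>
        refine List.nodup_cons.2 ⟨fun hm => ?_, h⟩
        simp only [List.any_eq_false, decide_eq_true_eq] at ha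
        exact ha a hm rfl
  exact key l [] List.nodup_nil

/-- The potential of a label of the tableau. -/
def potential (B : ℕ) (L : List SimplePL) : ℕ := 2 + (L.map fun C => 1 + C.weight B).sum

/-- Each range atom is charged to its axiom in `K`. Atoms contain no existential, so the bound does
not depend on `B` and allows `B` to be fixed from `K` alone. -/
theorem sum_rangeAtoms_le (K : PLKB) (R B : ℕ) :
    2 + ((K.rangeAtoms R).map fun C => 1 + C.weight B).sum ≤ 1 + encSize K := by
  induction K with
  | nil => simp [PLKB.rangeAtoms]
  | cons α K ih =>
    have hcons : PLKB.rangeAtoms (α :: K) R =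
        (α.ranges.filter fun p => decide (p.1 = R)).map (fun p => .atom p.2) ++
          PLKB.rangeAtoms K R := by
      simp [PLKB.rangeAtoms]
    have hα : (((α.ranges.filter fun p => decide (p.1 = R)).map fun p => SimplePL.atom p.2).map
        fun C => 1 + C.weight B).sum ≤ 1 + encSize α := by
      cases α with
      | range R' A =>
        have h1 : encSize (PLAxiom.range R' A) =
          1 + encSize (2 : ℕ) + (1 + encSize R' + (1 + encSize A + 1)) := rfl
        have h2 : encSize (SimplePL.atom A) = 1 + 1 + encSize A := rfl
        by_cases h : R' = R
        · subst h
          simp only [PLAxiom.ranges, decide_true, List.filter_cons_of_pos, List.filter_nil,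
            List.map_cons, List.map_nil, List.sum_cons, List.sum_nil, SimplePL.weight,
            SimplePL.numEx]
          omega
        · simp [PLAxiom.ranges, h]
      | _ => simp [PLAxiom.ranges]
    rw [hcons, List.map_append, List.sum_append, encSize_cons]
    omega

theorem sum_potential_requiredSuccessors_le (K : PLKB) (N : List SimplePL) {B : ℕ}
    (hB : 1 + encSize K ≤ B) :
    ((requiredSuccessors K N).map fun c => potential B c.2).sum ≤
      (N.map (SimplePL.weight B)).sum := by
  set S := N.flatMap SimplePL.successors with hS
  refine le_trans ?_ (sum_flatMap_le N (SimplePL.sum_successors_le B))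
  rw [← hS, ← sum_filter_add_sum_filter_not S (fun p => K.isFunctionalRole p.1), add_comm]
  rw [requiredSuccessors, List.map_append, List.sum_append, ← hS]
  have hrange : ∀ R, 2 + ((K.rangeAtoms R).map fun C => 1 + C.weight B).sum ≤ B := fun R =>
    (sum_rangeAtoms_le K R B).trans hB
  refine add_le_add ?_ ?_
  · rw [List.map_map]
    refine List.sum_le_sum fun p _ => ?_
    have := hrange p.1
    simp only [Function.comp_apply, potential, List.map_cons, List.sum_cons]
    omega
  · refine le_trans ?_ (sum_filter_fst_le (fun p => p.2.weight B + B + 1)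
      (nodup_distinct ((S.filter fun p => K.isFunctionalRole p.1).map Prod.fst))
      (S.filter fun p => K.isFunctionalRole p.1))
    rw [List.map_map]
    refine List.sum_le_sum fun R hR => ?_
    rw [mem_distinct, List.mem_map] at hR
    obtain ⟨p, hp, rfl⟩ := hR
    have hfilter : (S.filter fun p => K.isFunctionalRole p.1).filter (fun p' => decide (p'.1 = p.1))
        = S.filter fun p' => decide (p'.1 = p.1) := by
      rw [List.filter_filter]
      congr 1
      ext p'
      by_cases h : p'.1 = p.1
      · simp [h, (List.mem_filter.1 hp).2]
      · simp [h]
    rw [hfilter, Function.comp_apply]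
    have hmem : p ∈ S.filter fun p' => decide (p'.1 = p.1) :=
      List.mem_filter.2 ⟨(List.mem_filter.1 hp).1, by simp⟩
    have hr := hrange p.1
    -- The list of fillers for this functional role is nonempty, and the surplus `B` of its first
    -- member already pays for the range atoms of the merged label.
    generalize S.filter (fun p' => decide (p'.1 = p.1)) = S' at hmem
    cases S' with
    | nil => simp at hmem
    | cons p' S' =>
      have h1 : ((S'.map Prod.snd).map fun C => 1 + C.weight B).sum ≤
          (S'.map fun p => p.2.weight B + B + 1).sum := by
        rw [List.map_map]
        refine List.sum_le_sum fun p _ => ?_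
        simp only [Function.comp_apply]
        omega
      simp only [List.map_cons, List.cons_append, potential, List.map_append, List.sum_append,
        List.sum_cons]
      omega

/-- Replacing a label by all its successors loses potential, strictly because of the constant `2`.
So the whole tableau tree, and not only each branch, has polynomial size. -/
theorem sum_potential_lt (K : PLKB) (L : List SimplePL) {B : ℕ} (hB : 1 + encSize K ≤ B) :
    ((requiredSuccessors K (allConjuncts L)).map fun c => potential B c.2).sum < potential B L := by
  have h1 := sum_potential_requiredSuccessors_le K (allConjuncts L) hB
  have h2 : ((allConjuncts L).map (SimplePL.weight B)).sum ≤ (L.map (SimplePL.weight B)).sum := by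
    rw [allConjuncts, List.map_reverse, List.sum_reverse]
    exact sum_flatMap_le L (SimplePL.sum_weight_conjuncts_le B)
  have h3 : (L.map (SimplePL.weight B)).sum ≤ (L.map fun C => 1 + C.weight B).sum :=
    List.sum_le_sum fun C _ => by omega
  rw [potential]
  omega

theorem encSize_succ_le_potential (B : ℕ) (L : List SimplePL) : 1 + encSize L ≤ potential B L := by
  induction L with
  | nil => simp [potential]
  | cons C L ih =>
    simp only [potential, List.map_cons, List.sum_cons, encSize_cons] at *
    have : encSize C ≤ C.weight B := Nat.le_add_right _ _
    omega

theorem potential_le (B : ℕ) (L : List SimplePL) : potential B L ≤ (1 + B) * (1 + encSize L) := by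
  induction L with
  | nil =>
    simp [potential]
  | cons C L ih =>
    simp only [potential, List.map_cons, List.sum_cons, encSize_cons] at *
    have h1 : C.weight B ≤ (1 + B) * encSize C := by
      rw [SimplePL.weight, add_mul, one_mul]
      exact Nat.add_le_add_left (Nat.mul_le_mul_left _ C.numEx_le_encSize) _
    have h2 : (1 + B) * (1 + (1 + encSize C + encSize L)) =
      (1 + B) + (1 + B) * encSize C + (1 + B) * (1 + encSize L) := by ring
    omega

theorem encSize_le_sum_potential (B : ℕ) (W : List (List SimplePL)) :
    encSize W ≤ 1 + (W.map (potential B)).sum := by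
  induction W with
  | nil => simp
  | cons L W ih =>
    have := encSize_succ_le_potential B L
    rw [encSize_cons, List.map_cons, List.sum_cons]
    omega

theorem sum_potential_le (B : ℕ) (W : List (List SimplePL)) :
    (W.map (potential B)).sum ≤ (1 + B) * encSize W := by
  induction W with
  | nil => simp
  | cons L W ih =>
    have := potential_le B L
    rw [encSize_cons, List.map_cons, List.sum_cons, mul_add]
    omega

/-! ## The tableau in polynomial time -/

theorem consistent_iff {K : PLKB} {q : Query → Bool} {L : List SimplePL} :
    Consistent K q L ↔ locallyConsistent K q (allConjuncts L) = true ∧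
      ∀ c ∈ requiredSuccessors K (allConjuncts L), Consistent K q c.2 :=
  ⟨fun h => by cases h with | intro _ h1 h2 => exact ⟨h1, h2⟩, fun h => .intro L h.1 h.2⟩

-- The recursion is flattened into a worklist of labels with a Boolean accumulator. A failure does
-- not stop the loop, so the final value is the conjunction of all local tests.
open Classical in
theorem PolyFun.consistent {E : OracleSetting} {K : E.Idx → PLKB} {q : E.Idx → Query → Bool}
    (hK : PolyFun E fun i (_ : Unit) => K i) (hq : PolyFun E q) :
    PolyFun E fun i (L : List SimplePL) => decide (Consistent (K i) (q i) L) := by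
  have hstep : PolyFun E fun i (x : Bool × List (List SimplePL)) =>
      match x.2 with
      | [] => x
      | L :: W => (x.1 && PolicyLogic.locallyConsistent (K i) (q i) (PolicyLogic.allConjuncts L),
          (PolicyLogic.requiredSuccessors (K i) (PolicyLogic.allConjuncts L)).map Prod.snd ++ W) := by
    refine listCases (PolyFun.id.pair (const [])) ?_
    have h1 : PolyFun E fun (_ : E.Idx) (x : Bool × List SimplePL × List (List SimplePL)) =>
        PolicyLogic.allConjuncts x.2.1 := allConjuncts.comp (fst' snd)
    exact (fst.and ((locallyConsistent hK hq).comp h1)).pair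
      ((map (f := fun _ _ c => c.2) ((requiredSuccessors hK).comp h1) (snd' snd)).append (snd' snd))
  have hloop : PolyFun E fun i (x : Bool × List (List SimplePL)) =>
      (x.1 && x.2.all fun L => decide (Consistent (K i) (q i) L), ([] : List (List SimplePL))) := by
    have hB : PolyBound E fun i (_ : Bool × List (List SimplePL)) => 1 + encSize (K i) :=
      (PolyBound.const 1).add (hK.comp (const ())).polyBound
    refine loop_of_potential (test := fun _ x => !x.2.isEmpty)
      -- In the size of the state, `5` covers the pair node, at most three nodes for the Boolean,
      -- and the final `nil` of the worklist.
      (μ := fun i x => 5 + (x.2.map (potential (1 + encSize (K i)))).sum)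
      (isEmptyOfNil.comp snd) hstep (((PolyBound.const 5).add (((PolyBound.const 1).add hB).mul
        snd.polyBound)).of_le fun i x => Nat.add_le_add_left (sum_potential_le _ _) _) ?_ ?_ ?_ ?_
    · intro i x
      have h1 := encSize_bool x.1
      have h2 := encSize_le_sum_potential (1 + encSize (K i)) x.2
      rw [encSize_prod]
      omega
    · rintro i ⟨b, _ | ⟨L, W⟩⟩ h
      · simp at h
      · have := sum_potential_lt (K i) L (B := 1 + encSize (K i)) le_rfl
        simp only [List.map_append, List.map_map, List.sum_append, List.map_cons, List.sum_cons]
        exact Nat.add_lt_add_left (Nat.add_lt_add_right this _) 5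
    · rintro i ⟨b, _ | ⟨L, W⟩⟩ h
      · simp at h
      · simp only [List.all_cons, List.all_append, Prod.mk.injEq, and_true]
        rw [Bool.eq_iff_iff]
        simp only [Bool.and_eq_true, decide_eq_true_eq, List.all_eq_true, List.mem_map,
          forall_exists_index, and_imp, forall_apply_eq_imp_iff₂]
        rw [consistent_iff]
        tauto
    · rintro i ⟨b, _ | ⟨L, W⟩⟩ h
      · simp
      · simp at h
  convert (hloop.comp ((const true).pair ((singleton (α := List SimplePL))))).fst' using 3 with i L
  simp

open Classical in
theorem PolyFun.exists_consistent {E : OracleSetting} {K : E.Idx → PLKB}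
    {q : E.Idx → Query → Bool} (hK : PolyFun E fun i (_ : Unit) => K i) (hq : PolyFun E q) :
    PolyFun E fun i (C : List SimplePL) => C.any fun D => decide (Consistent (K i) (q i) [D]) :=
  any (c := fun i _ D => decide (Consistent (K i) (q i) [D])) .id
    ((consistent hK hq).comp (singleton.comp snd))

/-! ## From computable functions to decision problems -/

/-- The program `p` brings the input into the form assumed by `PolyFun`: argument in register `0`,
further input in register `1`. -/
theorem polyTimeDecidable_of_polyFun {α γ : Type} [DataEncoding γ] {encode : α → Data}
    {oracle : α → Set Data} {promise L : α → Prop} (ctx : α → Data) (c : α → γ) (p : Program)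
    (P : Polynomial ℕ)
    (hp : ∀ a, promise a → HaltsIn (oracle a) p (startStore (encode a)) (P.eval (encode a).size)
      fun s => s 0 = enc (c a) ∧ s 1 = ctx a)
    {f : {a // promise a} → γ → Bool}
    (hf : PolyFun ⟨{a // promise a}, fun a => oracle a.1, fun a => ctx a.1⟩ f)
    (hL : ∀ a (h : promise a), f ⟨a, h⟩ (c a) = true ↔ L a) :
    PolyTimeDecidable encode oracle promise L := by
  obtain ⟨q, T, ⟨Q, hQ⟩, hq⟩ := hf
  -- After `p`, registers `0` and `1` have sizes at most `n + P(n)` and `1 + P(n)`, where `n` is the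
  -- size of the input; hence `X + 2P + 1`.
  refine ⟨.seq p q, P + Q.comp (Polynomial.X + 2 * P + 1), fun a ha => ?_⟩
  obtain ⟨t, s, hrun, ht, h0, h1⟩ := hp a ha
  obtain ⟨t', s', hrun', ht', h0', -⟩ := hq ⟨a, ha⟩ (c a) s h0 h1
  refine ⟨t + t', s', hrun.seq hrun', ?_, ?_⟩
  · rw [Polynomial.eval_add, Polynomial.eval_comp]
    refine add_le_add ht ((ht'.trans (hQ _ _)).trans (eval_mono Q ?_))
    have e0 := hrun.size_le 0
    have e1 := hrun.size_le 1
    rw [h0] at e0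
    rw [h1] at e1
    have e2 : (startStore (encode a) 0).size = (encode a).size := by simp [startStore]
    have e3 : (startStore (encode a) 1).size = 1 := by simp [startStore, Data.size]
    simp only [Polynomial.eval_add, Polynomial.eval_mul, Polynomial.eval_X, Polynomial.eval_ofNat,
      Polynomial.eval_one]
    change encSize (c a) ≤ _ at e0
    change encSize (c a) + (ctx a).size ≤ _
    omega
  · rw [h0', ← hL a ha]
    cases f ⟨a, ha⟩ (c a) <;> simp [enc, encodeBit]

/-! ## The oracle -/

theorem encodeBit_injective : Function.Injective encodeBit := by
  intro a b h
  cases a <;> cases b <;> simp_all [encodeBit]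

theorem encodeList_injective {α : Type} {e : α → Data} (he : Function.Injective e) :
    Function.Injective (encodeList e) := by
  intro l l' h
  induction l generalizing l' with
  | nil => cases l' <;> simp_all [encodeList]
  | cons a l ih =>
    cases l' with
    | nil => simp [encodeList] at h
    | cons b l' =>
      simp only [encodeList, Data.cons.injEq] at h
      rw [he h.1, ih h.2]

theorem bits_injective : Function.Injective Nat.bits := by
  intro m
  induction m using Nat.strong_induction_on with
  | _ m ih =>
    intro n h
    have h1 : m.bodd = n.bodd := by rw [Nat.bodd_eq_bits_head, Nat.bodd_eq_bits_head, h]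
    have h2 : m.div2.bits = n.div2.bits := by rw [Nat.div2_bits_eq_tail, Nat.div2_bits_eq_tail, h]
    have h3 := Nat.bodd_add_div2 m
    have h4 := Nat.bodd_add_div2 n
    rcases Nat.eq_zero_or_pos m with rfl | hm
    · rcases Nat.eq_zero_or_pos n with rfl | hn
      · rfl
      · have : n.size = 0 := by rw [← Nat.size_eq_bits_len, ← h]; rfl
        rw [Nat.size_eq_zero.1 this]
    · rw [ih m.div2 (by omega) h2, h1] at h3
      omega

theorem encodeNats_injective : Function.Injective encodeNats :=
  encodeList_injective ((encodeList_injective encodeBit_injective).comp bits_injective)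

/-- The oracle is an image under the encoding; injectivity ensures that it contains the code of a
query only if the query itself is in `pos`. -/
theorem Query.encode_injective : Function.Injective Query.encode := by
  rintro ⟨l, r⟩ ⟨l', r'⟩ h
  simp only [Query.encode, Data.cons.injEq] at h
  rw [encodeNats_injective h.1, encodeNats_injective h.2]

/-- A query instruction computes the answers of the oracle. -/
theorem PolyFun.posAnswer_of_oracle {ι : Type} (π : ι → Problem) (ctx : ι → Data) :
    PolyFun ⟨ι, fun i => (π i).posOracle, ctx⟩ fun i (Q : Query) =>
      posAnswer (π i).K (π i).O Q := by
  refine ⟨.query 0 0, fun _ Q => 1 + encSize Q, (PolyBound.const 1).add .size,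
    fun i Q s h0 h1 => (HaltsIn.query ?_).mono (by rw [h0]; rfl) fun _ h => h⟩
  rw [Function.update_self, Function.update_of_ne one_ne_zero, h0]
  refine ⟨?_, h1⟩
  change encodeBit _ = encodeBit _
  congr 1
  exact decide_eq_decide.2 Query.encode_injective.mem_set_image

/-! ## Simulation of the oracle by a decision procedure -/

/-- Clears the registers `1`, …, `n + 1`. -/
def Program.clear : ℕ → Program
  | 0 => .setNil 1
  | n + 1 => .seq (Program.clear n) (.setNil (n + 2))

theorem HaltsIn.clear {Ω : Set Data} (n : ℕ) (s : Store) :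
    HaltsIn Ω (Program.clear n) s (n + 1) fun s' =>
      ∀ x, s' x = if 1 ≤ x ∧ x ≤ n + 1 then .nil else s x := by
  induction n with
  | zero =>
    refine .setNil fun x => ?_
    by_cases hx : x = 1
    · simp [hx]
    · rw [Function.update_of_ne hx, if_neg (by omega)]
  | succ n ih =>
    refine .seq (ih.mono le_rfl fun s' h => .setNil fun x => ?_)
    by_cases hx : x = n + 2
    · rw [hx, Function.update_self, if_pos (by omega)]
    · rw [Function.update_of_ne hx, h]
      by_cases h' : 1 ≤ x ∧ x ≤ n + 1
      · rw [if_pos h', if_pos (by omega)]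
      · rw [if_neg h', if_neg (by omega)]

-- The ontology is read from the further input, which is saved while `M` runs. Clearing the
-- registers recreates the start store as far as `M` can see. The final test turns acceptance, that
-- is any tree other than `nil`, into the code of a Boolean.
open Classical in
theorem PolyFun.of_tractable {𝓛 : Set SRIQKB} (h𝓛 : Tractable 𝓛) {ι : Type} (O : ι → SRIQKB)
    (hO : ∀ i, O i ∈ 𝓛) (d : ι → Data) :
    PolyFun ⟨ι, fun _ => ∅, fun i => .cons (d i) (SRIQKB.encode (O i))⟩ fun i (Q : Query) =>
      decide (Q ∈ (O i).pos) := by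
  obtain ⟨M, R, hM⟩ := h𝓛
  -- Clearing affects the registers `1` to `M.bound + 1`; `r` is the first one beyond them and
  -- beyond the reach of `M`.
  set r := M.bound + 2 with hr
  let E : OracleSetting := ⟨ι, fun _ => ∅, fun i => .cons (d i) (SRIQKB.encode (O i))⟩
  let T : E.Idx → Query → ℕ := fun i Q =>
    R.eval (1 + encSize Q + (E.ctx i).size) + 4 * (E.ctx i).size + encSize Q + M.bound + 11
  have hT : PolyBound E T := by
    refine PolyBound.add (.add (.add (.add ⟨R.comp (1 + Polynomial.X), fun i Q => ?_⟩
      ((PolyBound.const 4).mul .ctx)) .size) (.const _)) (.const _)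
    rw [Polynomial.eval_comp]
    simp [add_assoc]
  refine ⟨.seq (.copy r 1) (.seq (.tail 1 1) (.seq (.cons 0 1 0) (.seq (.clear M.bound) (.seq M
    (.seq (.copy 1 r) (.ifElse 0 (.seq (.setNil 0) (.cons 0 0 0)) (.setNil 0))))))), T, hT,
    fun i Q s h0 h1 => ?_⟩
  set c : Data := .cons (d i) (SRIQKB.encode (O i)) with hc
  have hctx : E.ctx i = c := rfl
  change s 1 = c at h1
  have hQ : (s 0).size = encSize Q := by rw [h0]; rfl
  have hOc : (SRIQKB.encode (O i)).size ≤ c.size := by simp only [hc, Data.size]; omega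
  have hx : (Data.cons (SRIQKB.encode (O i)) (Query.encode Q)).size ≤ 1 + encSize Q + c.size := by
    have : encSize Q = (Query.encode Q).size := rfl
    simp only [Data.size]
    omega
  obtain ⟨t, s₁, hrun, ht, hacc⟩ := hM (O i, Q) (hO i)
  have ht' := ht.trans (eval_mono R hx)
  refine HaltsIn.mono (T := (1 + c.size) + ((1 + c.size) + ((1 + c.size + encSize Q) +
    ((M.bound + 1) + (t + ((1 + c.size) + (1 + (1 + 3) + 1))))))) (Q := fun s' =>
      s' 0 = enc (decide (Q ∈ (O i).pos)) ∧ s' 1 = c) ?_ ?_ fun _ h => h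
  · refine .seq (HaltsIn.mono (.copy ?_) (by rw [h1]) fun _ h => h)
    refine .seq (HaltsIn.mono (.tail ?_)
      (by rw [Function.update_of_ne (by omega), h1]) fun _ h => h)
    refine .seq (HaltsIn.mono (.cons ?_) ?_ fun _ h => h)
    · refine .seq ((HaltsIn.clear _ _).mono le_rfl fun s₂ h₂ => ?_)
      have hs₂ : ∀ x < r, s₂ x =
          startStore (.cons (SRIQKB.encode (O i)) (Query.encode Q)) x := by
        intro x hx
        rw [h₂]
        by_cases hx0 : x = 0
        · subst hx0
          rw [if_neg (by omega)]
          simp [startStore, h0, h1, hc, Data.tail, Function.update_of_ne (show 1 ≠ r by omega)]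
          rfl
        · rw [if_pos (by omega)]
          simp [startStore, hx0]
      have hs₂r : s₂ r = c := by
        rw [h₂, if_neg (by omega), Function.update_of_ne (by omega),
          Function.update_of_ne (by omega), Function.update_self, h1]
      obtain ⟨s₃, hrun₃, hs₃⟩ := hrun.congr (n := r) (by omega) hs₂
      refine .seq ⟨t, s₃, hrun₃, le_rfl, ?_⟩
      have hs₃r : s₃ r = c := by rw [hrun₃.eq_of_bound_le (by omega), hs₂r]
      refine .seq (HaltsIn.mono (.copy ?_) (by rw [hs₃r]) fun _ h => h)
      have e0 : Function.update s₃ 1 (s₃ r) 0 = s₁ 0 := by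
        rw [Function.update_of_ne (by omega), hs₃ 0 (by omega)]
      refine .ifElse (fun hne => ?_) (fun he => ?_)
      · rw [e0, hacc] at hne
        refine .seq (.setNil (HaltsIn.mono (.cons ?_) (by simp [Data.size]) fun _ h => h))
        simp [hs₃r, enc, encodeBit, hne]
      · rw [e0] at he
        have hne : Q ∉ (O i).pos := fun h => hacc.2 h he
        exact .setNil (by simp [hs₃r, enc, encodeBit, hne])
    · rw [Function.update_self, Function.update_of_ne (by omega), Function.update_of_ne (by omega),
        Function.update_of_ne (by omega), hQ, h1]
      have : c.tail.size ≤ c.size := c.size_tail_le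
      omega
  · simp only [T, hctx]
    omega

/-! ## Computation of the extended ontology -/

instance : DataEncoding SRIQConcept := ⟨SRIQConcept.encode⟩

namespace PolyFun

variable {E : OracleSetting}

theorem gciAtoms : PolyFun E fun (_ : E.Idx) (x : ℕ × ℕ × Unit) =>
    [SRIQAxiom.gci (.atom x.1) (.atom x.2.1)] :=
  -- The zeros are constructor tags: of the inclusion and of its two atoms.
  singleton.comp (((const 0).pair (((const 0).pair fst).pair ((const 0).pair (fst' snd)))).of_enc id
    (fun _ => rfl) fun _ _ => rfl)

theorem gciDisjoint : PolyFun E fun (_ : E.Idx) (x : ℕ × ℕ × Unit) =>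
    [SRIQAxiom.gci (.inter (.atom x.1) (.atom x.2.1)) .bot] :=
  singleton.comp (((const 0).pair (((const 3).pair (((const 0).pair fst).pair
    ((const 0).pair (fst' snd)))).pair (const SRIQConcept.bot))).of_enc id
    (fun _ => rfl) fun _ _ => rfl)

theorem shift : PolyFun E fun (_ : E.Idx) (α : PLAxiom) => α.shift.toList := by
  have h1 : PolyFun E fun (_ : E.Idx) (α : PLAxiom) =>
      match α with
      | .sub A B => [SRIQAxiom.gci (.atom A) (.atom B)]
      | _ => [] := by
    refine ofPayload PLAxiom.encode_eq 3 gciAtoms (fun α h => ?_) fun α h => ?_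
    · cases α <;> simp only [PLAxiom.tag] at h <;> first | omega | exact ⟨(_, _, ()), rfl, rfl⟩
    · cases α <;> first | rfl | exact absurd rfl h
  have h2 : PolyFun E fun (_ : E.Idx) (α : PLAxiom) =>
      match α with
      | .disj A B => [SRIQAxiom.gci (.inter (.atom A) (.atom B)) .bot]
      | _ => [] := by
    refine ofPayload PLAxiom.encode_eq 4 gciDisjoint (fun α h => ?_) fun α h => ?_
    · cases α <;> simp only [PLAxiom.tag] at h <;> first | omega | exact ⟨(_, _, ()), rfl, rfl⟩
    · cases α <;> first | rfl | exact absurd rfl h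
  convert h1.append h2 using 3 with i α
  cases α <;> rfl

theorem shifted : PolyFun E fun (_ : E.Idx) (x : PLKB × SRIQKB) => shifted x.1 x.2 := by
  convert append (E := E) (α := PLKB × SRIQKB) snd
    (flatMap (f := fun _ _ α => PLAxiom.shift α |>.toList) fst (shift.comp snd)) using 3 with i x
  rw [PolicyLogic.shifted, List.filterMap_eq_flatMap_toList]

end PolyFun

/-! ## The main theorem -/

theorem polyTimeDecidable_satisfiable_posOracle :
    PolyTimeDecidable Problem.encodeWithoutOntology Problem.posOracle
      (fun π => Admissible π.K π.O π.C) (fun π => Satisfiable π.K π.O π.C) := by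
  classical
  let A := {π : Problem // Admissible π.K π.O π.C}
  have hK : PolyFun ⟨A, fun π => π.1.posOracle, fun π => PLKB.encode π.1.K⟩
      fun π (_ : Unit) => π.1.K :=
    ⟨.copy 0 1, fun π _ => 1 + (PLKB.encode π.1.K).size, (PolyBound.const 1).add .ctx,
      fun π _ s _ h1 => (HaltsIn.copy (by simp [h1]; rfl)).mono (by rw [h1]) fun _ h => h⟩
  refine polyTimeDecidable_of_polyFun (fun π => PLKB.encode π.K) (fun π => (π.C : List SimplePL))
    (.seq (.head 1 0) (.tail 0 0)) (2 * Polynomial.X + 2) (fun π _ => ?_)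
    (PolyFun.exists_consistent hK (PolyFun.posAnswer_of_oracle (fun π : A => π.1) _))
    fun π hπ => ?_
  · refine HaltsIn.mono (.seq (.head (.tail ?_))) ?_ fun _ h => h
    · simp [startStore, Problem.encodeWithoutOntology, Data.head, Data.tail]
      rfl
    · simp [startStore]
      omega
  · rw [satisfiable_iff_exists_consistent hπ]
    simp

/-- `O⁺_K` is computed once, before the tableau starts, and stored next to `K` in the further input,
from which every simulated query reads it. -/
theorem polyTimeDecidable_satisfiable_of_tractable {𝓛 : Set SRIQKB} (h𝓛 : Tractable 𝓛) :
    PolyTimeDecidable Problem.encode (fun _ => ∅)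
      (fun π => Admissible π.K π.O π.C ∧ shifted π.K π.O ∈ 𝓛)
      (fun π => Satisfiable π.K π.O π.C) := by
  classical
  let A := {π : Problem // Admissible π.K π.O π.C ∧ shifted π.K π.O ∈ 𝓛}
  let ctx : Problem → Data := fun π => .cons (PLKB.encode π.K) (SRIQKB.encode (shifted π.K π.O))
  have hK : PolyFun ⟨A, fun _ => ∅, fun π => ctx π.1⟩ fun π (_ : Unit) => π.1.K :=
    ⟨.head 0 1, fun π _ => 1 + (ctx π.1).size, (PolyBound.const 1).add .ctx,
      fun π _ s _ h1 => (HaltsIn.head (by simp [h1]; rfl)).mono (by rw [h1]) fun _ h => h⟩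
  -- At this stage the whole instance is the argument and the further input is empty, in agreement
  -- with register `1` of the start store. Its size `1` is the summand in `X + 1` below.
  have hpre : PolyFun ⟨Unit, fun _ => ∅, fun _ => .nil⟩ fun _ (x : PLKB × SRIQKB × PLConcept) =>
      ((x.1, shifted x.1 x.2.1), x.2.2) :=
    (PolyFun.fst.pair (PolyFun.shifted.comp (PolyFun.fst.pair (PolyFun.snd.fst')))).pair
      PolyFun.snd.snd'
  obtain ⟨p, T, ⟨P, hP⟩, hp⟩ := hpre
  refine polyTimeDecidable_of_polyFun ctx (fun π => (π.C : List SimplePL))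
    (.seq p (.seq (.head 1 0) (.tail 0 0)))
    (P.comp (Polynomial.X + 1) + (2 * (Polynomial.X + P.comp (Polynomial.X + 1)) + 2))
    (fun π _ => ?_)
    (PolyFun.exists_consistent hK
      (PolyFun.of_tractable h𝓛 (fun π : A => shifted π.1.K π.1.O) (fun π => π.2.2) _))
    fun π hπ => ?_
  · obtain ⟨t, s, hrun, ht, h0, -⟩ := hp () (π.K, π.O, π.C) (startStore π.encode)
      (by simp [startStore]; rfl) (by simp [startStore])
    have hP' := hP () (π.K, π.O, π.C)
    have hsz : encSize (π.K, π.O, π.C) = π.encode.size := rfl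
    have hnil : Data.nil.size = 1 := rfl
    rw [hsz, hnil] at hP'
    have hsize := hrun.size_le 0
    have hstart : (startStore π.encode 0).size = π.encode.size := by simp [startStore]
    refine HaltsIn.mono (.seq ⟨t, s, hrun, le_rfl, .seq (.head (.tail ?_))⟩) ?_ fun _ h => h
    · rw [Function.update_self, Function.update_of_ne one_ne_zero, Function.update_self,
        Function.update_of_ne zero_ne_one, h0]
      exact ⟨rfl, rfl⟩
    · rw [Function.update_of_ne zero_ne_one]
      simp only [Polynomial.eval_add, Polynomial.eval_mul, Polynomial.eval_comp, Polynomial.eval_X,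
        Polynomial.eval_ofNat, Polynomial.eval_one]
      omega
  · rw [satisfiable_iff_exists_consistent hπ.1]
    simp only [List.any_eq_true, decide_eq_true_eq]
    exact Iff.rfl

end PolicyLogic

/-- Unsatisfiability of a PL concept is characterized by rewriting to `⊥`; satisfiability is
decidable in polynomial time with the oracle `pos(O⁺_K)`, and in polynomial time without any oracle
if `O⁺_K` ranges over a tractable logic. -/
theorem mainTheorem12 :
    (∀ (K : PLKB) (O : SRIQKB) (C : PLConcept), Admissible K O C →
      (¬ Satisfiable K O C ↔
        ∀ D ∈ C, Relation.ReflTransGen (Rewrites K O) D SimplePL.bot)) ∧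
    PolyTimeDecidable Problem.encodeWithoutOntology Problem.posOracle
      (fun π => Admissible π.K π.O π.C)
      (fun π => Satisfiable π.K π.O π.C) ∧
    (∀ 𝓛 : Set SRIQKB, Tractable 𝓛 →
      PolyTimeDecidable Problem.encode (fun _ => ∅)
        (fun π => Admissible π.K π.O π.C ∧ shifted π.K π.O ∈ 𝓛)
        (fun π => Satisfiable π.K π.O π.C)) := by
  exact ⟨fun _ _ _ h => not_satisfiable_iff_refuted h, polyTimeDecidable_satisfiable_posOracle,
    fun _ h => polyTimeDecidable_satisfiable_of_tractable h⟩
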